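/- Theorem. Over $\mathsf{RCA}_0$, Helly's selection theorem $\mathsf{HST}$ for the space $BV=BV([0,1])$, coded as below, is equivalent to $\mathsf{ACA}_0$; that is, in every (not necessarily standard) model of $\mathsf{RCA}_0$, $\mathsf{HST}$ holds if and only if the axioms of $\mathsf{ACA}_0$ hold. Here $\mathsf{HST}$ is the following statement of second-order arithmetic. A point of $L_1([0,1])$ is a sequence $(p_k)_k$ of (codes of) rational polynomials with $\|p_k-p_{k+1}\|_1\le 2^{-k}$ for all $k$, where $\|p\|_1=\int_0^1|p(x)|\,dx$; its norm is $\lim_k\|p_k\|_1$, and the distance of two points $(p_k)_k,(q_k)_k$ is $\lim_k\|p_k-q_k\|_1$. A point of $BV$ is a point $(p_k)_k$ of $L_1([0,1])$ together with a rational $v$, its bound on the variation, such that $\int_0^1|p_k'(x)|\,dx\le v$ for all $k$. $\mathsf{HST}$ says: for every sequence $(f_n)_n$ of points of $BV$ with bounds on the variation $v_n$, and all rationals $u,v$ such that $\|f_n\|_1\le u$ and $v_n\le v$ for all $n$, there are a point $f$ of $BV$ with bound on the variation $v$ and a strictly increasing function $g$ such that $f_{g(n)}\to f$ in $L_1$ as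 $n\to\infty$. -/

import Mathlib

universe u

/-! ## Second-order arithmetic -/

namespace SOA

/-- A structure for the (two-sorted) language of second-order arithmetic: a first-order part
`Num` with `0, 1, +, ·, <`, and a non-empty family `sets` of subsets of `Num` over which the set
variables range.  `Num` need not be the standard natural numbers. -/
structure L2Structure where
  Num : Type u
  sets : Set (Set Num)
  sets_nonempty : sets.Nonempty
  zero : Num
  one : Num
  add : Num → Num → Num
  mul : Num → Num → Num
  lt : Num → Num → Prop

/-- Numerical terms; number variables are de Bruijn indices. -/
inductive Term : Type where
  | var : ℕ → Term
  | zero : Term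
  | one : Term
  | add : Term → Term → Term
  | mul : Term → Term → Term

/-- Arithmetical formulas (no set quantifiers), with free set variables `X_0, X_1, …`.
A quantifier binds the number variable with index `0` and shifts the others.
`ball t φ` is the bounded quantifier `∀ x < t, φ`, where `t` does not mention `x`. -/
inductive Formula : Type where
  | eq : Term → Term → Formula
  | lt : Term → Term → Formula
  | mem : Term → ℕ → Formula
  | not : Formula → Formula
  | and : Formula → Formula → Formula
  | ball : Term → Formula → Formula
  | all : Formula → Formula

/-- `Σ⁰₀` formulas: all quantifiers are bounded. -/
def Formula.IsBounded : Formula → Prop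
  | .eq _ _ => True
  | .lt _ _ => True
  | .mem _ _ => True
  | .not φ => φ.IsBounded
  | .and φ ψ => φ.IsBounded ∧ ψ.IsBounded
  | .ball _ φ => φ.IsBounded
  | .all _ => False

/-- The existential number quantifier. -/
def Formula.ex (φ : Formula) : Formula := .not (.all (.not φ))

/-- `Σ⁰₁` formulas: `∃ x, θ` with `θ` bounded. -/
def Formula.IsSigma01 (φ : Formula) : Prop := ∃ θ : Formula, θ.IsBounded ∧ φ = θ.ex

/-- `Π⁰₁` formulas: `∀ x, θ` with `θ` bounded. -/
def Formula.IsPi01 (φ : Formula) : Prop := ∃ θ : Formula, θ.IsBounded ∧ φ = .all θ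

/-- The number assignment `v` with `a` put in front. -/
def scons {α : Type u} (a : α) (v : ℕ → α) : ℕ → α
  | 0 => a
  | n + 1 => v n

namespace L2Structure

variable (𝔐 : L2Structure.{u})

instance : Zero 𝔐.Num := ⟨𝔐.zero⟩
instance : One 𝔐.Num := ⟨𝔐.one⟩
instance : Add 𝔐.Num := ⟨𝔐.add⟩
instance : Mul 𝔐.Num := ⟨𝔐.mul⟩
instance : LT 𝔐.Num := ⟨𝔐.lt⟩
instance : LE 𝔐.Num := ⟨fun a b => a < b ∨ a = b⟩

/-- Value of a term under an assignment of the number variables. -/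
def val (v : ℕ → 𝔐.Num) : Term → 𝔐.Num
  | .var i => v i
  | .zero => 0
  | .one => 1
  | .add s t => val v s + val v t
  | .mul s t => val v s * val v t

/-- Tarskian satisfaction of an arithmetical formula, under an assignment `E` of sets of the
structure to the set variables and `v` of numbers to the number variables. -/
def Sat (E : ℕ → 𝔐.sets) : Formula → (ℕ → 𝔐.Num) → Prop
  | .eq s t, v => 𝔐.val v s = 𝔐.val v t
  | .lt s t, v => 𝔐.val v s < 𝔐.val v t
  | .mem t i, v => 𝔐.val v t ∈ (E i : Set 𝔐.Num)
  | .not φ, v => ¬ Sat E φ v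
  | .and φ ψ, v => Sat E φ v ∧ Sat E ψ v
  | .ball t φ, v => ∀ a : 𝔐.Num, a < 𝔐.val v t → Sat E φ (scons a v)
  | .all φ, v => ∀ a : 𝔐.Num, Sat E φ (scons a v)

/-- The basic axioms of second-order arithmetic. -/
structure Basic : Prop where
  succ_ne_zero : ∀ n : 𝔐.Num, n + 1 ≠ 0
  succ_inj : ∀ m n : 𝔐.Num, m + 1 = n + 1 → m = n
  add_zero : ∀ m : 𝔐.Num, m + 0 = m
  add_succ : ∀ m n : 𝔐.Num, m + (n + 1) = (m + n) + 1
  mul_zero : ∀ m : 𝔐.Num, m * 0 = 0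
  mul_succ : ∀ m n : 𝔐.Num, m * (n + 1) = m * n + m
  not_lt_zero : ∀ m : 𝔐.Num, ¬ m < 0
  lt_succ : ∀ m n : 𝔐.Num, m < n + 1 ↔ (m < n ∨ m = n)

/-- `𝔐` is a model of `RCA₀`: basic axioms, `Σ⁰₁` induction and `Δ⁰₁` comprehension,
both schemes with number and set parameters. -/
structure IsRCA0 : Prop where
  basic : 𝔐.Basic
  sigma01_induction : ∀ φ : Formula, φ.IsSigma01 → ∀ (E : ℕ → 𝔐.sets) (v : ℕ → 𝔐.Num),
    𝔐.Sat E φ (scons 0 v) →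
    (∀ n : 𝔐.Num, 𝔐.Sat E φ (scons n v) → 𝔐.Sat E φ (scons (n + 1) v)) →
    ∀ n : 𝔐.Num, 𝔐.Sat E φ (scons n v)
  delta01_comprehension : ∀ φ ψ : Formula, φ.IsSigma01 → ψ.IsPi01 →
    ∀ (E : ℕ → 𝔐.sets) (v : ℕ → 𝔐.Num),
    (∀ n : 𝔐.Num, 𝔐.Sat E φ (scons n v) ↔ 𝔐.Sat E ψ (scons n v)) →
    {n : 𝔐.Num | 𝔐.Sat E φ (scons n v)} ∈ 𝔐.sets

/-- `𝔐` is a model of `ACA₀`: basic axioms, the induction axiom and comprehension for all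
arithmetical formulas with number and set parameters. -/
structure IsACA0 : Prop where
  basic : 𝔐.Basic
  induction : ∀ X ∈ 𝔐.sets, (0 : 𝔐.Num) ∈ X → (∀ n ∈ X, n + 1 ∈ X) → ∀ n : 𝔐.Num, n ∈ X
  arithmetical_comprehension : ∀ (φ : Formula) (E : ℕ → 𝔐.sets) (v : ℕ → 𝔐.Num),
    {n : 𝔐.Num | 𝔐.Sat E φ (scons n v)} ∈ 𝔐.sets

/-! ## Coding inside a structure

From here on everything is interpreted inside `𝔐`: numbers are elements of `Num`, functions and
sequences are those whose graph belongs to `sets`, finite objects are coded by elements of `Num`. -/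

variable {𝔐}

/-- The pairing function `(i + j)² + i`. -/
def pair (i j : 𝔐.Num) : 𝔐.Num := (i + j) * (i + j) + i

open Classical in
/-- Inverse of `pair`; numbers that are not pairs are read as `(0, 0)`. -/
noncomputable def unpair (z : 𝔐.Num) : 𝔐.Num × 𝔐.Num :=
  if h : ∃ p : 𝔐.Num × 𝔐.Num, pair p.1 p.2 = z then h.choose else (0, 0)

/-- `f` is a function of the structure. -/
def IsFun (f : 𝔐.Num → 𝔐.Num) : Prop :=
  {z : 𝔐.Num | ∃ i, z = pair i (f i)} ∈ 𝔐.sets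

/-- `f` is a binary function (a double sequence) of the structure. -/
def IsFun₂ (f : 𝔐.Num → 𝔐.Num → 𝔐.Num) : Prop :=
  {z : 𝔐.Num | ∃ n k, z = pair (pair n k) (f n k)} ∈ 𝔐.sets

/-! ### Rational numbers -/

variable (𝔐) in
/-- A fraction of the structure: `⟨a, b, c⟩` denotes the rational number `(a - b) / (c + 1)`. -/
@[ext]
structure Q where
  pos : 𝔐.Num
  neg : 𝔐.Num
  den : 𝔐.Num

namespace Q

instance : Zero (Q 𝔐) := ⟨⟨0, 0, 0⟩⟩
instance : One (Q 𝔐) := ⟨⟨1, 0, 0⟩⟩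
instance : Neg (Q 𝔐) := ⟨fun r => ⟨r.neg, r.pos, r.den⟩⟩
instance : Add (Q 𝔐) := ⟨fun r s =>
  ⟨r.pos * (s.den + 1) + s.pos * (r.den + 1), r.neg * (s.den + 1) + s.neg * (r.den + 1),
    r.den * s.den + r.den + s.den⟩⟩
instance : Sub (Q 𝔐) := ⟨fun r s => r + -s⟩
instance : Mul (Q 𝔐) := ⟨fun r s =>
  ⟨r.pos * s.pos + r.neg * s.neg, r.pos * s.neg + r.neg * s.pos,
    r.den * s.den + r.den + s.den⟩⟩
instance : LE (Q 𝔐) := ⟨fun r s =>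
  r.pos * (s.den + 1) + s.neg * (r.den + 1) ≤ s.pos * (r.den + 1) + r.neg * (s.den + 1)⟩
instance : LT (Q 𝔐) := ⟨fun r s =>
  r.pos * (s.den + 1) + s.neg * (r.den + 1) < s.pos * (r.den + 1) + r.neg * (s.den + 1)⟩

open Classical in
/-- Absolute value. -/
noncomputable def abs (r : Q 𝔐) : Q 𝔐 := if r.neg ≤ r.pos then r else -r

/-- The fraction `1 / 2`. -/
def half : Q 𝔐 := ⟨1, 0, 1⟩

/-- The rational number `n`. -/
def ofNum (n : 𝔐.Num) : Q 𝔐 := ⟨n, 0, 0⟩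

/-- The number that codes a fraction. -/
def code (r : Q 𝔐) : 𝔐.Num := pair (pair r.pos r.neg) r.den

/-- The fraction coded by a number. -/
noncomputable def decode (z : 𝔐.Num) : Q 𝔐 :=
  ⟨(unpair (unpair z).1).1, (unpair (unpair z).1).2, (unpair z).2⟩

/-- `q` is a sequence of rationals of the structure. -/
def IsSeq (q : 𝔐.Num → Q 𝔐) : Prop := IsFun fun i => (q i).code

/-- `h` is a sequence of the structure computing the first `n` steps of the recursion
`h 0 = a`, `h (i + 1) = G i (h i)`. -/
def IsRecursion (a : Q 𝔐) (G : 𝔐.Num → Q 𝔐 → Q 𝔐) (n : 𝔐.Num) (h : 𝔐.Num → Q 𝔐) : Prop :=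
  IsSeq h ∧ h 0 = a ∧ ∀ i : 𝔐.Num, i < n → h (i + 1) = G i (h i)

open Classical in
/-- The value after `n` steps (`n` a number of the structure) of the recursion with start `a`
and step `G`, carried out inside the structure. -/
noncomputable def recur (a : Q 𝔐) (G : 𝔐.Num → Q 𝔐 → Q 𝔐) (n : 𝔐.Num) : Q 𝔐 :=
  if h : ∃ s, IsRecursion a G n s then h.choose n else 0

/-- The power `x ^ n`. -/
noncomputable def pow (x : Q 𝔐) (n : 𝔐.Num) : Q 𝔐 := recur 1 (fun _ y => y * x) n

/-- The finite sum `∑_{i < n} f i`. -/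
noncomputable def sum (f : 𝔐.Num → Q 𝔐) (n : 𝔐.Num) : Q 𝔐 := recur 0 (fun i y => y + f i) n

end Q

/-! ### Rational polynomials -/

open Classical in
/-- Gödel's `β` function: the remainder of `c` modulo `(i + 1) d + 1`. -/
noncomputable def beta (c d i : 𝔐.Num) : 𝔐.Num :=
  if h : ∃ r : 𝔐.Num, r < (i + 1) * d + 1 ∧ ∃ q, c = q * ((i + 1) * d + 1) + r
  then h.choose else 0

/-- The number `p = pair ℓ (pair c d)` codes the polynomial `∑_{i < ℓ} aᵢ xⁱ`, where
`aᵢ` is the rational coded by `β(c, d, i)`.  This is `ℓ`. -/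
noncomputable def polyLen (p : 𝔐.Num) : 𝔐.Num := (unpair p).1

open Classical in
/-- The coefficient of `xⁱ` in the polynomial coded by `p`. -/
noncomputable def polyCoeff (p i : 𝔐.Num) : Q 𝔐 :=
  if i < polyLen p then Q.decode (beta (unpair (unpair p).2).1 (unpair (unpair p).2).2 i) else 0

/-- The value `p(x)`. -/
noncomputable def polyEval (p : 𝔐.Num) (x : Q 𝔐) : Q 𝔐 :=
  Q.sum (fun i => polyCoeff p i * Q.pow x i) (polyLen p)

/-- The value `p'(x)` of the derivative, that is `∑ (i + 1) aᵢ₊₁ xⁱ`. -/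
noncomputable def polyDerivEval (p : 𝔐.Num) (x : Q 𝔐) : Q 𝔐 :=
  Q.sum (fun i => Q.ofNum (i + 1) * polyCoeff p (i + 1) * Q.pow x i) (polyLen p)

/-! ### Real numbers and integrals -/

/-- `x` is (a code for) a real number: a sequence of rationals with `|x_k - x_{k+i}| ≤ 2^{-k}`. -/
def IsReal (x : 𝔐.Num → Q 𝔐) : Prop :=
  Q.IsSeq x ∧ ∀ k i : 𝔐.Num, (x k - x (k + i)).abs ≤ Q.pow Q.half k

/-- For a real `x` and a rational `r`: `x ≤ r`. -/
def RealLE (x : 𝔐.Num → Q 𝔐) (r : Q 𝔐) : Prop :=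
  ∀ k : 𝔐.Num, x k ≤ r + Q.pow Q.half k

/-- For reals `x, y` and a rational `r`: `|x - y| ≤ r`. -/
def RealDistLE (x y : 𝔐.Num → Q 𝔐) (r : Q 𝔐) : Prop :=
  ∀ k : 𝔐.Num, (x k - y k).abs ≤ r + (Q.pow Q.half k + Q.pow Q.half k)

/-- The Riemann sum `∑_{j ≤ n} F(j / (n+1)) · 1 / (n+1)` over `[0, 1]`. -/
noncomputable def riemannSum (F : Q 𝔐 → Q 𝔐) (n : 𝔐.Num) : Q 𝔐 :=
  Q.sum (fun j => F ⟨j, 0, n⟩ * ⟨1, 0, n⟩) (n + 1)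

/-- The real `x` is the Riemann integral of `F` over `[0, 1]`, the limit of the Riemann sums.
(Only used where `F` is the absolute value of a polynomial, which is Lipschitz, so that
equidistant partitions suffice.) -/
def IsIntegral (F : Q 𝔐 → Q 𝔐) (x : 𝔐.Num → Q 𝔐) : Prop :=
  IsReal x ∧ ∀ ε : Q 𝔐, 0 < ε → ∃ N : 𝔐.Num, ∀ n : 𝔐.Num, N ≤ n → (riemannSum F n - x n).abs ≤ ε

/-- `∫₀¹ F ≤ r`, as real numbers. -/
def IntegralLE (F : Q 𝔐 → Q 𝔐) (r : Q 𝔐) : Prop := ∃ x, IsIntegral F x ∧ RealLE x r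

/-! ### The spaces `L₁` and `BV` -/

/-- The sequence `p` of polynomials is a point of `L₁([0,1])`: `‖p_k - p_{k+1}‖₁ ≤ 2^{-k}`. -/
def IsL1 (p : 𝔐.Num → 𝔐.Num) : Prop :=
  IsFun p ∧ ∀ k : 𝔐.Num,
    IntegralLE (fun t => (polyEval (p k) t - polyEval (p (k + 1)) t).abs) (Q.pow Q.half k)

/-- The sequence `p` of polynomials together with the rational `v` is a point of `BV([0,1])`;
`v` is its bound on the variation. -/
def IsBV (p : 𝔐.Num → 𝔐.Num) (v : Q 𝔐) : Prop :=
  IsL1 p ∧ ∀ k : 𝔐.Num, IntegralLE (fun t => (polyDerivEval (p k) t).abs) v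

/-- The real `x` is `lim_k ∫₀¹ |F_k|`. -/
def IsLimNorm (F : 𝔐.Num → Q 𝔐 → Q 𝔐) (x : 𝔐.Num → Q 𝔐) : Prop :=
  IsReal x ∧ ∀ ε : Q 𝔐, 0 < ε → ∃ K : 𝔐.Num, ∀ k : 𝔐.Num, K ≤ k →
    ∃ y, IsIntegral (fun t => (F k t).abs) y ∧ RealDistLE y x ε

/-- For a point `f` of `L₁`: `‖f‖₁ ≤ r`. -/
def NormLE (f : 𝔐.Num → 𝔐.Num) (r : Q 𝔐) : Prop :=
  ∃ x, IsLimNorm (fun k t => polyEval (f k) t) x ∧ RealLE x r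

/-- For points `f, g` of `L₁`: `‖f - g‖₁ ≤ r`. -/
def DistLE (f g : 𝔐.Num → 𝔐.Num) (r : Q 𝔐) : Prop :=
  ∃ x, IsLimNorm (fun k t => polyEval (f k) t - polyEval (g k) t) x ∧ RealLE x r

variable (𝔐) in
/-- Helly's selection theorem holds in the structure `𝔐`. -/
def HST : Prop :=
  ∀ (f : 𝔐.Num → 𝔐.Num → 𝔐.Num) (w : 𝔐.Num → Q 𝔐), IsFun₂ f → Q.IsSeq w →
    (∀ n, IsBV (f n) (w n)) →
    ∀ u v : Q 𝔐, (∀ n, NormLE (f n) u) → (∀ n, w n ≤ v) →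
      ∃ (φ : 𝔐.Num → 𝔐.Num) (g : 𝔐.Num → 𝔐.Num),
        IsBV φ v ∧ IsFun g ∧ (∀ m n : 𝔐.Num, m < n → g m < g n) ∧
        ∀ ε : Q 𝔐, 0 < ε → ∃ N : 𝔐.Num, ∀ n : 𝔐.Num, N ≤ n → DistLE (f (g n)) φ ε

end L2Structure

end SOA

/-! Both directions pass through `ProjClosed`: the sets of the model are closed under projection.
Over `RCA₀` this is arithmetical comprehension, since quantifiers can then be eliminated one at a
time (`Fn.sat`, `ProjClosed.isACA0`).

From Helly to projections (`HST.projClosed`). Given A, let s_n be the sum of 2^(-x-1) over those x <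
n that have a witness y < n with (x, y) in A. The sequence s_n is increasing and bounded by 1.
Regard its terms as constant functions, with variation bound 0. A Helly limit has variation bound 0
too, so its approximating polynomials are constant on the rationals of [0, 1], and their values d_k
give the limit of s_n with error 2 · 2^(-k). Once s_n is close to the limit compared with 2^(-x-1),
no new witness for x can appear. Hence the complement of the projection is also Σ⁰₁, and Δ⁰₁
comprehension yields the projection.

From projections to Helly (`ProjClosed.hst`). Replace each f_n by its n-th polynomial. A bound on
the norm and on the variation bounds its values at grid points (`abs_peval_le`). If two polynomials
of variation at most v differ by at most δ at the points i/M with i < M, their L₁-distance is at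
most δ + 2v/M (`polyDistLE_of_grid`). So the values at finitely many grid points, rounded to
finitely many colours, determine a polynomial up to 2^(-k). Thinning out by the infinite pigeonhole
principle (`exists_thin`) makes every colour eventually constant, which gives a fast Cauchy
subsequence (`exists_fast_subsequence`). Its terms are already polynomials with the required
variation bound, so this subsequence is itself the limit point.

The model may be nonstandard, so sums, powers and integrals have to be computed inside it. The tool
is `Fn`, the class of maps between coded types that the model computes. It is closed under bounded
quantification, minimisation and, by Gödel's β function (`exists_beta_eq`), primitive recursion.
Fractions modulo equality form an ordered field `K` in which the estimates are ordinary algebra,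
with internal induction wherever a sum or a power of nonstandard length occurs. -/

namespace SOA

/-! ## Renaming of number variables -/

/-- Renaming of the variables of a term. -/
def Term.rename (ρ : ℕ → ℕ) : Term → Term
  | .var i => .var (ρ i)
  | .zero => .zero
  | .one => .one
  | .add s t => .add (s.rename ρ) (t.rename ρ)
  | .mul s t => .mul (s.rename ρ) (t.rename ρ)

/-- Extension of a renaming under a binder. -/
def liftRen (ρ : ℕ → ℕ) : ℕ → ℕ
  | 0 => 0
  | n + 1 => ρ n + 1

/-- Renaming of the free number variables of a formula. -/
def Formula.rename : (ℕ → ℕ) → Formula → Formula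
  | ρ, .eq s t => .eq (s.rename ρ) (t.rename ρ)
  | ρ, .lt s t => .lt (s.rename ρ) (t.rename ρ)
  | ρ, .mem t i => .mem (t.rename ρ) i
  | ρ, .not φ => .not (φ.rename ρ)
  | ρ, .and φ ψ => .and (φ.rename ρ) (ψ.rename ρ)
  | ρ, .ball t φ => .ball (t.rename ρ) (φ.rename (liftRen ρ))
  | ρ, .all φ => .all (φ.rename (liftRen ρ))

theorem Formula.IsBounded.rename {φ : Formula} (h : φ.IsBounded) (ρ : ℕ → ℕ) :
    (φ.rename ρ).IsBounded := by
  induction φ generalizing ρ with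
  | eq | lt | mem => trivial
  | not φ ih => exact ih h ρ
  | and φ ψ ih₁ ih₂ => exact ⟨ih₁ h.1 ρ, ih₂ h.2 ρ⟩
  | ball t φ ih => exact ih h _
  | all φ => exact h.elim

namespace L2Structure

variable {𝔐 : L2Structure.{u}}

theorem val_rename (ρ : ℕ → ℕ) (v : ℕ → 𝔐.Num) (t : Term) :
    𝔐.val v (t.rename ρ) = 𝔐.val (fun i => v (ρ i)) t := by
  induction t <;> simp_all [Term.rename, val]

theorem scons_liftRen (ρ : ℕ → ℕ) (a : 𝔐.Num) (v : ℕ → 𝔐.Num) :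
    (fun i => scons a v (liftRen ρ i)) = scons a fun i => v (ρ i) := by
  funext i; cases i <;> rfl

theorem sat_rename (E : ℕ → 𝔐.sets) (φ : Formula) (ρ : ℕ → ℕ) (v : ℕ → 𝔐.Num) :
    𝔐.Sat E (φ.rename ρ) v ↔ 𝔐.Sat E φ fun i => v (ρ i) := by
  induction φ generalizing ρ v with
  | eq | lt | mem => simp [Formula.rename, Sat, val_rename]
  | not φ ih => simp [Formula.rename, Sat, ih]
  | and φ ψ ih₁ ih₂ => simp [Formula.rename, Sat, ih₁, ih₂]
  | ball t φ ih => simp [Formula.rename, Sat, ih, val_rename, scons_liftRen]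
  | all φ ih => simp [Formula.rename, Sat, ih, scons_liftRen]

/-! ## Predicates defined by bounded formulas -/

/-- Predicates of assignments defined by a bounded formula with set parameters `E`. -/
def D0 (E : ℕ → 𝔐.sets) (P : (ℕ → 𝔐.Num) → Prop) : Prop :=
  ∃ θ : Formula, θ.IsBounded ∧ ∀ v, 𝔐.Sat E θ v ↔ P v

namespace D0

variable {E : ℕ → 𝔐.sets} {P P' : (ℕ → 𝔐.Num) → Prop}

theorem eq (s t : Term) : D0 E fun v => 𝔐.val v s = 𝔐.val v t :=
  ⟨.eq s t, trivial, fun _ => Iff.rfl⟩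

theorem lt (s t : Term) : D0 E fun v => 𝔐.val v s < 𝔐.val v t :=
  ⟨.lt s t, trivial, fun _ => Iff.rfl⟩

theorem mem (t : Term) (i : ℕ) : D0 E fun v => 𝔐.val v t ∈ (E i : Set 𝔐.Num) :=
  ⟨.mem t i, trivial, fun _ => Iff.rfl⟩

theorem not (h : D0 E P) : D0 E fun v => ¬ P v := by
  obtain ⟨θ, hb, hs⟩ := h
  exact ⟨.not θ, hb, fun v => not_congr (hs v)⟩

theorem and (h : D0 E P) (h' : D0 E P') : D0 E fun v => P v ∧ P' v := by
  obtain ⟨θ, hb, hs⟩ := h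
  obtain ⟨θ', hb', hs'⟩ := h'
  exact ⟨.and θ θ', ⟨hb, hb'⟩, fun v => and_congr (hs v) (hs' v)⟩

theorem congr (h : D0 E P) (h' : ∀ v, P v ↔ P' v) : D0 E P' := by
  obtain ⟨θ, hb, hs⟩ := h
  exact ⟨θ, hb, fun v => (hs v).trans (h' v)⟩

theorem or (h : D0 E P) (h' : D0 E P') : D0 E fun v => P v ∨ P' v :=
  (h.not.and h'.not).not.congr fun v => by tauto

theorem imp (h : D0 E P) (h' : D0 E P') : D0 E fun v => P v → P' v :=
  (h.and h'.not).not.congr fun v => by tauto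

theorem ball (t : Term) (h : D0 E P) : D0 E fun v => ∀ a, a < 𝔐.val v t → P (scons a v) := by
  obtain ⟨θ, hb, hs⟩ := h
  exact ⟨.ball t θ, hb, fun v => forall_congr' fun a => imp_congr Iff.rfl (hs _)⟩

theorem bex (t : Term) (h : D0 E P) : D0 E fun v => ∃ a, a < 𝔐.val v t ∧ P (scons a v) :=
  (h.not.ball t).not.congr fun v => by push Not; rfl

theorem rename (h : D0 E P) (ρ : ℕ → ℕ) : D0 E fun v => P fun i => v (ρ i) := by
  obtain ⟨θ, hb, hs⟩ := h
  exact ⟨θ.rename ρ, hb.rename ρ, fun v => (sat_rename E θ ρ v).trans (hs _)⟩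

end D0

theorem sat_ex (E : ℕ → 𝔐.sets) (φ : Formula) (v : ℕ → 𝔐.Num) :
    𝔐.Sat E φ.ex v ↔ ∃ a, 𝔐.Sat E φ (scons a v) := by
  simp [Formula.ex, Sat]

/-! ### The schemes of `RCA₀` for predicates given by bounded formulas -/

namespace IsRCA0

variable {E : ℕ → 𝔐.sets} {P : (ℕ → 𝔐.Num) → Prop}

theorem sigma_induction (h : 𝔐.IsRCA0) (hP : D0 E P) (v : ℕ → 𝔐.Num)
    (h0 : ∃ a, P (scons a (scons 0 v)))
    (hs : ∀ n, (∃ a, P (scons a (scons n v))) → ∃ a, P (scons a (scons (n + 1) v))) (n : 𝔐.Num) :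
    ∃ a, P (scons a (scons n v)) := by
  obtain ⟨θ, hb, hθ⟩ := hP
  have := h.sigma01_induction θ.ex ⟨θ, hb, rfl⟩ E v
  simp only [sat_ex, hθ] at this
  exact this h0 hs n

/-- A bounded formula becomes `Σ⁰₁` by a dummy quantifier; the renaming `(· + 1)` moves its
variables past the dummy. -/
theorem bounded_induction (h : 𝔐.IsRCA0) (hP : D0 E P) (v : ℕ → 𝔐.Num) (h0 : P (scons 0 v))
    (hs : ∀ n, P (scons n v) → P (scons (n + 1) v)) (n : 𝔐.Num) : P (scons n v) := by
  obtain ⟨a, ha⟩ := h.sigma_induction (hP.rename (· + 1)) v ⟨0, h0⟩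
    (fun n ⟨a, ha⟩ => ⟨0, hs n ha⟩) n
  exact ha

theorem delta_comprehension (h : 𝔐.IsRCA0) {P' : (ℕ → 𝔐.Num) → Prop} (hP : D0 E P)
    (hP' : D0 E P') (v : ℕ → 𝔐.Num)
    (hiff : ∀ n, (∃ a, P (scons a (scons n v))) ↔ ∀ a, P' (scons a (scons n v))) :
    {n | ∃ a, P (scons a (scons n v))} ∈ 𝔐.sets := by
  obtain ⟨θ, hb, hθ⟩ := hP
  obtain ⟨θ', hb', hθ'⟩ := hP'
  have := h.delta01_comprehension θ.ex (.all θ') ⟨θ, hb, rfl⟩ ⟨θ', hb', rfl⟩ E v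
  simp only [sat_ex, hθ, Sat, hθ'] at this
  exact this hiff

theorem bounded_comprehension (h : 𝔐.IsRCA0) (hP : D0 E P) (v : ℕ → 𝔐.Num) :
    {n | P (scons n v)} ∈ 𝔐.sets := by
  have := h.delta_comprehension (hP.rename (· + 1)) (hP.rename (· + 1)) v
    (fun n => ⟨fun ⟨_, ha⟩ _ => ha, fun ha => ⟨0, ha 0⟩⟩)
  rwa [show {n | P (scons n v)} = {n | ∃ a : 𝔐.Num, P fun i => scons a (scons n v) (i + 1)} from
    Set.ext fun n => ⟨fun h => ⟨0, h⟩, fun ⟨_, h⟩ => h⟩]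

end IsRCA0

/-! ## Arithmetic in models of `RCA₀` -/

section Arithmetic

variable [hR : Fact 𝔐.IsRCA0]

namespace Num

theorem basic : 𝔐.Basic := hR.out.basic

theorem bounded_induction {P : (ℕ → 𝔐.Num) → Prop} (v : ℕ → 𝔐.Num)
    (hP : ∀ E, D0 E P) (h0 : P (scons 0 v))
    (hs : ∀ n, P (scons n v) → P (scons (n + 1) v)) (n : 𝔐.Num) : P (scons n v) :=
  hR.out.bounded_induction (hP fun _ => ⟨_, 𝔐.sets_nonempty.choose_spec⟩) v h0 hs n

theorem eq_induction (s t : Term) (v : ℕ → 𝔐.Num)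
    (h0 : 𝔐.val (scons 0 v) s = 𝔐.val (scons 0 v) t)
    (hs : ∀ n, 𝔐.val (scons n v) s = 𝔐.val (scons n v) t →
      𝔐.val (scons (n + 1) v) s = 𝔐.val (scons (n + 1) v) t) (n : 𝔐.Num) :
    𝔐.val (scons n v) s = 𝔐.val (scons n v) t :=
  bounded_induction v (fun _ => D0.eq s t) h0 hs n

theorem add_succ' (m n : 𝔐.Num) : m + (n + 1) = m + n + 1 := basic.add_succ m n

theorem zero_add' (n : 𝔐.Num) : 0 + n = n :=
  eq_induction (.add .zero (.var 0)) (.var 0) (fun _ => 0) (basic.add_zero _)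
    (fun n (ih : 0 + n = n) => show 0 + (n + 1) = n + 1 by rw [add_succ', ih]) n

theorem succ_add' (m n : 𝔐.Num) : m + 1 + n = m + n + 1 :=
  eq_induction (.add (.add (.var 1) .one) (.var 0)) (.add (.add (.var 1) (.var 0)) .one)
    (fun _ => m) (show m + 1 + 0 = m + 0 + 1 by rw [basic.add_zero, basic.add_zero])
    (fun n (ih : m + 1 + n = m + n + 1) => show m + 1 + (n + 1) = m + (n + 1) + 1 by
      rw [add_succ', add_succ', ih]) n

theorem add_comm' (m n : 𝔐.Num) : m + n = n + m :=
  eq_induction (.add (.var 1) (.var 0)) (.add (.var 0) (.var 1))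
    (fun _ => m) (show m + 0 = 0 + m by rw [basic.add_zero, zero_add'])
    (fun n (ih : m + n = n + m) => show m + (n + 1) = n + 1 + m by
      rw [add_succ', succ_add', ih]) n

theorem add_assoc' (a b c : 𝔐.Num) : a + b + c = a + (b + c) :=
  eq_induction (.add (.add (.var 1) (.var 2)) (.var 0)) (.add (.var 1) (.add (.var 2) (.var 0)))
    (scons a fun _ => b) (show a + b + 0 = a + (b + 0) by rw [basic.add_zero, basic.add_zero])
    (fun n (ih : a + b + n = a + (b + n)) => show a + b + (n + 1) = a + (b + (n + 1)) by
      rw [add_succ', add_succ', add_succ', ih]) c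

instance : AddCommMonoid 𝔐.Num where
  add_assoc := add_assoc'
  zero_add := zero_add'
  add_zero := basic.add_zero
  add_comm := add_comm'
  nsmul := nsmulRec

theorem zero_mul' (n : 𝔐.Num) : 0 * n = 0 :=
  eq_induction (.mul .zero (.var 0)) .zero (fun _ => 0) (basic.mul_zero _)
    (fun n (ih : 0 * n = 0) => show 0 * (n + 1) = 0 by
      rw [basic.mul_succ, ih, add_zero]) n

theorem succ_mul' (m n : 𝔐.Num) : (m + 1) * n = m * n + n :=
  eq_induction (.mul (.add (.var 1) .one) (.var 0)) (.add (.mul (.var 1) (.var 0)) (.var 0))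
    (fun _ => m) (show (m + 1) * 0 = m * 0 + 0 by simp only [basic.mul_zero, add_zero])
    (fun n (ih : (m + 1) * n = m * n + n) => show (m + 1) * (n + 1) = m * (n + 1) + (n + 1) by
      rw [basic.mul_succ, basic.mul_succ, ih]; abel) n

theorem mul_comm' (m n : 𝔐.Num) : m * n = n * m :=
  eq_induction (.mul (.var 1) (.var 0)) (.mul (.var 0) (.var 1))
    (fun _ => m) (show m * 0 = 0 * m by rw [basic.mul_zero, zero_mul'])
    (fun n (ih : m * n = n * m) => show m * (n + 1) = (n + 1) * m by
      rw [basic.mul_succ, succ_mul', ih]) n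

theorem mul_add' (a b c : 𝔐.Num) : a * (b + c) = a * b + a * c :=
  eq_induction (.mul (.var 1) (.add (.var 2) (.var 0)))
    (.add (.mul (.var 1) (.var 2)) (.mul (.var 1) (.var 0)))
    (scons a fun _ => b) (show a * (b + 0) = a * b + a * 0 by
      rw [basic.mul_zero, add_zero, add_zero])
    (fun n (ih : a * (b + n) = a * b + a * n) =>
      show a * (b + (n + 1)) = a * b + a * (n + 1) by
      rw [← add_assoc, basic.mul_succ, basic.mul_succ, ih, add_assoc]) c

theorem mul_assoc' (a b c : 𝔐.Num) : a * b * c = a * (b * c) :=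
  eq_induction (.mul (.mul (.var 1) (.var 2)) (.var 0)) (.mul (.var 1) (.mul (.var 2) (.var 0)))
    (scons a fun _ => b) (show a * b * 0 = a * (b * 0) by simp only [basic.mul_zero])
    (fun n (ih : a * b * n = a * (b * n)) => show a * b * (n + 1) = a * (b * (n + 1)) by
      rw [basic.mul_succ, basic.mul_succ, mul_add', ih]) c

theorem mul_one' (a : 𝔐.Num) : a * 1 = a := by
  have := basic.mul_succ a 0
  rwa [zero_add, basic.mul_zero, zero_add] at this

instance : CommSemiring 𝔐.Num where
  mul_assoc := mul_assoc'
  mul_comm := mul_comm'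
  one_mul a := (mul_comm' 1 a).trans (mul_one' a)
  mul_one := mul_one'
  zero_mul := zero_mul'
  mul_zero := basic.mul_zero
  left_distrib := mul_add'
  right_distrib a b c := by rw [mul_comm', mul_add', mul_comm' c, mul_comm' c]
  natCast := Nat.unaryCast
  npow := npowRec

theorem add_right_cancel' {a b : 𝔐.Num} (c : 𝔐.Num) : a + c = b + c → a = b :=
  bounded_induction (P := fun v => v 1 + v 0 = v 2 + v 0 → v 1 = v 2) (scons a fun _ => b)
    (fun _ => (D0.eq (.add (.var 1) (.var 0)) (.add (.var 2) (.var 0))).imp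
      (D0.eq (.var 1) (.var 2)))
    (show a + 0 = b + 0 → a = b by simp)
    (fun n (ih : a + n = b + n → a = b) => show a + (n + 1) = b + (n + 1) → a = b from fun h =>
      ih (basic.succ_inj _ _ (by rwa [add_assoc, add_assoc]))) c

theorem lt_add_succ (m k : 𝔐.Num) : m < m + (k + 1) :=
  bounded_induction (P := fun v => v 1 < v 1 + (v 0 + 1)) (fun _ => m)
    (fun _ => D0.lt (.var 1) (.add (.var 1) (.add (.var 0) .one)))
    (show m < m + (0 + 1) by rw [zero_add]; exact (basic.lt_succ _ _).2 (.inr rfl))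
    (fun k (ih : m < m + (k + 1)) => show m < m + (k + 1 + 1) by
      rw [← add_assoc m]; exact (basic.lt_succ _ _).2 (.inl ih)) k

/-- The basic axioms describe `<` only by recursion on its right argument. This form reduces the
order to addition, and the order facts below rest on it. The difference k is the witness of a
genuine `Σ⁰₁` induction on n. -/
theorem lt_iff_exists {m n : 𝔐.Num} : m < n ↔ ∃ k, m + (k + 1) = n := by
  constructor
  · intro h
    obtain ⟨k, hk⟩ := hR.out.sigma_induction
      (E := fun _ => ⟨_, 𝔐.sets_nonempty.choose_spec⟩)
      (P := fun v => v 2 < v 1 → v 2 + (v 0 + 1) = v 1)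
      ((D0.lt (.var 2) (.var 1)).imp (D0.eq (.add (.var 2) (.add (.var 0) .one)) (.var 1)))
      (fun _ => m) ⟨0, fun h => (basic.not_lt_zero _ h).elim⟩ (by
        rintro n ⟨k, hk⟩
        change m < n → m + (k + 1) = n at hk
        change ∃ k, m < n + 1 → m + (k + 1) = n + 1
        rcases Classical.em (m < n) with h | h
        · exact ⟨k + 1, fun _ => by rw [← hk h, add_succ', add_succ']⟩
        · refine ⟨0, fun h' => ?_⟩
          rcases (basic.lt_succ _ _).1 h' with h'' | h''
          · exact (h h'').elim
          · rw [h'', zero_add]) n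
    exact ⟨k, hk h⟩
  · rintro ⟨k, rfl⟩
    exact lt_add_succ m k

theorem eq_zero_or_succ (n : 𝔐.Num) : n = 0 ∨ ∃ k, n = k + 1 := by
  rcases (basic.lt_succ (0 : 𝔐.Num) n).1 (by
    have := lt_add_succ (0 : 𝔐.Num) n; rwa [zero_add] at this) with h | h
  · obtain ⟨k, hk⟩ := lt_iff_exists.1 h
    exact .inr ⟨k, by rw [← hk, zero_add]⟩
  · exact .inl h.symm

theorem lt_irrefl' (m : 𝔐.Num) : ¬ m < m := by
  intro h
  obtain ⟨k, hk⟩ := lt_iff_exists.1 h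
  rw [add_comm] at hk
  exact basic.succ_ne_zero k (add_right_cancel' m (by rw [hk, zero_add]))

theorem lt_trans' {a b c : 𝔐.Num} (h : a < b) (h' : b < c) : a < c := by
  obtain ⟨k, rfl⟩ := lt_iff_exists.1 h
  obtain ⟨l, rfl⟩ := lt_iff_exists.1 h'
  exact lt_iff_exists.2 ⟨k + 1 + l, by ring⟩

theorem trichotomy (m n : 𝔐.Num) : m < n ∨ m = n ∨ n < m :=
  bounded_induction (P := fun v => v 1 < v 0 ∨ v 1 = v 0 ∨ v 0 < v 1) (fun _ => m)
    (fun _ => (D0.lt (.var 1) (.var 0)).or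
      ((D0.eq (.var 1) (.var 0)).or (D0.lt (.var 0) (.var 1))))
    (show m < 0 ∨ m = 0 ∨ 0 < m by
      rcases eq_zero_or_succ m with h | ⟨k, rfl⟩
      · exact .inr (.inl h)
      · exact .inr (.inr (lt_iff_exists.2 ⟨k, zero_add _⟩)))
    (fun n (ih : m < n ∨ m = n ∨ n < m) => show m < n + 1 ∨ m = n + 1 ∨ n + 1 < m by
      rcases ih with h | h | h
      · exact .inl ((basic.lt_succ _ _).2 (.inl h))
      · exact .inl ((basic.lt_succ _ _).2 (.inr h))
      · obtain ⟨k, rfl⟩ := lt_iff_exists.1 h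
        rcases eq_zero_or_succ k with rfl | ⟨l, rfl⟩
        · exact .inr (.inl (by rw [zero_add]))
        · exact .inr (.inr (lt_iff_exists.2 ⟨l, by ring⟩))) n

open Classical in
noncomputable instance : LinearOrder 𝔐.Num where
  le_refl a := .inr rfl
  le_trans a b c h h' := by
    rcases h with h | rfl
    · rcases h' with h' | rfl
      · exact .inl (lt_trans' h h')
      · exact .inl h
    · exact h'
  lt_iff_le_not_ge a b := by
    constructor
    · refine fun h => ⟨.inl h, ?_⟩
      rintro (h' | rfl)
      · exact lt_irrefl' _ (lt_trans' h h')
      · exact lt_irrefl' _ h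
    · rintro ⟨h | rfl, h'⟩
      · exact h
      · exact (h' (.inr rfl)).elim
  le_antisymm a b h h' := by
    rcases h with h | h
    · rcases h' with h' | h'
      · exact (lt_irrefl' _ (lt_trans' h h')).elim
      · exact h'.symm
    · exact h
  le_total a b := by
    rcases trichotomy a b with h | h | h
    · exact .inl (.inl h)
    · exact .inl (.inr h)
    · exact .inr (.inl h)
  toDecidableLE := Classical.decRel _

theorem lt_add_one_iff' {m n : 𝔐.Num} : m < n + 1 ↔ m ≤ n := basic.lt_succ m n

theorem le_iff_exists {m n : 𝔐.Num} : m ≤ n ↔ ∃ k, n = m + k := by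
  constructor
  · rintro (h | rfl)
    · obtain ⟨k, rfl⟩ := lt_iff_exists.1 h
      exact ⟨_, rfl⟩
    · exact ⟨0, by simp⟩
  · rintro ⟨k, rfl⟩
    rcases eq_zero_or_succ k with rfl | ⟨l, rfl⟩
    · simp
    · exact (lt_add_succ m l).le

theorem zero_le' (m : 𝔐.Num) : 0 ≤ m := le_iff_exists.2 ⟨m, (zero_add m).symm⟩

instance : IsOrderedCancelAddMonoid 𝔐.Num where
  add_le_add_left a b h c := by
    obtain ⟨k, rfl⟩ := le_iff_exists.1 h
    exact le_iff_exists.2 ⟨k, by ring⟩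
  le_of_add_le_add_left a b c h := by
    obtain ⟨k, hk⟩ := le_iff_exists.1 h
    exact le_iff_exists.2 ⟨k, add_right_cancel' a (by rw [add_comm, hk]; ring)⟩

theorem mul_pos' {a b : 𝔐.Num} (ha : 0 < a) (hb : 0 < b) : 0 < a * b := by
  obtain ⟨k, rfl⟩ := lt_iff_exists.1 ha
  obtain ⟨l, rfl⟩ := lt_iff_exists.1 hb
  exact lt_iff_exists.2 ⟨k * l + k + l, by ring⟩

theorem mul_lt_mul_of_pos' {a b c : 𝔐.Num} (h : a < b) (hc : 0 < c) : c * a < c * b := by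
  obtain ⟨k, rfl⟩ := lt_iff_exists.1 h
  rw [mul_add]
  exact lt_add_of_pos_right _ (mul_pos' hc ((lt_add_succ 0 k).trans_eq (zero_add _)))

instance : IsStrictOrderedRing 𝔐.Num where
  zero_le_one := zero_le' 1
  exists_pair_ne := ⟨0, 1, fun h => basic.succ_ne_zero (0 : 𝔐.Num) (by rw [zero_add, ← h])⟩
  mul_lt_mul_of_pos_left _ ha _ _ h := mul_lt_mul_of_pos' h ha
  mul_lt_mul_of_pos_right a ha b c h := by
    show b * a < c * a
    rw [mul_comm b, mul_comm c]; exact mul_lt_mul_of_pos' h ha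

instance : CanonicallyOrderedAdd 𝔐.Num where
  exists_add_of_le h := le_iff_exists.1 h
  le_self_add _ b := le_iff_exists.2 ⟨b, rfl⟩
  le_add_self _ b := le_iff_exists.2 ⟨b, add_comm _ _⟩

instance : SuccAddOrder 𝔐.Num where
  succ a := a + 1
  le_succ a := (lt_add_one a).le
  max_of_succ_le {a} h := ((lt_add_one a).not_ge h).elim
  succ_le_of_lt {a b} h := by
    obtain ⟨k, rfl⟩ := lt_iff_exists.1 h
    exact le_iff_exists.2 ⟨k, by ring⟩
  succ_eq_add_one _ := rfl

/-- Induction on c: the remainder grows by one until it wraps around. Bounding the quotient by c + 1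
keeps the induction formula bounded. -/
theorem exists_div (c : 𝔐.Num) {m : 𝔐.Num} (hm : 0 < m) : ∃ q r, r < m ∧ c = q * m + r := by
  have := bounded_induction (P := fun v => ∃ q, q < v 0 + 1 ∧
      ∃ r, r < v 1 ∧ v 0 = q * v 1 + r) (fun _ => m)
    (fun _ => .bex (.add (.var 0) .one) (.bex (.var 2)
      (P := fun v => v 2 = v 1 * v 3 + v 0) (.eq (.var 2)
        (.add (.mul (.var 1) (.var 3)) (.var 0)))))
    ⟨0, by simp [scons], 0, hm, by simp [scons]⟩ (by
      rintro n ⟨q, hq, r, hr, h⟩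
      change r < m at hr; change n = q * m + r at h; change q < n + 1 at hq
      change ∃ q, q < n + 1 + 1 ∧ ∃ r, r < m ∧ n + 1 = q * m + r
      rcases (Order.add_one_le_of_lt hr).lt_or_eq with h' | h'
      · exact ⟨q, hq.trans (lt_add_one _), r + 1, h', by rw [h]; ring⟩
      · refine ⟨q + 1, by simpa using hq, 0, hm, ?_⟩
        rw [h, ← h']; ring) c
  obtain ⟨q, -, r, hr, h⟩ := this
  exact ⟨q, r, hr, h⟩

theorem div_unique {q q' r r' m : 𝔐.Num} (h : q * m + r = q' * m + r') (hr : r < m)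
    (hr' : r' < m) : q = q' ∧ r = r' := by
  have key : ∀ {q q' r r' : 𝔐.Num}, q * m + r = q' * m + r' → r < m → r' < m → ¬ q < q' := by
    intro q q' r r' h hr hr' hlt
    obtain ⟨k, rfl⟩ := lt_iff_exists.1 hlt
    have h2 : r = k * m + m + r' := add_left_cancel (a := q * m) (by rw [h]; ring)
    have h3 : m ≤ r := by
      rw [h2, add_assoc, add_left_comm]; exact le_self_add
    exact hr.not_ge h3
  have hq : q = q' := le_antisymm (not_lt.1 (key h.symm hr' hr)) (not_lt.1 (key h hr hr'))
  subst hq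
  exact ⟨rfl, add_left_cancel h⟩

end Num

/-! ### The pairing function -/

theorem pair_lt_of_add_lt {i j i' j' : 𝔐.Num} (h : i + j < i' + j') : pair i j < pair i' j' := by
  obtain ⟨k, hk⟩ := Num.lt_iff_exists.1 h
  unfold pair
  rw [← hk]
  refine Num.lt_iff_exists.2 ⟨i + j + j + k + k * k + (i + j) * k + (i + j) * k + k + i', ?_⟩
  ring

/-- The codes of pairs with sum s lie between s² and s² + s, hence below (s + 1)². So the code
determines the sum, then i, then j. -/
theorem pair_inj {i j i' j' : 𝔐.Num} : pair i j = pair i' j' ↔ i = i' ∧ j = j' := by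
  refine ⟨fun h => ?_, by rintro ⟨rfl, rfl⟩; rfl⟩
  have hs : i + j = i' + j' := le_antisymm
    (not_lt.1 fun hl => (pair_lt_of_add_lt hl).ne h.symm)
    (not_lt.1 fun hl => (pair_lt_of_add_lt hl).ne h)
  have hi : i = i' := by
    unfold pair at h
    rw [hs] at h
    exact add_left_cancel h
  subst hi
  exact ⟨rfl, add_left_cancel hs⟩

theorem le_pair_left (i j : 𝔐.Num) : i ≤ pair i j := le_add_self

theorem le_pair_right (i j : 𝔐.Num) : j ≤ pair i j := by
  refine (le_add_self (a := j) (b := i)).trans ((?_ : i + j ≤ (i + j) * (i + j)).trans le_self_add)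
  rcases Num.eq_zero_or_succ (i + j) with h | ⟨k, h⟩
  · simp [h]
  · rw [h]; exact Num.le_iff_exists.2 ⟨k * k + k, by ring⟩

@[simp] theorem unpair_pair (i j : 𝔐.Num) : unpair (pair i j) = (i, j) := by
  have h : ∃ p : 𝔐.Num × 𝔐.Num, pair p.1 p.2 = pair i j := ⟨(i, j), rfl⟩
  unfold unpair
  rw [dif_pos h]
  obtain ⟨h1, h2⟩ := pair_inj.1 h.choose_spec
  exact Prod.ext h1 h2

end Arithmetic

end L2Structure
end SOA

set_option linter.unusedSectionVars false

namespace SOA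

/-! ## Explicit bounded formulas -/

namespace Formula

/-- Disjunction. -/
def or (φ ψ : Formula) : Formula := .not (.and (.not φ) (.not ψ))

/-- The bounded existential quantifier. -/
def bex (t : Term) (φ : Formula) : Formula := .not (.ball t (.not φ))

end Formula

/-- The term `pair s t`. -/
def Term.pair (s t : Term) : Term := .add (.mul (.add s t) (.add s t)) s

/-- The term `t + 1`. -/
def Term.succ (t : Term) : Term := .add t .one

namespace L2Structure

variable {𝔐 : L2Structure.{u}}

section scons

variable {α : Type u} (a : α) (v : ℕ → α)

@[simp] theorem scons_zero : scons a v 0 = a := rfl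
@[simp] theorem scons_succ (n : ℕ) : scons a v (n + 1) = v n := rfl
@[simp] theorem scons_one : scons a v 1 = v 0 := rfl
@[simp] theorem scons_two : scons a v 2 = v 1 := rfl
@[simp] theorem scons_three : scons a v 3 = v 2 := rfl

end scons

theorem sat_or (E : ℕ → 𝔐.sets) (φ ψ : Formula) (v : ℕ → 𝔐.Num) :
    𝔐.Sat E (φ.or ψ) v ↔ 𝔐.Sat E φ v ∨ 𝔐.Sat E ψ v := by
  simp only [Formula.or, Sat]; tauto

theorem sat_bex (E : ℕ → 𝔐.sets) (t : Term) (φ : Formula) (v : ℕ → 𝔐.Num) :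
    𝔐.Sat E (.bex t φ) v ↔ ∃ a, a < 𝔐.val v t ∧ 𝔐.Sat E φ (scons a v) := by
  simp [Formula.bex, Sat]

theorem val_pair (v : ℕ → 𝔐.Num) (s t : Term) :
    𝔐.val v (.pair s t) = pair (𝔐.val v s) (𝔐.val v t) := rfl

theorem val_succ (v : ℕ → 𝔐.Num) (t : Term) : 𝔐.val v t.succ = 𝔐.val v t + 1 := rfl

theorem D0.of_formula {E : ℕ → 𝔐.sets} {θ : Formula} (h : θ.IsBounded) : D0 E (𝔐.Sat E θ) :=
  ⟨θ, h, fun _ => Iff.rfl⟩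

theorem unpair_of_not {z : 𝔐.Num} (h : ¬ ∃ a b, z = pair a b) : unpair z = (0, 0) := by
  unfold unpair
  rw [dif_neg]
  rintro ⟨p, hp⟩
  exact h ⟨p.1, p.2, hp.symm⟩

section RCA

variable [hR : Fact 𝔐.IsRCA0]

/-! ## Functions of the structure -/

theorem setOf_sat_mem (E : ℕ → 𝔐.sets) (v : ℕ → 𝔐.Num) (θ : Formula) (h : θ.IsBounded) :
    {n | 𝔐.Sat E θ (scons n v)} ∈ 𝔐.sets :=
  hR.out.bounded_comprehension (.of_formula h) v

/-- Both components of a pair are at most its code, so a graph defined by a bounded formula on pairs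
is a set defined by a bounded formula on codes. -/
theorem isFun_of_sat {F : 𝔐.Num → 𝔐.Num} (E : ℕ → 𝔐.sets) (v : ℕ → 𝔐.Num) (θ : Formula)
    (hb : θ.IsBounded) (h : ∀ x y, 𝔐.Sat E θ (scons y (scons x v)) ↔ y = F x) : IsFun F := by
  -- The code of the pair occupies index 2, which the formula `θ` has to skip.
  let ρ : ℕ → ℕ := fun i => match i with | 0 => 0 | 1 => 1 | n + 2 => n + 3
  have := setOf_sat_mem E v (.bex (.succ (.var 0)) (.bex (.succ (.var 1))
    (.and (.eq (.var 2) (.pair (.var 1) (.var 0))) (θ.rename ρ)))) ⟨trivial, hb.rename ρ⟩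
  have hρ : ∀ w x y : 𝔐.Num, (fun i => scons y (scons x (scons w v)) (ρ i)) =
      scons y (scons x v) := by
    intro w x y; funext i
    match i with | 0 => rfl | 1 => rfl | n + 2 => rfl
  refine (congrArg (· ∈ 𝔐.sets) (Set.ext fun w => ?_)).mp this
  simp only [sat_bex, Sat, sat_rename, hρ, h, val_pair, Set.mem_ofPred_eq, val, val_succ,
    scons_zero, scons_one, scons_two]
  constructor
  · rintro ⟨x, -, y, -, rfl, rfl⟩; exact ⟨x, rfl⟩
  · rintro ⟨x, rfl⟩
    exact ⟨x, Num.lt_add_one_iff'.2 (le_pair_left _ _), _,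
      Num.lt_add_one_iff'.2 (le_pair_right _ _), rfl, rfl⟩

theorem isFun₂_of_sat {F : 𝔐.Num → 𝔐.Num → 𝔐.Num} (E : ℕ → 𝔐.sets) (v : ℕ → 𝔐.Num)
    (θ : Formula) (hb : θ.IsBounded)
    (h : ∀ a b y, 𝔐.Sat E θ (scons y (scons b (scons a v))) ↔ y = F a b) :
    IsFun fun z => F (unpair z).1 (unpair z).2 := by
  let ρ : ℕ → ℕ := fun i => match i with | 0 => 2 | 1 => 0 | 2 => 1 | n + 3 => n + 5
  have hρ : ∀ a b y x c : 𝔐.Num,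
      (fun i => scons b (scons a (scons y (scons x (scons c v)))) (ρ i)) =
      scons y (scons b (scons a v)) := by
    intro a b y x c; funext i
    match i with | 0 => rfl | 1 => rfl | 2 => rfl | n + 3 => rfl
  -- Numbers that are not pairs unpair to (0, 0), so the value there is the constant `F 0 0`,
  -- supplied as an extra number parameter.
  refine isFun_of_sat E (scons (F 0 0) v)
    (.or (.bex (.succ (.var 1)) (.bex (.succ (.var 2))
      (.and (.eq (.var 3) (.pair (.var 1) (.var 0))) (θ.rename ρ))))
    (.and (.not (.bex (.succ (.var 1)) (.bex (.succ (.var 2))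
      (.eq (.var 3) (.pair (.var 1) (.var 0)))))) (.eq (.var 0) (.var 2))))
    ⟨⟨trivial, hb.rename ρ⟩, trivial, trivial⟩ fun z y => ?_
  simp only [sat_or, sat_bex, Sat, sat_rename, hρ, h, val_pair, val, val_succ,
    scons_zero, scons_one, scons_two, scons_three]
  by_cases hz : ∃ a b, z = pair a b
  · obtain ⟨a, b, rfl⟩ := hz
    have ha := Num.lt_add_one_iff'.2 (le_pair_left a b)
    have hb := Num.lt_add_one_iff'.2 (le_pair_right a b)
    simp only [unpair_pair]
    constructor
    · rintro (⟨a', -, b', -, h1, h2⟩ | ⟨h1, -⟩)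
      · obtain ⟨rfl, rfl⟩ := pair_inj.1 h1
        exact h2
      · exact (h1 ⟨a, ha, b, hb, rfl⟩).elim
    · exact fun h => .inl ⟨a, ha, b, hb, rfl, h⟩
  · rw [unpair_of_not hz]
    constructor
    · rintro (⟨a', -, b', -, h1, -⟩ | ⟨-, h1⟩)
      · exact (hz ⟨_, _, h1⟩).elim
      · exact h1
    · exact fun h => .inr ⟨fun ⟨a, _, b, _, h⟩ => hz ⟨a, b, h⟩, h⟩

namespace IsFun

/-- The graph of a function, as a set of codes of pairs. -/
def graph (F : 𝔐.Num → 𝔐.Num) : Set 𝔐.Num := {z | ∃ i, z = pair i (F i)}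

theorem pair_mem_graph {F : 𝔐.Num → 𝔐.Num} {x y : 𝔐.Num} : pair x y ∈ graph F ↔ y = F x := by
  constructor
  · rintro ⟨i, hi⟩
    obtain ⟨rfl, rfl⟩ := pair_inj.1 hi
    rfl
  · rintro rfl; exact ⟨x, rfl⟩

variable {F G H : 𝔐.Num → 𝔐.Num}

theorem const (c : 𝔐.Num) : IsFun fun _ : 𝔐.Num => c :=
  isFun_of_sat (fun _ => ⟨_, 𝔐.sets_nonempty.choose_spec⟩) (fun _ => c) (.eq (.var 0) (.var 2))
    trivial fun _ _ => Iff.rfl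

theorem id : IsFun fun z : 𝔐.Num => z :=
  isFun_of_sat (fun _ => ⟨_, 𝔐.sets_nonempty.choose_spec⟩) (fun _ => 0) (.eq (.var 0) (.var 1))
    trivial fun _ _ => Iff.rfl

theorem fst : IsFun fun z : 𝔐.Num => (unpair z).1 :=
  isFun₂_of_sat (F := fun a _ => a) (fun _ => ⟨_, 𝔐.sets_nonempty.choose_spec⟩) (fun _ => 0)
    (.eq (.var 0) (.var 2)) trivial fun _ _ _ => Iff.rfl

theorem snd : IsFun fun z : 𝔐.Num => (unpair z).2 :=
  isFun₂_of_sat (F := fun _ b => b) (fun _ => ⟨_, 𝔐.sets_nonempty.choose_spec⟩) (fun _ => 0)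
    (.eq (.var 0) (.var 1)) trivial fun _ _ _ => Iff.rfl

theorem add₂ : IsFun fun z : 𝔐.Num => (unpair z).1 + (unpair z).2 :=
  isFun₂_of_sat (F := fun a b => a + b) (fun _ => ⟨_, 𝔐.sets_nonempty.choose_spec⟩) (fun _ => 0)
    (.eq (.var 0) (.add (.var 2) (.var 1))) trivial fun _ _ _ => Iff.rfl

theorem mul₂ : IsFun fun z : 𝔐.Num => (unpair z).1 * (unpair z).2 :=
  isFun₂_of_sat (F := fun a b => a * b) (fun _ => ⟨_, 𝔐.sets_nonempty.choose_spec⟩) (fun _ => 0)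
    (.eq (.var 0) (.mul (.var 2) (.var 1))) trivial fun _ _ _ => Iff.rfl

open Classical in
theorem eq₂ : IsFun fun z : 𝔐.Num => if (unpair z).1 = (unpair z).2 then (1 : 𝔐.Num) else 0 :=
  isFun₂_of_sat (F := fun a b => if a = b then 1 else 0)
    (fun _ => ⟨_, 𝔐.sets_nonempty.choose_spec⟩) (fun _ => 0)
    (.or (.and (.eq (.var 2) (.var 1)) (.eq (.var 0) .one))
      (.and (.not (.eq (.var 2) (.var 1))) (.eq (.var 0) .zero)))
    ⟨⟨trivial, trivial⟩, trivial, trivial⟩ fun a b y => by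
      simp only [sat_or, Sat, val, scons_zero, scons_one, scons_two]
      split_ifs with h <;> simp [h]

open Classical in
theorem lt₂ : IsFun fun z : 𝔐.Num => if (unpair z).1 < (unpair z).2 then (1 : 𝔐.Num) else 0 :=
  isFun₂_of_sat (F := fun a b => if a < b then 1 else 0)
    (fun _ => ⟨_, 𝔐.sets_nonempty.choose_spec⟩) (fun _ => 0)
    (.or (.and (.lt (.var 2) (.var 1)) (.eq (.var 0) .one))
      (.and (.not (.lt (.var 2) (.var 1))) (.eq (.var 0) .zero)))
    ⟨⟨trivial, trivial⟩, trivial, trivial⟩ fun a b y => by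
      simp only [sat_or, Sat, val, scons_zero, scons_one, scons_two]
      split_ifs with h <;> simp [h]

open Classical in
theorem char {X : Set 𝔐.Num} (hX : X ∈ 𝔐.sets) : IsFun fun z => if z ∈ X then (1 : 𝔐.Num) else 0 :=
  isFun_of_sat (fun _ => ⟨X, hX⟩) (fun _ => 0)
    (.or (.and (.mem (.var 1) 0) (.eq (.var 0) .one))
      (.and (.not (.mem (.var 1) 0)) (.eq (.var 0) .zero)))
    ⟨⟨trivial, trivial⟩, trivial, trivial⟩ fun a b => by
      simp only [sat_or, Sat, val, scons_zero, scons_one]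
      split_ifs with h <;> simp [h]

open Classical in
theorem ite (hF : IsFun F) (hG : IsFun G) (hH : IsFun H) :
    IsFun fun z => if F z ≠ 0 then G z else H z :=
  isFun_of_sat (scons ⟨_, hF⟩ (scons ⟨_, hG⟩ fun _ => ⟨_, hH⟩)) (fun _ => 0)
    (.or (.and (.not (.mem (.pair (.var 1) .zero) 0)) (.mem (.pair (.var 1) (.var 0)) 1))
      (.and (.mem (.pair (.var 1) .zero) 0) (.mem (.pair (.var 1) (.var 0)) 2)))
    ⟨⟨trivial, trivial⟩, trivial, trivial⟩ fun a b => by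
      simp only [sat_or, Sat]
      change (pair a 0 ∉ graph F ∧ pair a b ∈ graph G ∨
        pair a 0 ∈ graph F ∧ pair a b ∈ graph H) ↔ _
      simp only [pair_mem_graph, eq_comm (a := (0 : 𝔐.Num)) (b := F a)]
      by_cases h : F a = 0 <;> simp [h]

theorem pairing (hF : IsFun F) (hG : IsFun G) : IsFun fun z => pair (F z) (G z) :=
  isFun_of_sat (scons ⟨_, hF⟩ fun _ => ⟨_, hG⟩) (fun _ => 0)
    (.bex (.succ (.var 0)) (.bex (.succ (.var 1)) (.and (.eq (.var 2) (.pair (.var 1) (.var 0)))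
      (.and (.mem (.pair (.var 3) (.var 1)) 0) (.mem (.pair (.var 3) (.var 0)) 1)))))
    ⟨trivial, trivial, trivial⟩ fun a b => by
      simp only [sat_bex, Sat]
      change (∃ x, x < b + 1 ∧ ∃ y, y < b + 1 ∧ b = pair x y ∧ pair a x ∈ graph F ∧
        pair a y ∈ graph G) ↔ _
      simp only [pair_mem_graph]
      constructor
      · rintro ⟨_, -, _, -, rfl, rfl, rfl⟩; rfl
      · rintro rfl
        exact ⟨_, Num.lt_add_one_iff'.2 (le_pair_left _ _), _,
          Num.lt_add_one_iff'.2 (le_pair_right _ _), rfl, rfl, rfl⟩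

/-- The intermediate value need not be bounded by the code of the pair (z, G (F z)), so bounded
comprehension does not suffice. Since it is unique, it can be quantified existentially or
universally, and `Δ⁰₁` comprehension applies. -/
theorem comp (hG : IsFun G) (hF : IsFun F) : IsFun fun z => G (F z) := by
  have := hR.out.delta_comprehension (E := scons ⟨_, hF⟩ fun _ => ⟨_, hG⟩)
    (.of_formula (θ := .bex (.succ (.var 1)) (.bex (.succ (.var 2))
      (.and (.eq (.var 3) (.pair (.var 1) (.var 0))) (.and (.mem (.pair (.var 1) (.var 2)) 0)
        (.mem (.pair (.var 2) (.var 0)) 1))))) ⟨trivial, trivial, trivial⟩)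
    (.of_formula (θ := .bex (.succ (.var 1)) (.bex (.succ (.var 2))
      (.and (.eq (.var 3) (.pair (.var 1) (.var 0))) (.or (.not (.mem (.pair (.var 1) (.var 2)) 0))
        (.mem (.pair (.var 2) (.var 0)) 1))))) ⟨trivial, trivial, trivial⟩) (fun _ => 0)
  simp only [sat_bex, Sat, sat_or] at this
  change (∀ n, (∃ a, ∃ i, i < n + 1 ∧ ∃ k, k < n + 1 ∧ n = pair i k ∧ pair i a ∈ graph F ∧
    pair a k ∈ graph G) ↔ ∀ a, ∃ i, i < n + 1 ∧ ∃ k, k < n + 1 ∧ n = pair i k ∧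
    (pair i a ∉ graph F ∨ pair a k ∈ graph G)) → {n | ∃ a, ∃ i, i < n + 1 ∧ ∃ k, k < n + 1 ∧
    n = pair i k ∧ pair i a ∈ graph F ∧ pair a k ∈ graph G} ∈ 𝔐.sets at this
  simp only [pair_mem_graph] at this
  have key : ∀ n, (∃ a, ∃ i, i < n + 1 ∧ ∃ k, k < n + 1 ∧ n = pair i k ∧ a = F i ∧ k = G a) ↔
      ∃ i, n = pair i (G (F i)) := by
    intro n
    constructor
    · rintro ⟨_, i, -, _, -, h, rfl, rfl⟩; exact ⟨i, h⟩
    · rintro ⟨i, rfl⟩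
      exact ⟨_, i, Num.lt_add_one_iff'.2 (le_pair_left _ _), _,
        Num.lt_add_one_iff'.2 (le_pair_right _ _), rfl, rfl, rfl⟩
  simp only [key] at this
  refine this fun n => ⟨?_, fun h => ?_⟩
  · rintro ⟨i, rfl⟩ a
    refine ⟨i, Num.lt_add_one_iff'.2 (le_pair_left _ _), _,
      Num.lt_add_one_iff'.2 (le_pair_right _ _), rfl, ?_⟩
    by_cases h : a = F i
    · exact .inr (by rw [h])
    · exact .inl h
  -- Any instance of the universal form shows that the number is a pair; the instance at `F i` then
  -- identifies its second component.
  · obtain ⟨i, -, k, -, rfl, -⟩ := h 0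
    obtain ⟨i', -, k', -, h', h''⟩ := h (F i)
    obtain ⟨rfl, rfl⟩ := pair_inj.1 h'
    rcases h'' with h'' | h''
    · exact (h'' rfl).elim
    · exact ⟨i, by rw [h'']⟩

open Classical in
theorem ball₂ (hF : IsFun F) :
    IsFun fun z => if ∀ i < (unpair z).2, F (pair (unpair z).1 i) ≠ 0 then (1 : 𝔐.Num) else 0 :=
  isFun₂_of_sat (F := fun a b => if ∀ i < b, F (pair a i) ≠ 0 then 1 else 0)
    (fun _ => ⟨_, hF⟩) (fun _ => 0)
    (.or (.and (.ball (.var 1) (.not (.mem (.pair (.pair (.var 3) (.var 0)) .zero) 0)))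
        (.eq (.var 0) .one))
      (.and (.not (.ball (.var 1) (.not (.mem (.pair (.pair (.var 3) (.var 0)) .zero) 0))))
        (.eq (.var 0) .zero)))
    ⟨⟨trivial, trivial⟩, trivial, trivial⟩ fun a b y => by
      simp only [sat_or, Sat]
      change ((∀ i, i < b → pair (pair a i) 0 ∉ graph F) ∧ y = 1 ∨
        (¬ ∀ i, i < b → pair (pair a i) 0 ∉ graph F) ∧ y = 0) ↔ _
      simp only [pair_mem_graph, ne_eq, eq_comm (a := (0 : 𝔐.Num)) (b := F _)]
      split_ifs with h <;> tauto

theorem of_graph (hF : IsFun F) (h : ∀ x y, F (pair x y) ≠ 0 ↔ y = G x) : IsFun G :=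
  isFun_of_sat (fun _ => ⟨_, hF⟩) (fun _ => 0)
    (.not (.mem (.pair (.pair (.var 1) (.var 0)) .zero) 0)) trivial fun x y => by
      change pair (pair x y) 0 ∉ graph F ↔ _
      rw [pair_mem_graph, ← h, ne_comm]

theorem setOf_ne_zero_mem (hF : IsFun F) : {z | F z ≠ 0} ∈ 𝔐.sets := by
  have := setOf_sat_mem (fun _ => ⟨_, hF⟩) (fun _ => 0)
    (.not (.mem (.pair (.var 0) .zero) 0)) trivial
  refine (congrArg (· ∈ 𝔐.sets) (Set.ext fun w => ?_)).mp this
  change pair w 0 ∉ graph F ↔ _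
  rw [pair_mem_graph]
  exact ne_comm

end IsFun

theorem set_induction {X : Set 𝔐.Num} (hX : X ∈ 𝔐.sets) (h0 : 0 ∈ X)
    (hs : ∀ n ∈ X, n + 1 ∈ X) (n : 𝔐.Num) : n ∈ X :=
  hR.out.bounded_induction (P := fun v => v 0 ∈ X) (E := fun _ => ⟨X, hX⟩)
    (D0.mem (.var 0) 0) (fun _ => 0) h0 hs n

theorem sigma_set_induction {X : Set 𝔐.Num} (hX : X ∈ 𝔐.sets) (h0 : ∃ y, pair 0 y ∈ X)
    (hs : ∀ n, (∃ y, pair n y ∈ X) → ∃ y, pair (n + 1) y ∈ X) (n : 𝔐.Num) : ∃ y, pair n y ∈ X :=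
  hR.out.sigma_induction (P := fun v => pair (v 1) (v 0) ∈ X) (E := fun _ => ⟨X, hX⟩)
    (D0.mem (.pair (.var 1) (.var 0)) 0) (fun _ => 0) h0 hs n

/-! ## Coded types and the maps computed by functions of the structure -/

variable (𝔐) in
/-- A type whose elements are (not necessarily uniquely) coded by numbers of the structure. -/
class Coded (Γ : Type*) where
  dec : 𝔐.Num → Γ
  surj : Function.Surjective dec

open Coded

instance : Coded 𝔐 𝔐.Num := ⟨fun z => z, fun z => ⟨z, rfl⟩⟩

/-- With truth values coded as nonzero or zero, decidable predicates are just `Fn` maps into `Prop`,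
and one calculus serves functions and predicates. -/
instance : Coded 𝔐 Prop := ⟨fun z => z ≠ 0, fun p => by
  by_cases h : p
  · exact ⟨1, by simp [h]⟩
  · exact ⟨0, by simp [h]⟩⟩

noncomputable instance {Γ Δ : Type*} [Coded 𝔐 Γ] [Coded 𝔐 Δ] : Coded 𝔐 (Γ × Δ) :=
  ⟨fun z => (dec (unpair z).1, dec (unpair z).2), fun ⟨a, b⟩ => by
    obtain ⟨x, rfl⟩ := surj (𝔐 := 𝔐) a
    obtain ⟨y, rfl⟩ := surj (𝔐 := 𝔐) b
    exact ⟨pair x y, by simp⟩⟩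

theorem Coded.dec_num (z : 𝔐.Num) : (dec z : 𝔐.Num) = z := rfl

theorem Coded.dec_prod {Γ Δ : Type*} [Coded 𝔐 Γ] [Coded 𝔐 Δ] (z : 𝔐.Num) :
    (dec z : Γ × Δ) = (dec (unpair z).1, dec (unpair z).2) := rfl

variable (𝔐) in
/-- A map between coded types computed on codes by a function of the structure. -/
@[fun_prop]
def Fn {Γ Δ : Type*} [Coded 𝔐 Γ] [Coded 𝔐 Δ] (f : Γ → Δ) : Prop :=
  ∃ F : 𝔐.Num → 𝔐.Num, IsFun F ∧ ∀ z, dec (F z) = f (dec z)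

namespace Fn

variable {Γ Δ Θ : Type*} [Coded 𝔐 Γ] [Coded 𝔐 Δ] [Coded 𝔐 Θ]

@[fun_prop]
theorem id : Fn 𝔐 fun x : Γ => x := ⟨_, IsFun.id, fun _ => rfl⟩

@[fun_prop]
theorem const (c : Δ) : Fn 𝔐 fun _ : Γ => c := by
  obtain ⟨z, rfl⟩ := surj (𝔐 := 𝔐) c
  exact ⟨_, IsFun.const z, fun _ => rfl⟩

@[fun_prop]
theorem comp {g : Δ → Θ} {f : Γ → Δ} (hg : Fn 𝔐 g) (hf : Fn 𝔐 f) : Fn 𝔐 fun x => g (f x) := by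
  obtain ⟨F, hF, hF'⟩ := hf
  obtain ⟨G, hG, hG'⟩ := hg
  exact ⟨_, hG.comp hF, fun z => by rw [hG', hF']⟩

@[fun_prop]
theorem fst {f : Γ → Δ × Θ} (hf : Fn 𝔐 f) : Fn 𝔐 fun x => (f x).1 :=
  comp (g := Prod.fst) ⟨_, IsFun.fst, fun _ => rfl⟩ hf

@[fun_prop]
theorem snd {f : Γ → Δ × Θ} (hf : Fn 𝔐 f) : Fn 𝔐 fun x => (f x).2 :=
  comp (g := Prod.snd) ⟨_, IsFun.snd, fun _ => rfl⟩ hf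

@[fun_prop]
theorem prodMk {f : Γ → Δ} {g : Γ → Θ} (hf : Fn 𝔐 f) (hg : Fn 𝔐 g) :
    Fn 𝔐 fun x => (f x, g x) := by
  obtain ⟨F, hF, hF'⟩ := hf
  obtain ⟨G, hG, hG'⟩ := hg
  exact ⟨_, hF.pairing hG, fun z => by simp [dec_prod, ← hF', ← hG']⟩

variable {f g : Γ → 𝔐.Num} {P P' : Γ → Prop}

@[fun_prop]
theorem add (hf : Fn 𝔐 f) (hg : Fn 𝔐 g) : Fn 𝔐 fun x => f x + g x :=
  comp (g := fun p : 𝔐.Num × 𝔐.Num => p.1 + p.2) ⟨_, IsFun.add₂, fun _ => rfl⟩ (hf.prodMk hg)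

@[fun_prop]
theorem mul (hf : Fn 𝔐 f) (hg : Fn 𝔐 g) : Fn 𝔐 fun x => f x * g x :=
  comp (g := fun p : 𝔐.Num × 𝔐.Num => p.1 * p.2) ⟨_, IsFun.mul₂, fun _ => rfl⟩ (hf.prodMk hg)

@[fun_prop]
theorem pair (hf : Fn 𝔐 f) (hg : Fn 𝔐 g) : Fn 𝔐 fun x => L2Structure.pair (f x) (g x) := by
  unfold L2Structure.pair; fun_prop

@[fun_prop]
theorem unpair (hf : Fn 𝔐 f) : Fn 𝔐 fun x => unpair (f x) :=
  comp (g := L2Structure.unpair) ⟨_, IsFun.id, fun _ => rfl⟩ hf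

open Classical in
theorem prop_iff : Fn 𝔐 P ↔ Fn 𝔐 fun x => if P x then (1 : 𝔐.Num) else 0 := by
  constructor
  · rintro ⟨F, hF, hF'⟩
    refine ⟨_, hF.ite (IsFun.const 1) (IsFun.const 0), fun z => ?_⟩
    have h : F z ≠ 0 ↔ P (dec z) := iff_of_eq (hF' z)
    show (if F z ≠ 0 then (1 : 𝔐.Num) else 0) = if P (dec z) then 1 else 0
    simp only [h]
  · rintro ⟨F, hF, hF'⟩
    refine ⟨F, hF, fun z => ?_⟩
    have := hF' z
    change F z = _ at this
    change (F z ≠ 0) = _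
    rw [this]
    simp

theorem eq_num (hf : Fn 𝔐 f) (hg : Fn 𝔐 g) : Fn 𝔐 fun x => f x = g x :=
  comp (g := fun p : 𝔐.Num × 𝔐.Num => p.1 = p.2)
    (prop_iff.2 ⟨_, IsFun.eq₂, fun _ => by dsimp only [dec]; congr⟩) (hf.prodMk hg)

variable (𝔐 Δ) in
/-- Coded types on which equality of codes is decided in the structure. -/
class _root_.SOA.L2Structure.CodedEq : Prop where
  eq : Fn 𝔐 fun p : Δ × Δ => p.1 = p.2

instance : CodedEq 𝔐 𝔐.Num := ⟨eq_num (fst id) (snd id)⟩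

@[fun_prop]
theorem eq [CodedEq 𝔐 Δ] {f g : Γ → Δ} (hf : Fn 𝔐 f) (hg : Fn 𝔐 g) : Fn 𝔐 fun x => f x = g x :=
  comp CodedEq.eq (hf.prodMk hg)

@[fun_prop]
theorem lt (hf : Fn 𝔐 f) (hg : Fn 𝔐 g) : Fn 𝔐 fun x => f x < g x :=
  comp (g := fun p : 𝔐.Num × 𝔐.Num => p.1 < p.2)
    (prop_iff.2 ⟨_, IsFun.lt₂, fun _ => by dsimp only [dec]; congr⟩) (hf.prodMk hg)

theorem mem {X : Set 𝔐.Num} (hX : X ∈ 𝔐.sets) (hf : Fn 𝔐 f) : Fn 𝔐 fun x => f x ∈ X :=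
  comp (g := fun z => z ∈ X) (prop_iff.2 ⟨_, IsFun.char hX, fun _ => rfl⟩) hf

@[fun_prop]
theorem not (hP : Fn 𝔐 P) : Fn 𝔐 fun x => ¬ P x := by
  obtain ⟨F, hF, hF'⟩ := hP
  refine ⟨_, hF.ite (IsFun.const 0) (IsFun.const 1), fun z => ?_⟩
  beta_reduce
  rw [← hF']
  change ((if F z ≠ 0 then (0 : 𝔐.Num) else 1) ≠ 0) = ¬ (F z ≠ 0)
  split_ifs with h <;> simp [h]

@[fun_prop]
theorem and (hP : Fn 𝔐 P) (hP' : Fn 𝔐 P') : Fn 𝔐 fun x => P x ∧ P' x := by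
  obtain ⟨F, hF, hF'⟩ := hP
  obtain ⟨G, hG, hG'⟩ := hP'
  refine ⟨_, hF.ite hG (IsFun.const 0), fun z => ?_⟩
  beta_reduce
  rw [← hF', ← hG']
  change ((if F z ≠ 0 then G z else 0) ≠ 0) = ((F z ≠ 0) ∧ (G z ≠ 0))
  split_ifs with h
  · simp [h]
  · simp only [h, false_and, ne_eq, not_true_eq_false]

theorem congr (hP : Fn 𝔐 P) (h : ∀ x, P x ↔ P' x) : Fn 𝔐 P' :=
  (funext fun x => propext (h x) : P = P') ▸ hP

@[fun_prop]
theorem or (hP : Fn 𝔐 P) (hP' : Fn 𝔐 P') : Fn 𝔐 fun x => P x ∨ P' x :=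
  (hP.not.and hP'.not).not.congr fun x => by tauto

theorem imp (hP : Fn 𝔐 P) (hP' : Fn 𝔐 P') : Fn 𝔐 fun x => P x → P' x :=
  (hP.and hP'.not).not.congr fun x => by tauto

@[fun_prop]
theorem le (hf : Fn 𝔐 f) (hg : Fn 𝔐 g) : Fn 𝔐 fun x => f x ≤ g x :=
  (hg.lt hf).not.congr fun _ => not_lt

open Classical in
theorem ball {R : Γ → 𝔐.Num → Prop} (hR : Fn 𝔐 fun p : Γ × 𝔐.Num => R p.1 p.2)
    (hf : Fn 𝔐 f) : Fn 𝔐 fun x => ∀ i < f x, R x i := by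
  obtain ⟨F, hF, hF'⟩ := hR
  obtain ⟨G, hG, hG'⟩ := hf
  refine prop_iff.2 ⟨_, hF.ball₂.comp (IsFun.id.pairing hG), fun z => ?_⟩
  have : (∀ i < G z, F (L2Structure.pair z i) ≠ 0) ↔ ∀ i < f (dec z), R (dec z) i := by
    rw [← hG']
    refine forall_congr' fun i => imp_congr Iff.rfl ?_
    have := hF' (L2Structure.pair z i)
    simp only [dec_prod, dec_num, unpair_pair] at this
    exact iff_of_eq this
  show (if ∀ i < (L2Structure.unpair (L2Structure.pair z (G z))).2,
    F (L2Structure.pair (L2Structure.unpair (L2Structure.pair z (G z))).1 i) ≠ 0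
      then (1 : 𝔐.Num) else 0) = if ∀ i < f (dec z), R (dec z) i then 1 else 0
  simp only [unpair_pair, this]

theorem bex {R : Γ → 𝔐.Num → Prop} (hR : Fn 𝔐 fun p : Γ × 𝔐.Num => R p.1 p.2)
    (hf : Fn 𝔐 f) : Fn 𝔐 fun x => ∃ i < f x, R x i :=
  (ball (R := fun x i => ¬ R x i) hR.not hf).not.congr fun _ => by push Not; rfl

@[fun_prop]
theorem ite {f g : Γ → Δ} [∀ x, Decidable (P x)] (hP : Fn 𝔐 P) (hf : Fn 𝔐 f) (hg : Fn 𝔐 g) :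
    Fn 𝔐 fun x => if P x then f x else g x := by
  obtain ⟨F, hF, hF'⟩ := hP
  obtain ⟨G, hG, hG'⟩ := hf
  obtain ⟨H, hH, hH'⟩ := hg
  refine ⟨_, hF.ite hG hH, fun z => ?_⟩
  have h : F z ≠ 0 ↔ P (dec z) := iff_of_eq (hF' z)
  simp only [← hG', ← hH', h, ← apply_ite dec]

theorem of_graph (h : Fn 𝔐 fun p : Γ × 𝔐.Num => p.2 = f p.1) : Fn 𝔐 f := by
  obtain ⟨F, hF, hF'⟩ := h
  refine ⟨fun z => f (dec z), hF.of_graph fun x y => ?_, fun _ => rfl⟩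
  have := hF' (L2Structure.pair x y)
  simp only [dec_prod, dec_num, unpair_pair] at this
  exact iff_of_eq this

theorem setOf_mem {P : 𝔐.Num → Prop} (hP : Fn 𝔐 P) : {z | P z} ∈ 𝔐.sets := by
  obtain ⟨F, hF, hF'⟩ := hP
  rw [show {z | P z} = {z | F z ≠ 0} from Set.ext fun z => (iff_of_eq (hF' z)).symm]
  exact hF.setOf_ne_zero_mem

theorem isFun {f : 𝔐.Num → 𝔐.Num} (hf : Fn 𝔐 f) : IsFun f := by
  obtain ⟨F, hF, hF'⟩ := hf
  exact (funext hF' : F = f) ▸ hF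

theorem _root_.SOA.L2Structure.IsFun.fn {f : 𝔐.Num → 𝔐.Num} (hf : IsFun f) : Fn 𝔐 f :=
  ⟨f, hf, fun _ => rfl⟩

theorem induction {P : 𝔐.Num → Prop} (hP : Fn 𝔐 P) (h0 : P 0) (hs : ∀ n, P n → P (n + 1))
    (n : 𝔐.Num) : P n :=
  set_induction hP.setOf_mem h0 hs n

/-- A witness in a coded type is replaced by any of its codes, which turns this into `Σ⁰₁` induction
over numbers. -/
theorem sigma_induction {P : 𝔐.Num → Δ → Prop} (hP : Fn 𝔐 fun p : 𝔐.Num × Δ => P p.1 p.2)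
    (h0 : ∃ y, P 0 y) (hs : ∀ n, (∃ y, P n y) → ∃ y, P (n + 1) y) (n : 𝔐.Num) : ∃ y, P n y := by
  have hX : Fn 𝔐 fun z : 𝔐.Num => P (L2Structure.unpair z).1 (dec (L2Structure.unpair z).2) := by
    obtain ⟨F, hF, hF'⟩ := hP
    exact ⟨F, hF, hF'⟩
  have key : ∀ n, (∃ y, L2Structure.pair n y ∈
      {z : 𝔐.Num | P (L2Structure.unpair z).1 (dec (L2Structure.unpair z).2)}) ↔ ∃ y, P n y := by
    intro n
    simp only [Set.mem_ofPred_eq, unpair_pair]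
    exact ((surj (𝔐 := 𝔐) (Γ := Δ)).exists (p := fun y => P n y)).symm
  have := sigma_set_induction hX.setOf_mem
  simp only [key] at this
  exact this h0 hs n

theorem strong_induction {P : 𝔐.Num → Prop} (hP : Fn 𝔐 P) (hs : ∀ n, (∀ m < n, P m) → P n)
    (n : 𝔐.Num) : P n := by
  have : ∀ n, ∀ m < n, P m := induction (ball (by fun_prop) (by fun_prop))
    (fun m hm => (Num.basic.not_lt_zero m hm).elim) fun n ih m hm => by
      rcases (Num.basic.lt_succ m n).1 hm with h | rfl
      · exact ih m h
      · exact hs m ih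
  exact hs n (this n)

theorem exists_least {P : 𝔐.Num → Prop} (hP : Fn 𝔐 P) (h : ∃ n, P n) :
    ∃ n, P n ∧ ∀ m < n, ¬ P m := by
  by_contra hc
  push Not at hc
  obtain ⟨n, hn⟩ := h
  refine strong_induction (P := fun n => ¬ P n) hP.not (fun n ih hn => ?_) n hn
  obtain ⟨m, hm, hm'⟩ := hc n hn
  exact ih m hm hm'

/-- Minimisation. -/
theorem exists_min {R : Γ → 𝔐.Num → Prop} (hR : Fn 𝔐 fun p : Γ × 𝔐.Num => R p.1 p.2)
    (h : ∀ x, ∃ n, R x n) :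
    ∃ f : Γ → 𝔐.Num, Fn 𝔐 f ∧ ∀ x, R x (f x) ∧ ∀ m < f x, ¬ R x m := by
  have h' : ∀ x, ∃ n, R x n ∧ ∀ m < n, ¬ R x m := fun x =>
    exists_least (hR.comp (f := fun n => (x, n)) (by fun_prop)) (h x)
  choose f hf using h'
  refine ⟨f, of_graph ?_, hf⟩
  have : Fn 𝔐 fun p : Γ × 𝔐.Num => R p.1 p.2 ∧ ∀ m < p.2, ¬ R p.1 m :=
    hR.and (ball (hR.comp (f := fun q : (Γ × 𝔐.Num) × 𝔐.Num => (q.1.1, q.2)) (by fun_prop)).not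
      (by fun_prop))
  refine this.congr fun ⟨x, n⟩ => ⟨fun ⟨h1, h2⟩ => ?_, ?_⟩
  · exact le_antisymm (not_lt.1 fun hl => h2 _ hl (hf x).1)
      (not_lt.1 fun hl => (hf x).2 _ hl h1)
  · intro (h : n = f x)
    subst h
    exact hf x

/-- `Δ⁰₁` comprehension. -/
theorem of_sigma {A B : Γ → 𝔐.Num → Prop} (hA : Fn 𝔐 fun p : Γ × 𝔐.Num => A p.1 p.2)
    (hB : Fn 𝔐 fun p : Γ × 𝔐.Num => B p.1 p.2) (h : ∀ x, P x ↔ ∃ n, A x n)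
    (h' : ∀ x, ¬ P x ↔ ∃ n, B x n) : Fn 𝔐 P := by
  -- Search for the first witness of either alternative; one always exists, and testing `A` at it
  -- decides `P`.
  obtain ⟨f, hf, hf'⟩ := exists_min (R := fun x n => A x n ∨ B x n) (hA.or hB) fun x => by
    by_cases hx : P x
    · exact ((h x).1 hx).imp fun _ => .inl
    · exact ((h' x).1 hx).imp fun _ => .inr
  refine (hA.comp (f := fun x => (x, f x)) (by fun_prop)).congr fun x =>
    ⟨fun hx => (h x).2 ⟨_, hx⟩, fun hx => ?_⟩
  exact (hf' x).1.resolve_right fun hb => (h' x).2 ⟨_, hb⟩ hx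

end Fn
end RCA
end L2Structure
end SOA

namespace SOA
namespace L2Structure

variable {𝔐 : L2Structure.{u}} [hR : Fact 𝔐.IsRCA0]

open Coded

/-! ## Gödel's `β` function -/

theorem Num.succ_pos (n : 𝔐.Num) : 0 < n + 1 := Num.lt_add_one_iff'.2 (Num.zero_le' n)

/-- Boundedness of a function on an initial segment is where nonstandard n matter; it needs `Σ⁰₁`
induction on the existence of the bound. -/
theorem Fn.exists_bound {f : 𝔐.Num → 𝔐.Num} (hf : Fn 𝔐 f) (n : 𝔐.Num) : ∃ B, ∀ i < n, f i < B := by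
  refine Fn.sigma_induction (P := fun n B => ∀ i < n, f i < B) (Fn.ball (by fun_prop) (by fun_prop))
    ⟨0, fun i hi => (Num.basic.not_lt_zero i hi).elim⟩ ?_ n
  rintro n ⟨B, hB⟩
  refine ⟨B + f n + 1, fun i hi => Num.lt_add_one_iff'.2 ?_⟩
  rcases (Num.basic.lt_succ i n).1 hi with h | rfl
  · exact (hB i h).le.trans le_self_add
  · exact le_add_self

theorem beta_eq {c d i q r : 𝔐.Num} (hr : r < (i + 1) * d + 1)
    (h : c = q * ((i + 1) * d + 1) + r) : beta c d i = r := by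
  have hex : ∃ r : 𝔐.Num, r < (i + 1) * d + 1 ∧ ∃ q, c = q * ((i + 1) * d + 1) + r :=
    ⟨r, hr, q, h⟩
  unfold beta
  rw [dif_pos hex]
  obtain ⟨h1, q', h2⟩ := hex.choose_spec
  exact (Num.div_unique (h2.symm.trans h) h1 hr).2

theorem beta_spec (c d i : 𝔐.Num) :
    beta c d i < (i + 1) * d + 1 ∧ ∃ q, c = q * ((i + 1) * d + 1) + beta c d i := by
  obtain ⟨q, r, hr, h⟩ := Num.exists_div c (m := (i + 1) * d + 1) (Num.succ_pos _)
  rw [beta_eq hr h]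
  exact ⟨hr, q, h⟩

theorem le_of_eq_mul_add {c q m r : 𝔐.Num} (h : c = q * (m + 1) + r) : q < c + 1 := by
  rw [h, Num.lt_add_one_iff']
  exact Num.le_iff_exists.2 ⟨q * m + r, by ring⟩

@[fun_prop]
theorem Fn.beta {Γ : Type*} [Coded 𝔐 Γ] {c d i : Γ → 𝔐.Num} (hc : Fn 𝔐 c) (hd : Fn 𝔐 d)
    (hi : Fn 𝔐 i) : Fn 𝔐 fun x => beta (c x) (d x) (i x) := by
  refine Fn.of_graph (Fn.congr (P := fun p : Γ × 𝔐.Num => p.2 < (i p.1 + 1) * d p.1 + 1 ∧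
    ∃ q < c p.1 + 1, c p.1 = q * ((i p.1 + 1) * d p.1 + 1) + p.2) ?_ ?_)
  · exact Fn.and (by fun_prop) (Fn.bex (by fun_prop) (by fun_prop))
  · rintro ⟨x, r⟩
    constructor
    · rintro ⟨h1, q, -, h2⟩
      exact (beta_eq h1 h2).symm
    · intro (h : r = L2Structure.beta (c x) (d x) (i x))
      subst h
      obtain ⟨h1, q, h2⟩ := beta_spec (c x) (d x) (i x)
      exact ⟨h1, q, le_of_eq_mul_add h2, h2⟩

/-- The substitute for a large multiple of n!, built before recursion is available. The auxiliary
statement bounds e so that its matrix is decidable. -/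
theorem exists_common_multiple (n b : 𝔐.Num) : ∃ D, b < D ∧ ∀ j < n, ∃ e, D = (j + 1) * e := by
  have : ∃ D, 0 < D ∧ ∀ j < n, ∃ e < D + 1, D = (j + 1) * e := by
    refine Fn.sigma_induction (P := fun n D => 0 < D ∧ ∀ j < n, ∃ e < D + 1, D = (j + 1) * e)
      (Fn.and (by fun_prop) (Fn.ball (Fn.bex (by fun_prop) (by fun_prop)) (by fun_prop)))
      ⟨1, one_pos, fun i hi => (Num.basic.not_lt_zero i hi).elim⟩ ?_ n
    rintro n ⟨D, hD, h⟩
    refine ⟨(n + 1) * D, mul_pos (Num.succ_pos _) hD, fun j hj => ?_⟩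
    rcases (Num.basic.lt_succ j n).1 hj with hj | rfl
    · obtain ⟨e, -, rfl⟩ := h j hj
      refine ⟨(n + 1) * e, Num.lt_add_one_iff'.2 (Num.le_iff_exists.2 ⟨(n + 1) * j * e, ?_⟩), ?_⟩
      <;> ring
    · exact ⟨D, Num.lt_add_one_iff'.2 (Num.le_iff_exists.2 ⟨j * D, by ring⟩), rfl⟩
  obtain ⟨D, hD, h⟩ := this
  obtain ⟨k, hk⟩ := Num.lt_iff_exists.1 hD
  refine ⟨D * (b + 1), Num.lt_iff_exists.2 ⟨k * (b + 1), ?_⟩, fun j hj => ?_⟩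
  · rw [← hk]; ring
  · obtain ⟨e, -, rfl⟩ := h j hj
    exact ⟨e * (b + 1), by ring⟩

/-- `P` is invertible modulo `m`. -/
def InvMod (P m : 𝔐.Num) : Prop := ∃ w q, P * w = q * m + 1

theorem InvMod.mul {P P' m : 𝔐.Num} (h : InvMod P m) (h' : InvMod P' m) : InvMod (P * P') m := by
  obtain ⟨w, q, h⟩ := h
  obtain ⟨w', q', h'⟩ := h'
  refine ⟨w * w', q * q' * m + q + q', ?_⟩
  rw [mul_mul_mul_comm, h, h']; ring

/-- Reducing the inverse modulo m bounds it. Invertibility thus becomes decidable and may occur in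
the induction of `exists_beta_eq`. -/
theorem InvMod.bounded {P m : 𝔐.Num} (hm : 1 < m) (h : InvMod P m) :
    ∃ w < m, ∃ q < P * w + 1, P * w = q * m + 1 := by
  obtain ⟨w, q, h⟩ := h
  obtain ⟨a, r, hr, rfl⟩ := Num.exists_div w (zero_lt_one.trans hm)
  obtain ⟨s, t, ht, h2⟩ := Num.exists_div (P * r) (zero_lt_one.trans hm)
  have h3 : (P * a + s) * m + t = q * m + 1 := by
    rw [← h, mul_add, h2]; ring
  obtain ⟨-, rfl⟩ := Num.div_unique h3 ht hm
  refine ⟨r, hr, s, ?_, h2⟩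
  obtain ⟨k, rfl⟩ := Num.lt_iff_exists.1 hm
  exact le_of_eq_mul_add (m := 1 + k) (r := 1) (by rw [h2]; ring)

theorem invMod_of_lt {D i j : 𝔐.Num} (hD : 0 < D) (hij : i < j) (h : ∀ k < j, ∃ e, D = (k + 1) * e) :
    InvMod ((i + 1) * D + 1) ((j + 1) * D + 1) := by
  obtain ⟨t, rfl⟩ := Num.lt_iff_exists.1 hij
  obtain ⟨e, rfl⟩ := h t (Num.lt_iff_exists.2 ⟨i, by ring⟩)
  obtain ⟨M, hM⟩ : ∃ M, (i + (t + 1) + 1) * ((t + 1) * e) = M + 1 := by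
    obtain ⟨k, hk⟩ := Num.lt_iff_exists.1
      (mul_pos (Num.succ_pos (i + (t + 1))) hD)
    exact ⟨k, by rw [← hk]; ring⟩
  -- Write j = i + t + 1, so M + 1 = (j + 1)D is -1 modulo the second modulus. One factor j + 1
  -- turns the first modulus into t + 1, the factor (j + 1)e turns that into (j + 1)D = -1, and the
  -- factor M + 1 corrects the sign.
  refine ⟨(i + (t + 1) + 1) * (i + (t + 1) + 1) * e * (M + 1),
    (M + 1) * e * (i + (t + 1) + 1) * (i + 1) + M, ?_⟩
  have h1 : ((i + 1) * ((t + 1) * e) + 1) * ((i + (t + 1) + 1) * (i + (t + 1) + 1) * e * (M + 1)) =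
    (M + 1) * e * (i + (t + 1) + 1) * (i + 1) * ((i + (t + 1) + 1) * ((t + 1) * e) + 1) +
      (i + (t + 1) + 1) * ((t + 1) * e) * (M + 1) := by ring
  rw [h1, hM]; ring

/-- The Chinese remainder theorem for the moduli of the `β` function. -/
theorem exists_beta_eq {x : 𝔐.Num → 𝔐.Num} (hx : Fn 𝔐 x) (n : 𝔐.Num) :
    ∃ c d, ∀ i < n, beta c d i = x i := by
  obtain ⟨B, hB⟩ := hx.exists_bound n
  obtain ⟨D, hBD, hD⟩ := exists_common_multiple n B
  have hD0 : 0 < D := (Num.zero_le' B).trans_lt hBD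
  have hm : ∀ i : 𝔐.Num, 1 < (i + 1) * D + 1 := fun i =>
    lt_add_of_pos_left _ (mul_pos (Num.succ_pos _) hD0)
  -- Invariant of the construction: `p.1` has the first k prescribed remainders, while `p.2` is
  -- divisible by the first k moduli and invertible modulo the later ones.
  have key : ∀ k, ∃ p : 𝔐.Num × 𝔐.Num, k ≤ n → (∀ i < k, beta p.1 D i = x i) ∧
      (∀ i < k, ∃ q < p.2 + 1, p.2 = q * ((i + 1) * D + 1)) ∧
      (∀ j < n, k ≤ j → ∃ w < (j + 1) * D + 1, ∃ q < p.2 * w + 1,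
        p.2 * w = q * ((j + 1) * D + 1) + 1) := by
    refine Fn.sigma_induction (Fn.imp (by fun_prop) (Fn.and (Fn.ball (by fun_prop) (by fun_prop))
      (Fn.and (Fn.ball (Fn.bex (by fun_prop) (by fun_prop)) (by fun_prop)) (Fn.ball (Fn.imp
        (by fun_prop) (Fn.bex (Fn.bex (by fun_prop) (by fun_prop)) (by fun_prop)))
          (by fun_prop))))) ⟨(0, 1), fun _ => ⟨?_, ?_, ?_⟩⟩ ?_
    · exact fun i hi => (Num.basic.not_lt_zero i hi).elim
    · exact fun i hi => (Num.basic.not_lt_zero i hi).elim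
    · exact fun j _ _ => InvMod.bounded (hm j) ⟨1, 0, by simp⟩
    · rintro k ⟨⟨c, P⟩, h⟩
      by_cases hk : k + 1 ≤ n
      swap
      · exact ⟨(0, 0), fun h => (hk h).elim⟩
      have hkn : k < n := (lt_add_one k).trans_le hk
      obtain ⟨h1, h2, h3⟩ := h hkn.le
      obtain ⟨w, -, q, -, hw⟩ := h3 k hkn le_rfl
      obtain ⟨a, r, hr, hc⟩ := Num.exists_div c (zero_lt_one.trans (hm k))
      obtain ⟨r', hr'⟩ := Num.le_iff_exists.1 hr.le
      -- Modulo the k-th modulus, P * w is 1 and c is r; adding r', with r + r' equal to that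
      -- modulus, cancels r without subtraction and leaves x k. Earlier remainders do not change
      -- because P is divisible by their moduli.
      refine ⟨(c + P * (w * (x k + r')), P * ((k + 1) * D + 1)), fun _ => ⟨?_, ?_, ?_⟩⟩
      · intro i hi
        rcases (Num.basic.lt_succ i k).1 hi with hi | rfl
        · obtain ⟨s, -, hs⟩ := h2 i hi
          dsimp only at hs ⊢
          rw [← h1 i hi]
          obtain ⟨h4, u, h5⟩ := beta_spec c D i
          refine beta_eq (q := u + s * (w * (x k + r'))) h4 ?_
          rw [hs]; nth_rw 1 [h5]; ring
        · have hxm : x i < (i + 1) * D + 1 := ((hB i hkn).trans hBD).trans_le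
            (Num.le_iff_exists.2 ⟨i * D + 1, by ring⟩)
          refine beta_eq (q := a + q * (x i + r') + 1) hxm ?_
          dsimp only at hw ⊢
          rw [← mul_assoc, hw, hc]
          generalize (i + 1) * D + 1 = m at *
          calc a * m + r + (q * m + 1) * (x i + r')
              = a * m + q * m * (x i + r') + (r + r') + x i := by ring
            _ = _ := by rw [← hr']; ring
      · intro i hi
        rcases (Num.basic.lt_succ i k).1 hi with hi | rfl
        · obtain ⟨s, -, hs⟩ := h2 i hi
          dsimp only at hs ⊢
          refine ⟨s * ((k + 1) * D + 1), le_of_eq_mul_add (m := (i + 1) * D) (r := 0) ?_, ?_⟩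
          · rw [hs]; ring
          · rw [hs]; ring
        · exact ⟨P, le_of_eq_mul_add (m := (i + 1) * D) (r := 0) (by ring), rfl⟩
      · intro j hj hkj
        have hkj' : k < j := (lt_add_one k).trans_le hkj
        refine InvMod.bounded (hm j) (InvMod.mul ?_ (invMod_of_lt hD0 hkj' fun l hl =>
          hD l (hl.trans hj)))
        obtain ⟨w, -, q, -, hw⟩ := h3 j hj hkj'.le
        exact ⟨w, q, hw⟩
  obtain ⟨p, hp⟩ := key n
  exact ⟨p.1, D, (hp le_rfl).1⟩

/-! ## Primitive recursion -/

/-- The value at n is read from the least β-code of a computation of length n. Such codes exist by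
`Σ⁰₁` induction, and codes of different computations agree on their common length. -/
theorem exists_num_rec {a : 𝔐.Num → 𝔐.Num} {G : 𝔐.Num → 𝔐.Num → 𝔐.Num → 𝔐.Num} (ha : Fn 𝔐 a)
    (hG : Fn 𝔐 fun p : 𝔐.Num × 𝔐.Num × 𝔐.Num => G p.1 p.2.1 p.2.2) :
    ∃ H : 𝔐.Num → 𝔐.Num → 𝔐.Num, (Fn 𝔐 fun p : 𝔐.Num × 𝔐.Num => H p.1 p.2) ∧
      ∀ z, H z 0 = a z ∧ ∀ n, H z (n + 1) = G z n (H z n) := by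
  let R : 𝔐.Num → 𝔐.Num → 𝔐.Num → 𝔐.Num → Prop := fun z n c d =>
    beta c d 0 = a z ∧ ∀ i < n, beta c d (i + 1) = G z i (beta c d i)
  have hR : Fn 𝔐 fun p : (𝔐.Num × 𝔐.Num) × 𝔐.Num =>
      R p.1.1 p.1.2 (unpair p.2).1 (unpair p.2).2 :=
    Fn.and (by fun_prop) (Fn.ball (Fn.eq (by fun_prop) (hG.comp
      (f := fun q : ((𝔐.Num × 𝔐.Num) × 𝔐.Num) × 𝔐.Num => (q.1.1.1, q.2,
        beta (unpair q.1.2).1 (unpair q.1.2).2 q.2)) (by fun_prop))) (by fun_prop))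
  have hex : ∀ z n, ∃ w, R z n (unpair w).1 (unpair w).2 := by
    intro z
    refine Fn.sigma_induction (hR.comp (f := fun p : 𝔐.Num × 𝔐.Num => ((z, p.1), p.2))
      (by fun_prop)) ?_ ?_
    · obtain ⟨c, d, h⟩ := exists_beta_eq (Fn.const (a z)) (1 : 𝔐.Num)
      exact ⟨pair c d, by simpa using h 0 one_pos,
        fun i hi => (Num.basic.not_lt_zero i hi).elim⟩
    · rintro n ⟨w, h0, h⟩
      generalize (unpair w).1 = c at *
      generalize (unpair w).2 = d at *
      -- A coded sequence is extended by one entry by coding the extended sequence anew.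
      obtain ⟨c', d', h'⟩ := exists_beta_eq (x := fun i => if i < n + 1 then beta c d i else
        G z n (beta c d n)) (Fn.ite (by fun_prop) (by fun_prop) (by fun_prop)) (n + 1 + 1)
      have hlt : ∀ i, i < n + 1 → beta c' d' i = beta c d i := fun i hi =>
        (h' i (hi.trans (lt_add_one _))).trans (if_pos hi)
      refine ⟨pair c' d', ?_, fun i hi => ?_⟩
      · simp only [unpair_pair]
        rw [hlt 0 (Num.succ_pos _), h0]
      · simp only [unpair_pair]
        rw [hlt i hi]
        rcases (Num.basic.lt_succ i n).1 hi with hi | rfl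
        · rw [hlt _ (by simpa using hi), h i hi]
        · rw [h' _ (lt_add_one _), if_neg (lt_irrefl _)]
  obtain ⟨f, hf, hf'⟩ := Fn.exists_min hR fun p : 𝔐.Num × 𝔐.Num => hex p.1 p.2
  have huniq : ∀ z n n' c d c' d', R z n c d → R z n' c' d' →
      ∀ i, i ≤ n → i ≤ n' → beta c d i = beta c' d' i := by
    intro z n n' c d c' d' h h' 
    refine Fn.induction (Fn.imp (by fun_prop) (Fn.imp (by fun_prop) (by fun_prop)))
      (fun _ _ => h.1.trans h'.1.symm) fun i ih hi hi' => ?_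
    have h1 := (lt_add_one i).trans_le hi
    have h2 := (lt_add_one i).trans_le hi'
    rw [h.2 i h1, h'.2 i h2, ih h1.le h2.le]
  refine ⟨fun z n => beta (unpair (f (z, n))).1 (unpair (f (z, n))).2 n, by fun_prop,
    fun z => ⟨(hf' (z, 0)).1.1, fun n => ?_⟩⟩
  beta_reduce
  rw [(hf' (z, n + 1)).1.2 n (lt_add_one n)]
  exact congrArg _ (huniq z _ _ _ _ _ _ (hf' (z, n + 1)).1 (hf' (z, n)).1 n (lt_add_one n).le le_rfl)

section Rec

variable {Γ Δ : Type*} [Coded 𝔐 Γ] [Coded 𝔐 Δ]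

/-- `s` is computed in the structure by the recursion `s 0 = a`, `s (n + 1) = G n (s n)`. -/
def IsRec (a : Δ) (G : 𝔐.Num → Δ → Δ) (s : 𝔐.Num → Δ) : Prop :=
  Fn 𝔐 s ∧ s 0 = a ∧ ∀ n, s (n + 1) = G n (s n)

open Classical in
/-- Primitive recursion inside the structure. -/
noncomputable def irec (a : Δ) (G : 𝔐.Num → Δ → Δ) (n : 𝔐.Num) : Δ :=
  if h : ∃ s, IsRec a G s then h.choose n else a

/-- The recursion runs on codes, so its values may depend on the code z chosen for the parameter;
only the decoded values are specified. -/
theorem exists_isRec_uniform {a : Γ → Δ} {G : Γ → 𝔐.Num → Δ → Δ} (ha : Fn 𝔐 a)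
    (hG : Fn 𝔐 fun p : Γ × 𝔐.Num × Δ => G p.1 p.2.1 p.2.2) :
    ∃ H : 𝔐.Num → 𝔐.Num → 𝔐.Num, (Fn 𝔐 fun p : 𝔐.Num × 𝔐.Num => H p.1 p.2) ∧
      ∀ z, IsRec (a (dec z)) (G (dec z)) fun n => dec (H z n) := by
  obtain ⟨A, hA, hA'⟩ := ha
  obtain ⟨F, hF, hF'⟩ := hG
  obtain ⟨H, hH, hH'⟩ := exists_num_rec (a := A) (G := fun z n y => F (pair z (pair n y))) hA.fn
    (hF.fn.comp (by fun_prop))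
  refine ⟨H, hH, fun z => ⟨?_, ?_, fun n => ?_⟩⟩
  · exact Fn.comp (g := dec) ⟨_, IsFun.id, fun _ => rfl⟩
      (hH.comp (f := fun n => (z, n)) (by fun_prop))
  · beta_reduce
    rw [(hH' z).1, hA']
  · beta_reduce
    rw [(hH' z).2, hF']
    simp [dec_prod, dec_num]

theorem exists_isRec {a : Δ} {G : 𝔐.Num → Δ → Δ} (hG : Fn 𝔐 fun p : 𝔐.Num × Δ => G p.1 p.2) :
    ∃ s, IsRec a G s := by
  obtain ⟨H, -, h⟩ := exists_isRec_uniform (Γ := 𝔐.Num) (a := fun _ => a) (G := fun _ => G)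
    (Fn.const a) (hG.comp (f := fun p : 𝔐.Num × 𝔐.Num × Δ => p.2) (by fun_prop))
  exact ⟨_, h 0⟩

/-- Uniqueness is an internal induction on an equation, so equality in the value type has to be
decidable on codes. This is the reason for `CodedEq`. -/
theorem IsRec.unique [CodedEq 𝔐 Δ] {a : Δ} {G : 𝔐.Num → Δ → Δ} {s s' : 𝔐.Num → Δ}
    (h : IsRec a G s) (h' : IsRec a G s') : s = s' := by
  have h1 := h.1
  have h2 := h'.1
  refine funext (Fn.induction (by fun_prop) (h.2.1.trans h'.2.1.symm) fun n ih => ?_)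
  rw [h.2.2, h'.2.2, ih]

theorem IsRec.eq_irec [CodedEq 𝔐 Δ] {a : Δ} {G : 𝔐.Num → Δ → Δ} {s : 𝔐.Num → Δ}
    (h : IsRec a G s) : s = irec a G := by
  have hex : ∃ s, IsRec a G s := ⟨s, h⟩
  funext n
  unfold irec
  rw [dif_pos hex]
  exact congrFun (h.unique hex.choose_spec) n

theorem isRec_irec [CodedEq 𝔐 Δ] {a : Δ} {G : 𝔐.Num → Δ → Δ}
    (hG : Fn 𝔐 fun p : 𝔐.Num × Δ => G p.1 p.2) : IsRec a G (irec a G) := by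
  obtain ⟨s, hs⟩ := exists_isRec (a := a) hG
  exact hs.eq_irec ▸ hs

theorem Fn.irec [CodedEq 𝔐 Δ] {a : Γ → Δ} {G : Γ → 𝔐.Num → Δ → Δ} {n : Γ → 𝔐.Num} (ha : Fn 𝔐 a)
    (hG : Fn 𝔐 fun p : Γ × 𝔐.Num × Δ => G p.1 p.2.1 p.2.2) (hn : Fn 𝔐 n) :
    Fn 𝔐 fun x => irec (a x) (G x) (n x) := by
  obtain ⟨H, hH, h⟩ := exists_isRec_uniform ha hG
  obtain ⟨N, hN, hN'⟩ := hn
  refine ⟨fun z => H z (N z), (hH.comp (f := fun z => (z, N z))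
    (Fn.prodMk Fn.id hN.fn)).isFun, fun z => ?_⟩
  beta_reduce
  rw [← (h z).eq_irec, ← hN']
  rfl

end Rec

/-! ## The ordered field of fractions of the structure -/

namespace Q

@[simp] theorem zero_pos : (0 : Q 𝔐).pos = 0 := rfl
@[simp] theorem zero_neg : (0 : Q 𝔐).neg = 0 := rfl
@[simp] theorem zero_den : (0 : Q 𝔐).den = 0 := rfl
@[simp] theorem one_pos : (1 : Q 𝔐).pos = 1 := rfl
@[simp] theorem one_neg : (1 : Q 𝔐).neg = 0 := rfl
@[simp] theorem one_den : (1 : Q 𝔐).den = 0 := rfl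
@[simp] theorem neg_pos (r : Q 𝔐) : (-r).pos = r.neg := rfl
@[simp] theorem neg_neg (r : Q 𝔐) : (-r).neg = r.pos := rfl
@[simp] theorem neg_den (r : Q 𝔐) : (-r).den = r.den := rfl
@[simp] theorem add_pos (r s : Q 𝔐) :
    (r + s).pos = r.pos * (s.den + 1) + s.pos * (r.den + 1) := rfl
@[simp] theorem add_neg (r s : Q 𝔐) :
    (r + s).neg = r.neg * (s.den + 1) + s.neg * (r.den + 1) := rfl
@[simp] theorem add_den (r s : Q 𝔐) : (r + s).den = r.den * s.den + r.den + s.den := rfl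
@[simp] theorem mul_pos (r s : Q 𝔐) : (r * s).pos = r.pos * s.pos + r.neg * s.neg := rfl
@[simp] theorem mul_neg (r s : Q 𝔐) : (r * s).neg = r.pos * s.neg + r.neg * s.pos := rfl
@[simp] theorem mul_den (r s : Q 𝔐) : (r * s).den = r.den * s.den + r.den + s.den := rfl

theorem le_def (r s : Q 𝔐) : r ≤ s ↔
    r.pos * (s.den + 1) + s.neg * (r.den + 1) ≤ s.pos * (r.den + 1) + r.neg * (s.den + 1) := Iff.rfl

theorem lt_def (r s : Q 𝔐) : r < s ↔
    r.pos * (s.den + 1) + s.neg * (r.den + 1) < s.pos * (r.den + 1) + r.neg * (s.den + 1) := Iff.rfl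

/-- Equality of the rational numbers denoted by two fractions. -/
def Equiv (r s : Q 𝔐) : Prop :=
  r.pos * (s.den + 1) + s.neg * (r.den + 1) = s.pos * (r.den + 1) + r.neg * (s.den + 1)

theorem Equiv.trans {r s t : Q 𝔐} (h : r.Equiv s) (h' : s.Equiv t) : r.Equiv t := by
  have : s.den + 1 ≠ 0 := (Num.succ_pos _).ne'
  refine mul_right_cancel₀ this ?_
  unfold Equiv at h h'
  grind

variable (𝔐) in
/-- Equality of rational numbers, as a setoid on fractions. -/
def setoid : Setoid (Q 𝔐) where
  r := Equiv
  iseqv := ⟨fun _ => rfl, fun h => Eq.symm h, Equiv.trans⟩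

theorem le_congr_left {r r' s : Q 𝔐} (h : r.Equiv r') (hs : r ≤ s) : r' ≤ s := by
  rw [le_def, Num.le_iff_exists] at hs
  obtain ⟨k, hk⟩ := hs
  unfold Equiv at h
  rw [le_def]
  refine le_of_mul_le_mul_right ?_ (Num.succ_pos r.den)
  rw [Num.le_iff_exists]
  exact ⟨k * (r'.den + 1), by grind⟩

theorem le_congr_right {r s s' : Q 𝔐} (h : s.Equiv s') (hs : r ≤ s) : r ≤ s' := by
  rw [le_def, Num.le_iff_exists] at hs
  obtain ⟨k, hk⟩ := hs
  unfold Equiv at h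
  rw [le_def]
  refine le_of_mul_le_mul_right ?_ (Num.succ_pos s.den)
  rw [Num.le_iff_exists]
  exact ⟨k * (s'.den + 1), by grind⟩

end Q

variable (𝔐) in
/-- The field of rational numbers of the structure. -/
def K : Type u := Quotient (Q.setoid 𝔐)

namespace K

/-- The rational number denoted by a fraction. -/
def val (r : Q 𝔐) : K 𝔐 := Quotient.mk _ r

theorem val_eq_val {r s : Q 𝔐} : val r = val s ↔ r.Equiv s := Quotient.eq (r := Q.setoid 𝔐)

theorem val_surjective : Function.Surjective (val (𝔐 := 𝔐)) := Quotient.mk_surjective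

instance : Zero (K 𝔐) := ⟨val 0⟩
instance : One (K 𝔐) := ⟨val 1⟩
instance : Neg (K 𝔐) := ⟨Quotient.map (fun r => -r) fun r s (h : r.Equiv s) => by
  show (-r).Equiv (-s)
  unfold Q.Equiv at *
  simp only [Q.neg_pos, Q.neg_neg, Q.neg_den]
  grind⟩
instance : Add (K 𝔐) := ⟨Quotient.map₂ (fun r s => r + s)
  fun r r' (h : r.Equiv r') s s' (h' : s.Equiv s') => by
    show (r + s).Equiv (r' + s')
    unfold Q.Equiv at *
    simp only [Q.add_pos, Q.add_neg, Q.add_den]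
    grind⟩
instance : Mul (K 𝔐) := ⟨Quotient.map₂ (fun r s => r * s)
  fun r r' (h : r.Equiv r') s s' (h' : s.Equiv s') => by
    have h1 : (r * s).Equiv (r' * s) := by
      unfold Q.Equiv at *
      simp only [Q.mul_pos, Q.mul_neg, Q.mul_den]
      grind
    have h2 : (r' * s).Equiv (r' * s') := by
      unfold Q.Equiv at *
      simp only [Q.mul_pos, Q.mul_neg, Q.mul_den]
      grind
    exact h1.trans h2⟩

open Classical in
noncomputable instance : Inv (K 𝔐) := ⟨fun x => if h : ∃ y, x * y = 1 then h.choose else 0⟩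

theorem val_zero : val (0 : Q 𝔐) = 0 := rfl
theorem val_one : val (1 : Q 𝔐) = 1 := rfl
theorem val_neg (r : Q 𝔐) : val (-r) = -val r := rfl
theorem val_add (r s : Q 𝔐) : val (r + s) = val r + val s := rfl
theorem val_mul (r s : Q 𝔐) : val (r * s) = val r * val s := rfl

theorem zero_ne_one : (0 : K 𝔐) ≠ 1 := fun h => by
  have : (0 : Q 𝔐).Equiv 1 := val_eq_val.1 h
  simp [Q.Equiv] at this

theorem exists_mul_eq_one {x : K 𝔐} (hx : x ≠ 0) : ∃ y, x * y = 1 := by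
  obtain ⟨r, rfl⟩ := val_surjective x
  rcases lt_trichotomy r.pos r.neg with h | h | h
  · obtain ⟨k, hk⟩ := Num.lt_iff_exists.1 h
    -- The third entry of a fraction is its denominator minus one, so the difference k + 1 becomes
    -- the new denominator through k.
    refine ⟨val ⟨0, r.den + 1, k⟩, val_eq_val.2 ?_⟩
    unfold Q.Equiv
    simp only [Q.mul_pos, Q.mul_neg, Q.mul_den, Q.one_pos, Q.one_neg, Q.one_den]
    grind
  · refine (hx (val_eq_val.2 ?_)).elim
    simp [Q.Equiv, h]
  · obtain ⟨k, hk⟩ := Num.lt_iff_exists.1 h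
    refine ⟨val ⟨r.den + 1, 0, k⟩, val_eq_val.2 ?_⟩
    unfold Q.Equiv
    simp only [Q.mul_pos, Q.mul_neg, Q.mul_den, Q.one_pos, Q.one_neg, Q.one_den]
    grind

noncomputable instance : Field (K 𝔐) := Field.ofMinimalAxioms (K 𝔐)
  (fun x y z => by
    obtain ⟨r, rfl⟩ := val_surjective x
    obtain ⟨s, rfl⟩ := val_surjective y
    obtain ⟨t, rfl⟩ := val_surjective z
    refine val_eq_val.2 ?_
    unfold Q.Equiv
    simp only [Q.add_pos, Q.add_neg, Q.add_den]
    ring)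
  (fun x => by
    obtain ⟨r, rfl⟩ := val_surjective x
    refine val_eq_val.2 ?_
    unfold Q.Equiv
    simp only [Q.add_pos, Q.add_neg, Q.add_den, Q.zero_pos, Q.zero_neg, Q.zero_den]
    ring)
  (fun x => by
    obtain ⟨r, rfl⟩ := val_surjective x
    refine val_eq_val.2 ?_
    unfold Q.Equiv
    simp only [Q.add_pos, Q.add_neg, Q.add_den, Q.zero_pos, Q.zero_neg, Q.zero_den, Q.neg_pos,
      Q.neg_neg, Q.neg_den]
    ring)
  (fun x y z => by
    obtain ⟨r, rfl⟩ := val_surjective x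
    obtain ⟨s, rfl⟩ := val_surjective y
    obtain ⟨t, rfl⟩ := val_surjective z
    refine val_eq_val.2 ?_
    unfold Q.Equiv
    simp only [Q.mul_pos, Q.mul_neg, Q.mul_den]
    ring)
  (fun x y => by
    obtain ⟨r, rfl⟩ := val_surjective x
    obtain ⟨s, rfl⟩ := val_surjective y
    refine val_eq_val.2 ?_
    unfold Q.Equiv
    simp only [Q.mul_pos, Q.mul_neg, Q.mul_den]
    ring)
  (fun x => by
    obtain ⟨r, rfl⟩ := val_surjective x
    refine val_eq_val.2 ?_
    unfold Q.Equiv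
    simp only [Q.mul_pos, Q.mul_neg, Q.mul_den, Q.one_pos, Q.one_neg, Q.one_den]
    ring)
  (fun x hx => by
    have h := exists_mul_eq_one hx
    have h' : x⁻¹ = h.choose := dif_pos h
    rw [h']
    exact h.choose_spec)
  (by
    refine dif_neg ?_
    rintro ⟨y, hy⟩
    obtain ⟨r, rfl⟩ := val_surjective y
    have := val_eq_val.1 ((val_mul 0 r).trans hy)
    simp only [Q.Equiv, Q.mul_pos, Q.mul_neg, Q.mul_den, Q.zero_pos, Q.zero_neg, Q.zero_den,
      Q.one_pos, Q.one_neg, Q.one_den, zero_mul, zero_add, add_zero, one_mul] at this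
    exact (Num.succ_pos _).ne this)
  (fun x y z => by
    obtain ⟨r, rfl⟩ := val_surjective x
    obtain ⟨s, rfl⟩ := val_surjective y
    obtain ⟨t, rfl⟩ := val_surjective z
    refine val_eq_val.2 ?_
    unfold Q.Equiv
    simp only [Q.mul_pos, Q.mul_neg, Q.mul_den, Q.add_pos, Q.add_neg, Q.add_den]
    ring)
  ⟨0, 1, zero_ne_one⟩

theorem val_sub (r s : Q 𝔐) : val (r - s) = val r - val s := by
  rw [sub_eq_add_neg, ← val_neg, ← val_add]; rfl

instance : LE (K 𝔐) := ⟨Quotient.lift₂ (fun r s => r ≤ s)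
  fun _ _ _ _ h h' => propext ⟨fun hs => Q.le_congr_left h (Q.le_congr_right h' hs),
    fun hs => Q.le_congr_left (Eq.symm h) (Q.le_congr_right (Eq.symm h') hs)⟩⟩

theorem val_le_val {r s : Q 𝔐} : val r ≤ val s ↔ r ≤ s := Iff.rfl

theorem le_iff_nonneg {x y : K 𝔐} : x ≤ y ↔ 0 ≤ y - x := by
  obtain ⟨r, rfl⟩ := val_surjective x
  obtain ⟨s, rfl⟩ := val_surjective y
  rw [← val_zero, sub_eq_add_neg, ← val_neg, ← val_add, val_le_val, val_le_val, Q.le_def, Q.le_def]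
  simp only [Q.add_pos, Q.add_neg, Q.neg_neg, Q.neg_pos, Q.neg_den, Q.zero_pos, Q.zero_neg,
    Q.zero_den, zero_mul, zero_add, mul_one, add_zero]
  rw [add_comm (s.neg * _)]

open Classical in
noncomputable instance : LinearOrder (K 𝔐) where
  le_refl x := by
    obtain ⟨r, rfl⟩ := val_surjective x
    exact (le_refl (r.pos * (r.den + 1) + r.neg * (r.den + 1)))
  le_trans x y z := by
    obtain ⟨r, rfl⟩ := val_surjective x
    obtain ⟨s, rfl⟩ := val_surjective y
    obtain ⟨t, rfl⟩ := val_surjective z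
    simp only [val_le_val, Q.le_def, Num.le_iff_exists]
    rintro ⟨k, hk⟩ ⟨l, hl⟩
    rw [← Num.le_iff_exists]
    refine le_of_mul_le_mul_right ?_ (Num.succ_pos s.den)
    rw [Num.le_iff_exists]
    exact ⟨k * (t.den + 1) + l * (r.den + 1), by grind⟩
  le_antisymm x y := by
    obtain ⟨r, rfl⟩ := val_surjective x
    obtain ⟨s, rfl⟩ := val_surjective y
    simp only [val_le_val, Q.le_def, val_eq_val]
    exact fun h h' => le_antisymm h h'
  le_total x y := by
    obtain ⟨r, rfl⟩ := val_surjective x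
    obtain ⟨s, rfl⟩ := val_surjective y
    exact le_total (r.pos * (s.den + 1) + s.neg * (r.den + 1)) _
  toDecidableLE := Classical.decRel _

theorem val_lt_val {r s : Q 𝔐} : val r < val s ↔ r < s := by
  rw [← not_le, val_le_val, Q.le_def, Q.lt_def, not_le]

theorem zero_lt_val {r : Q 𝔐} : 0 < val r ↔ r.neg < r.pos := by
  rw [← val_zero, val_lt_val, Q.lt_def]
  simp

instance : IsOrderedAddMonoid (K 𝔐) where
  add_le_add_left x y h z := by
    rw [le_iff_nonneg] at h ⊢
    rwa [add_sub_add_right_eq_sub]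

instance : ZeroLEOneClass (K 𝔐) where
  zero_le_one := by
    rw [← val_zero, ← val_one, val_le_val, Q.le_def]
    simp

instance : IsStrictOrderedRing (K 𝔐) := .of_mul_pos fun x y => by
  obtain ⟨r, rfl⟩ := val_surjective x
  obtain ⟨s, rfl⟩ := val_surjective y
  rw [← val_mul]
  simp only [zero_lt_val, Q.mul_pos, Q.mul_neg]
  intro h h'
  obtain ⟨k, hk⟩ := Num.lt_iff_exists.1 h
  obtain ⟨l, hl⟩ := Num.lt_iff_exists.1 h'
  exact Num.lt_iff_exists.2 ⟨k * l + k + l, by grind⟩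

theorem val_abs (r : Q 𝔐) : val r.abs = |val r| := by
  unfold Q.abs
  split_ifs with h
  · rw [abs_of_nonneg]
    rw [← val_zero, val_le_val, Q.le_def]
    simpa using h
  · rw [val_neg, abs_of_neg]
    rw [← val_zero, val_lt_val, Q.lt_def]
    simpa using h

/-- The embedding of the numbers into the rational numbers. -/
@[coe]
def ofNum (n : 𝔐.Num) : K 𝔐 := val (Q.ofNum n)

instance : CoeTail 𝔐.Num (K 𝔐) := ⟨ofNum⟩

@[simp, norm_cast]
theorem ofNum_zero : ((0 : 𝔐.Num) : K 𝔐) = 0 := rfl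

@[simp, norm_cast]
theorem ofNum_one : ((1 : 𝔐.Num) : K 𝔐) = 1 := rfl

@[simp, norm_cast]
theorem ofNum_add (m n : 𝔐.Num) : ((m + n : 𝔐.Num) : K 𝔐) = m + n :=
  val_eq_val.2 (by simp [Q.Equiv, Q.ofNum])

@[simp, norm_cast]
theorem ofNum_mul (m n : 𝔐.Num) : ((m * n : 𝔐.Num) : K 𝔐) = m * n :=
  val_eq_val.2 (by simp [Q.Equiv, Q.ofNum])

@[simp, norm_cast]
theorem ofNum_le {m n : 𝔐.Num} : (m : K 𝔐) ≤ n ↔ m ≤ n := by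
  show val _ ≤ val _ ↔ _
  rw [val_le_val, Q.le_def]; simp [Q.ofNum]

@[simp, norm_cast]
theorem ofNum_lt {m n : 𝔐.Num} : (m : K 𝔐) < n ↔ m < n := by
  rw [← not_le, ofNum_le, not_le]

@[simp]
theorem ofNum_nonneg (n : 𝔐.Num) : (0 : K 𝔐) ≤ n := by
  rw [← ofNum_zero, ofNum_le]; exact Num.zero_le' n

theorem ofNum_succ_pos (n : 𝔐.Num) : (0 : K 𝔐) < n + 1 := by
  linarith [ofNum_nonneg n]

theorem val_eq (r : Q 𝔐) : val r = (r.pos - r.neg) / (r.den + 1) := by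
  rw [eq_div_iff (ofNum_succ_pos _).ne', ← ofNum_one, ← ofNum_add, sub_eq_add_neg]
  refine val_eq_val.2 ?_
  simp only [Q.Equiv, Q.ofNum, Q.mul_pos, Q.mul_neg, Q.mul_den, Q.add_pos, Q.add_neg, Q.add_den,
    Q.neg_pos, Q.neg_neg, Q.neg_den]
  ring

/-- The field is Archimedean relative to the numbers of the structure, though not in general
relative to the standard ones. -/
theorem exists_ofNum_ge (x : K 𝔐) : ∃ n : 𝔐.Num, x ≤ n := by
  obtain ⟨r, rfl⟩ := val_surjective x
  refine ⟨r.pos, ?_⟩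
  rw [val_eq, div_le_iff₀ (ofNum_succ_pos _)]
  nlinarith [ofNum_nonneg r.pos, ofNum_nonneg r.neg, ofNum_nonneg r.den,
    mul_nonneg (ofNum_nonneg r.pos) (ofNum_nonneg r.den)]

theorem exists_inv_succ_le {x : K 𝔐} (hx : 0 < x) : ∃ n : 𝔐.Num, 1 / ((n : K 𝔐) + 1) ≤ x := by
  obtain ⟨n, hn⟩ := exists_ofNum_ge (1 / x)
  refine ⟨n, ?_⟩
  rw [div_le_iff₀ hx] at hn
  rw [div_le_iff₀ (ofNum_succ_pos _)]
  nlinarith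

noncomputable instance : Coded 𝔐 (K 𝔐) := ⟨fun z => val (Q.decode z), fun x => by
  obtain ⟨r, rfl⟩ := val_surjective x
  exact ⟨r.code, by simp [Q.decode, Q.code]⟩⟩

end K

@[simp]
theorem Q.decode_code (r : Q 𝔐) : Q.decode r.code = r := by simp [Q.decode, Q.code]

noncomputable instance : Coded 𝔐 (Q 𝔐) := ⟨Q.decode, fun r => ⟨r.code, r.decode_code⟩⟩

/-! ## Closure properties of the computable maps into fractions and rational numbers -/

namespace Fn

variable {Γ Δ : Type*} [Coded 𝔐 Γ] [Coded 𝔐 Δ]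

@[fun_prop]
theorem mkQ {a b c : Γ → 𝔐.Num} (ha : Fn 𝔐 a) (hb : Fn 𝔐 b) (hc : Fn 𝔐 c) :
    Fn 𝔐 fun x => Q.mk (a x) (b x) (c x) := by
  obtain ⟨A, hA, hA'⟩ := ha
  obtain ⟨B, hB, hB'⟩ := hb
  obtain ⟨C, hC, hC'⟩ := hc
  refine ⟨_, (hA.pairing hB).pairing hC, fun z => ?_⟩
  simp [dec, Q.decode, ← hA', ← hB', ← hC']

@[fun_prop]
theorem Q_pos {r : Γ → Q 𝔐} (hr : Fn 𝔐 r) : Fn 𝔐 fun x => (r x).pos :=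
  comp (g := Q.pos) ⟨_, IsFun.fst.comp IsFun.fst, fun _ => rfl⟩ hr

@[fun_prop]
theorem Q_neg {r : Γ → Q 𝔐} (hr : Fn 𝔐 r) : Fn 𝔐 fun x => (r x).neg :=
  comp (g := Q.neg) ⟨_, IsFun.snd.comp IsFun.fst, fun _ => rfl⟩ hr

@[fun_prop]
theorem Q_den {r : Γ → Q 𝔐} (hr : Fn 𝔐 r) : Fn 𝔐 fun x => (r x).den :=
  comp (g := Q.den) ⟨_, IsFun.snd, fun _ => rfl⟩ hr

@[fun_prop]
theorem Q_code {r : Γ → Q 𝔐} (hr : Fn 𝔐 r) : Fn 𝔐 fun x => (r x).code := by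
  unfold Q.code; fun_prop

@[fun_prop]
theorem Q_decode {f : Γ → 𝔐.Num} (hf : Fn 𝔐 f) : Fn 𝔐 fun x => Q.decode (f x) :=
  comp (g := Q.decode) ⟨_, IsFun.id, fun _ => rfl⟩ hf

theorem isSeq {q : 𝔐.Num → Q 𝔐} (hq : Fn 𝔐 q) : Q.IsSeq q := hq.Q_code.isFun

theorem _root_.SOA.L2Structure.Q.IsSeq.fn {q : 𝔐.Num → Q 𝔐} (hq : Q.IsSeq q) : Fn 𝔐 q := by
  have := (IsFun.fn hq).Q_decode
  simpa using this

instance : CodedEq 𝔐 (Q 𝔐) := ⟨by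
  simp only [Q.ext_iff]; fun_prop⟩

@[fun_prop]
theorem val {r : Γ → Q 𝔐} (hr : Fn 𝔐 r) : Fn 𝔐 fun x => K.val (r x) :=
  comp (g := K.val) ⟨_, IsFun.id, fun _ => rfl⟩ hr

@[fun_prop]
theorem ofNum {f : Γ → 𝔐.Num} (hf : Fn 𝔐 f) : Fn 𝔐 fun x => K.ofNum (f x) := by
  unfold K.ofNum Q.ofNum; fun_prop

/-- A rational number has the codes of its fractions, so the same function on codes works for the
quotient. -/
theorem lift_K {f : K 𝔐 → Δ} (hf : Fn 𝔐 fun r : Q 𝔐 => f (K.val r)) : Fn 𝔐 f := by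
  obtain ⟨F, hF, hF'⟩ := hf
  exact ⟨F, hF, hF'⟩

theorem lift₂_K {f : K 𝔐 → K 𝔐 → Δ} (hf : Fn 𝔐 fun p : Q 𝔐 × Q 𝔐 => f (K.val p.1) (K.val p.2))
    {a b : Γ → K 𝔐} (ha : Fn 𝔐 a) (hb : Fn 𝔐 b) : Fn 𝔐 fun x => f (a x) (b x) := by
  obtain ⟨F, hF, hF'⟩ := hf
  exact comp (g := fun p : K 𝔐 × K 𝔐 => f p.1 p.2) ⟨F, hF, hF'⟩ (ha.prodMk hb)

/-- A sequence of rational numbers is denoted by a sequence of fractions. -/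
theorem exists_lift {a : 𝔐.Num → K 𝔐} (ha : Fn 𝔐 a) :
    ∃ q : 𝔐.Num → Q 𝔐, Fn 𝔐 q ∧ ∀ n, K.val (q n) = a n := by
  obtain ⟨F, hF, hF'⟩ := ha
  exact ⟨fun n => Q.decode (F n), hF.fn.Q_decode, hF'⟩

variable {a b : Γ → K 𝔐}

@[fun_prop]
theorem le_K (ha : Fn 𝔐 a) (hb : Fn 𝔐 b) : Fn 𝔐 fun x => a x ≤ b x := by
  refine lift₂_K (f := fun x y => x ≤ y) ?_ ha hb
  simp only [K.val_le_val, Q.le_def]; fun_prop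

@[fun_prop]
theorem lt_K (ha : Fn 𝔐 a) (hb : Fn 𝔐 b) : Fn 𝔐 fun x => a x < b x :=
  (hb.le_K ha).not.congr fun _ => not_le

instance : CodedEq 𝔐 (K 𝔐) := ⟨by
  simp only [le_antisymm_iff]; fun_prop⟩

theorem neg_Q {r : Γ → Q 𝔐} (hr : Fn 𝔐 r) : Fn 𝔐 fun x => -r x :=
  mkQ hr.Q_neg hr.Q_pos hr.Q_den

theorem add_Q {r s : Γ → Q 𝔐} (hr : Fn 𝔐 r) (hs : Fn 𝔐 s) : Fn 𝔐 fun x => r x + s x :=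
  mkQ (by fun_prop) (by fun_prop) (by fun_prop)

theorem sub_Q {r s : Γ → Q 𝔐} (hr : Fn 𝔐 r) (hs : Fn 𝔐 s) : Fn 𝔐 fun x => r x - s x :=
  hr.add_Q hs.neg_Q

theorem mul_Q {r s : Γ → Q 𝔐} (hr : Fn 𝔐 r) (hs : Fn 𝔐 s) : Fn 𝔐 fun x => r x * s x :=
  mkQ (by fun_prop) (by fun_prop) (by fun_prop)

theorem abs_Q {r : Γ → Q 𝔐} (hr : Fn 𝔐 r) : Fn 𝔐 fun x => (r x).abs := by
  classical
  unfold Q.abs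
  exact ite (hr.Q_neg.le hr.Q_pos) hr hr.neg_Q

@[fun_prop]
theorem neg_K (ha : Fn 𝔐 a) : Fn 𝔐 fun x => -a x :=
  comp (g := fun x : K 𝔐 => -x) (lift_K (val (neg_Q id))) ha

@[fun_prop]
theorem add_K (ha : Fn 𝔐 a) (hb : Fn 𝔐 b) : Fn 𝔐 fun x => a x + b x :=
  lift₂_K (f := fun x y => x + y) (val (add_Q (fst id) (snd id))) ha hb

@[fun_prop]
theorem mul_K (ha : Fn 𝔐 a) (hb : Fn 𝔐 b) : Fn 𝔐 fun x => a x * b x :=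
  lift₂_K (f := fun x y => x * y) (val (mul_Q (fst id) (snd id))) ha hb

@[fun_prop]
theorem sub_K (ha : Fn 𝔐 a) (hb : Fn 𝔐 b) : Fn 𝔐 fun x => a x - b x := by
  simp only [sub_eq_add_neg]; fun_prop

@[fun_prop]
theorem abs_K (ha : Fn 𝔐 a) : Fn 𝔐 fun x => |a x| :=
  comp (g := fun x : K 𝔐 => |x|) (lift_K (by simp only [← K.val_abs]; exact val (abs_Q id))) ha

@[fun_prop]
-- The inverse in `K` was obtained by choice. It is computed by minimisation: search for the k for
-- which the numerator is ±(k + 1), then interchange numerator and denominator.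
theorem inv_K (ha : Fn 𝔐 a) : Fn 𝔐 fun x => (a x)⁻¹ := by
  refine comp (g := fun x : K 𝔐 => x⁻¹) (lift_K ?_) ha
  have h : Fn 𝔐 fun p : Q 𝔐 × 𝔐.Num =>
      (p.1.pos = p.1.neg) ∨ (p.1.neg + (p.2 + 1) = p.1.pos) ∨ p.1.pos + (p.2 + 1) = p.1.neg := by
    fun_prop
  obtain ⟨d, hd, hd'⟩ := exists_min
    (R := fun (r : Q 𝔐) k => (r.pos = r.neg) ∨ (r.neg + (k + 1) = r.pos) ∨ r.pos + (k + 1) = r.neg)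
    h fun r => by
      rcases lt_trichotomy r.pos r.neg with h | h | h
      · exact (Num.lt_iff_exists.1 h).imp fun k hk => .inr (.inr hk)
      · exact ⟨0, .inl h⟩
      · exact (Num.lt_iff_exists.1 h).imp fun k hk => .inr (.inl hk)
  have h2 : Fn 𝔐 fun r : Q 𝔐 => if r.pos = r.neg then (0 : K 𝔐) else
      if r.neg < r.pos then K.val ⟨r.den + 1, 0, d r⟩ else K.val ⟨0, r.den + 1, d r⟩ := by
    fun_prop
  have e : (fun r : Q 𝔐 => (K.val r)⁻¹) = fun r : Q 𝔐 => if r.pos = r.neg then (0 : K 𝔐) else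
      if r.neg < r.pos then K.val ⟨r.den + 1, 0, d r⟩ else K.val ⟨0, r.den + 1, d r⟩ := ?_
  · rw [e]; exact h2
  funext r
  have hk := (hd' r).1
  generalize d r = k at hk
  have hden := (K.ofNum_succ_pos r.den).ne'
  have hkpos := (K.ofNum_succ_pos k).ne'
  simp only [K.val_eq]
  split_ifs with h3 h4
  · simp [h3]
  · rcases hk.resolve_left h3 with hk | hk
    · rw [← hk]; push_cast
      rw [show (r.neg : K 𝔐) + (k + 1) - r.neg = k + 1 by ring]
      field_simp; ring
    · exact ((Num.lt_iff_exists.2 ⟨_, hk⟩).not_gt h4).elim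
  · rcases hk.resolve_left h3 with hk | hk
    · exact (h4 (Num.lt_iff_exists.2 ⟨_, hk⟩)).elim
    · rw [← hk]; push_cast
      rw [show (r.pos : K 𝔐) - (r.pos + (k + 1)) = -(k + 1) by ring]
      field_simp; ring

@[fun_prop]
theorem div_K (ha : Fn 𝔐 a) (hb : Fn 𝔐 b) : Fn 𝔐 fun x => a x / b x := by
  simp only [div_eq_mul_inv]; fun_prop

end Fn

/-! ## Finite sums and powers -/

/-- The sum `∑_{i < n} a i` of a sequence of rational numbers of the structure. -/
noncomputable def isum (a : 𝔐.Num → K 𝔐) (n : 𝔐.Num) : K 𝔐 := irec 0 (fun i y => y + a i) n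

section isum

variable {a b : 𝔐.Num → K 𝔐} {m n : 𝔐.Num} {Γ : Type*} [Coded 𝔐 Γ]

theorem isRec_isum (ha : Fn 𝔐 a) : IsRec (0 : K 𝔐) (fun i y => y + a i) (isum a) :=
  isRec_irec (by fun_prop)

theorem isum_zero (ha : Fn 𝔐 a) : isum a 0 = 0 := (isRec_isum ha).2.1

theorem isum_succ (ha : Fn 𝔐 a) (n : 𝔐.Num) : isum a (n + 1) = isum a n + a n :=
  (isRec_isum ha).2.2 n

@[fun_prop]
theorem Fn.isum_right (ha : Fn 𝔐 a) {f : Γ → 𝔐.Num} (hf : Fn 𝔐 f) : Fn 𝔐 fun x => isum a (f x) :=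
  (isRec_isum ha).1.comp hf

theorem Fn.isum {a : Γ → 𝔐.Num → K 𝔐} (ha : Fn 𝔐 fun p : Γ × 𝔐.Num => a p.1 p.2)
    {f : Γ → 𝔐.Num} (hf : Fn 𝔐 f) : Fn 𝔐 fun x => isum (a x) (f x) :=
  Fn.irec (Fn.const 0) (Fn.add_K (by fun_prop) (ha.comp
    (f := fun p : Γ × 𝔐.Num × K 𝔐 => (p.1, p.2.1)) (by fun_prop))) hf

theorem not_lt_zero (i : 𝔐.Num) : ¬ i < 0 := Num.basic.not_lt_zero i

/-- Comparison principle for two sums of possibly nonstandard length: any decidable relation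
preserved by adding a pair of terms passes to the sums. -/
theorem isum_induction (R : K 𝔐 → K 𝔐 → Prop) (hR : Fn 𝔐 fun p : K 𝔐 × K 𝔐 => R p.1 p.2)
    (ha : Fn 𝔐 a) (hb : Fn 𝔐 b) (h0 : R 0 0)
    (h : ∀ i < n, R (isum a i) (isum b i) → R (isum a i + a i) (isum b i + b i)) :
    R (isum a n) (isum b n) := by
  have : ∀ m, m ≤ n → R (isum a m) (isum b m) := by
    refine Fn.induction (Fn.imp (by fun_prop)
      (hR.comp (f := fun m => (isum a m, isum b m)) (by fun_prop))) (fun _ => ?_) fun m ih hm => ?_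
    · rwa [isum_zero ha, isum_zero hb]
    · have hm' := (lt_add_one m).trans_le hm
      rw [isum_succ ha, isum_succ hb]
      exact h m hm' (ih hm'.le)
  exact this n le_rfl

theorem isum_congr (ha : Fn 𝔐 a) (hb : Fn 𝔐 b) (h : ∀ i < n, a i = b i) :
    isum a n = isum b n :=
  isum_induction (fun x y => x = y) (by fun_prop) ha hb rfl fun i hi ih => by rw [ih, h i hi]

theorem isum_le (ha : Fn 𝔐 a) (hb : Fn 𝔐 b) (h : ∀ i < n, a i ≤ b i) :
    isum a n ≤ isum b n :=
  isum_induction (fun x y => x ≤ y) (by fun_prop) ha hb le_rfl fun i hi ih => add_le_add ih (h i hi)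

theorem abs_isum_le (ha : Fn 𝔐 a) (n : 𝔐.Num) : |isum a n| ≤ isum (fun i => |a i|) n :=
  isum_induction (fun x y => |x| ≤ y) (by fun_prop) ha (by fun_prop) (by simp)
    fun i _ ih => (abs_add_le _ _).trans (by simpa using ih)

theorem isum_mul_const (ha : Fn 𝔐 a) (c : K 𝔐) (n : 𝔐.Num) :
    isum (fun i => a i * c) n = isum a n * c :=
  isum_induction (fun x y => x = y * c) (by fun_prop) (by fun_prop) ha (by simp)
    fun i _ ih => by rw [ih, add_mul]

theorem isum_const (c : K 𝔐) (n : 𝔐.Num) : isum (fun _ => c) n = n * c := by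
  refine Fn.induction (P := fun n => isum (fun _ => c) n = n * c) (by fun_prop) ?_ (fun n ih => ?_) n
  · rw [isum_zero (by fun_prop)]; simp
  · rw [isum_succ (by fun_prop), ih]; push_cast; ring

theorem isum_add (ha : Fn 𝔐 a) (hb : Fn 𝔐 b) (n : 𝔐.Num) :
    isum (fun i => a i + b i) n = isum a n + isum b n := by
  refine Fn.induction (P := fun n => isum (fun i => a i + b i) n = isum a n + isum b n)
    (by fun_prop) ?_ (fun n ih => ?_) n
  · rw [isum_zero (by fun_prop), isum_zero ha, isum_zero hb, add_zero]
  · rw [isum_succ (by fun_prop), isum_succ ha, isum_succ hb, ih]; ring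

theorem isum_sub (ha : Fn 𝔐 a) (hb : Fn 𝔐 b) (n : 𝔐.Num) :
    isum (fun i => a i - b i) n = isum a n - isum b n := by
  rw [eq_sub_iff_add_eq, ← isum_add (by fun_prop) hb]
  simp

theorem isum_telescope (ha : Fn 𝔐 a) (n : 𝔐.Num) :
    isum (fun i => a (i + 1) - a i) n = a n - a 0 := by
  have h1 : Fn 𝔐 fun i => a (i + 1) := ha.comp (by fun_prop)
  refine Fn.induction (P := fun n => isum (fun i => a (i + 1) - a i) n = a n - a 0)
    (by fun_prop) ?_ (fun n ih => ?_) n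
  · rw [isum_zero (by fun_prop), sub_self]
  · rw [isum_succ (by fun_prop), ih]; ring

theorem isum_append (ha : Fn 𝔐 a) (m n : 𝔐.Num) :
    isum a (m + n) = isum a m + isum (fun i => a (m + i)) n := by
  have h1 : Fn 𝔐 fun i => a (m + i) := ha.comp (by fun_prop)
  refine Fn.induction (P := fun n => isum a (m + n) = isum a m + isum (fun i => a (m + i)) n)
    (by fun_prop) ?_ (fun n ih => ?_) n
  · rw [isum_zero h1, add_zero, add_zero]
  · rw [isum_succ h1, ← add_assoc, isum_succ ha, ih]; ring

theorem isum_succ' (ha : Fn 𝔐 a) (n : 𝔐.Num) :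
    isum a (n + 1) = a 0 + isum (fun i => a (i + 1)) n := by
  rw [add_comm n 1, isum_append ha]
  rw [show (1 : 𝔐.Num) = 0 + 1 by simp, isum_succ ha, isum_zero ha]
  simp [add_comm]

theorem isum_nonneg (ha : Fn 𝔐 a) (h : ∀ i < n, 0 ≤ a i) : 0 ≤ isum a n := by
  have := isum_le (Fn.const 0) ha h
  rwa [isum_const, mul_zero] at this

theorem isum_mono_right (ha : Fn 𝔐 a) (hmn : m ≤ n) (h : ∀ i < n, 0 ≤ a i) :
    isum a m ≤ isum a n := by
  obtain ⟨k, rfl⟩ := Num.le_iff_exists.1 hmn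
  rw [isum_append ha]
  exact le_add_of_nonneg_right (isum_nonneg (ha.comp (by fun_prop)) fun i hi => h _ (by simpa))

theorem isum_block (ha : Fn 𝔐 a) (m n : 𝔐.Num) :
    isum a (m * n) = isum (fun i => isum (fun l => a (i * n + l)) n) m := by
  have h1 : Fn 𝔐 fun i => isum (fun l => a (i * n + l)) n :=
    Fn.isum (ha.comp (f := fun p : 𝔐.Num × 𝔐.Num => p.1 * n + p.2) (by fun_prop)) (by fun_prop)
  refine Fn.induction (P := fun m => isum a (m * n) = isum (fun i => isum (fun l => a (i * n + l)) n) m)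
    (by fun_prop) ?_ (fun m ih => ?_) m
  · rw [zero_mul, isum_zero ha, isum_zero h1]
  · rw [isum_succ h1, ← ih, add_mul, one_mul, isum_append ha]

end isum

/-- The power `x ^ n` with exponent in the structure. -/
noncomputable def kpow (x : K 𝔐) (n : 𝔐.Num) : K 𝔐 := irec 1 (fun _ y => y * x) n

theorem isRec_kpow (x : K 𝔐) : IsRec (1 : K 𝔐) (fun _ y => y * x) (kpow x) :=
  isRec_irec (by fun_prop)

@[simp]
theorem kpow_zero (x : K 𝔐) : kpow x 0 = 1 := (isRec_kpow x).2.1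

theorem kpow_succ (x : K 𝔐) (n : 𝔐.Num) : kpow x (n + 1) = kpow x n * x := (isRec_kpow x).2.2 n

@[fun_prop]
theorem Fn.kpow {Γ : Type*} [Coded 𝔐 Γ] {x : Γ → K 𝔐} {n : Γ → 𝔐.Num} (hx : Fn 𝔐 x)
    (hn : Fn 𝔐 n) : Fn 𝔐 fun p => kpow (x p) (n p) :=
  Fn.irec (Fn.const 1) (by fun_prop) hn

/-- The rational number `2 ^ (-k)`. -/
noncomputable def hp (k : 𝔐.Num) : K 𝔐 := kpow (1 / 2) k

@[fun_prop]
theorem Fn.hp {Γ : Type*} [Coded 𝔐 Γ] {n : Γ → 𝔐.Num} (hn : Fn 𝔐 n) : Fn 𝔐 fun p => hp (n p) := by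
  unfold L2Structure.hp; fun_prop

@[simp]
theorem hp_zero : hp (0 : 𝔐.Num) = 1 := kpow_zero _

theorem hp_succ (k : 𝔐.Num) : hp (k + 1) = hp k / 2 := by
  rw [hp, kpow_succ, hp]; ring

theorem hp_pos (k : 𝔐.Num) : 0 < hp k := by
  refine Fn.induction (P := fun k => 0 < hp k) (by fun_prop) (by simp) (fun k ih => ?_) k
  rw [hp_succ]; linarith

theorem hp_le_inv (k : 𝔐.Num) : hp k ≤ 1 / ((k : K 𝔐) + 1) := by
  refine Fn.induction (P := fun k => hp k ≤ 1 / ((k : K 𝔐) + 1)) (by fun_prop) (by simp) (fun k ih => ?_) k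
  have := K.ofNum_nonneg k
  rw [hp_succ]
  push_cast
  rw [le_div_iff₀ (by linarith)] at ih ⊢
  nlinarith [hp_pos k]

theorem hp_anti {k l : 𝔐.Num} (h : k ≤ l) : hp l ≤ hp k := by
  obtain ⟨d, rfl⟩ := Num.le_iff_exists.1 h
  refine Fn.induction (P := fun d => hp (k + d) ≤ hp k) (by fun_prop) (by simp) (fun d ih => ?_) d
  rw [← add_assoc, hp_succ]
  linarith [hp_pos (k + d)]

theorem exists_hp_le {x : K 𝔐} (hx : 0 < x) : ∃ k : 𝔐.Num, ∀ l, k ≤ l → hp l ≤ x := by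
  obtain ⟨k, hk⟩ := K.exists_inv_succ_le hx
  exact ⟨k, fun l hl => (hp_anti hl).trans ((hp_le_inv k).trans hk)⟩

/-! ## Recursions on fractions -/

/-- `Q.recur` uses an arbitrarily chosen computation of length n. Any such computation agrees with
the total recursion up to n. -/
theorem Q.recur_eq_irec {a : Q 𝔐} {G : 𝔐.Num → Q 𝔐 → Q 𝔐}
    (hG : Fn 𝔐 fun p : 𝔐.Num × Q 𝔐 => G p.1 p.2) (n : 𝔐.Num) : Q.recur a G n = irec a G n := by
  obtain ⟨h1, h2, h3⟩ := isRec_irec (a := a) hG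
  have hex : ∃ s, Q.IsRecursion a G n s := ⟨_, h1.isSeq, h2, fun i _ => h3 i⟩
  unfold Q.recur
  rw [dif_pos hex]
  obtain ⟨h4, h5, h6⟩ := hex.choose_spec
  have h4' := h4.fn
  have : ∀ i, i ≤ n → hex.choose i = irec a G i := by
    refine Fn.induction (Fn.imp (by fun_prop) (by fun_prop)) (fun _ => h5.trans h2.symm)
      fun i ih hi => ?_
    have hi' := (lt_add_one i).trans_le hi
    rw [h6 i hi', h3, ih hi'.le]
  exact this n le_rfl

theorem val_irec {a : Q 𝔐} {G : 𝔐.Num → Q 𝔐 → Q 𝔐} {a' : K 𝔐} {G' : 𝔐.Num → K 𝔐 → K 𝔐}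
    (hG : Fn 𝔐 fun p : 𝔐.Num × Q 𝔐 => G p.1 p.2) (ha : K.val a = a')
    (h : ∀ i r, K.val (G i r) = G' i (K.val r)) (n : 𝔐.Num) :
    K.val (irec a G n) = irec a' G' n := by
  obtain ⟨h1, h2, h3⟩ := isRec_irec (a := a) hG
  exact congrFun (IsRec.eq_irec (s := fun n => K.val (irec a G n))
    ⟨h1.val, by beta_reduce; rw [h2, ha], fun n => by beta_reduce; rw [h3, h]⟩) n

theorem Q.val_sum {f : 𝔐.Num → Q 𝔐} (hf : Fn 𝔐 f) (n : 𝔐.Num) :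
    K.val (Q.sum f n) = isum (fun i => K.val (f i)) n := by
  have : Fn 𝔐 fun p : 𝔐.Num × Q 𝔐 => p.2 + f p.1 := Fn.add_Q (by fun_prop) (by fun_prop)
  rw [Q.sum, Q.recur_eq_irec this]
  exact val_irec (G := fun i y => y + f i) (G' := fun i y => y + K.val (f i)) this rfl
    (fun i r => K.val_add _ _) n

theorem Fn.Q_sum {Γ : Type*} [Coded 𝔐 Γ] {f : Γ → 𝔐.Num → Q 𝔐}
    (hf : Fn 𝔐 fun p : Γ × 𝔐.Num => f p.1 p.2) {n : Γ → 𝔐.Num} (hn : Fn 𝔐 n) :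
    Fn 𝔐 fun x => Q.sum (f x) (n x) := by
  have h : ∀ x, Q.sum (f x) (n x) = L2Structure.irec 0 (fun i y => y + f x i) (n x) := fun x =>
    Q.recur_eq_irec (Fn.add_Q (by fun_prop)
      (hf.comp (f := fun p : 𝔐.Num × Q 𝔐 => (x, p.1)) (by fun_prop))) _
  simp only [h]
  exact Fn.irec (Fn.const 0) (Fn.add_Q (by fun_prop)
      (hf.comp (f := fun p : Γ × 𝔐.Num × Q 𝔐 => (p.1, p.2.1)) (by fun_prop))) hn

theorem Q.pow_eq_irec (x : Q 𝔐) (n : 𝔐.Num) : Q.pow x n = irec 1 (fun _ y => y * x) n :=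
  Q.recur_eq_irec (Fn.mul_Q (by fun_prop) (by fun_prop)) n

theorem Q.val_pow (x : Q 𝔐) (n : 𝔐.Num) : K.val (Q.pow x n) = kpow (K.val x) n := by
  rw [Q.pow_eq_irec]
  exact val_irec (G := fun _ y => y * x) (G' := fun _ y => y * K.val x)
    (Fn.mul_Q (by fun_prop) (by fun_prop)) rfl (fun _ _ => K.val_mul _ _) n

theorem Fn.Q_pow {Γ : Type*} [Coded 𝔐 Γ] {r : Γ → Q 𝔐} (hr : Fn 𝔐 r) {n : Γ → 𝔐.Num}
    (hn : Fn 𝔐 n) : Fn 𝔐 fun x => Q.pow (r x) (n x) := by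
  simp only [Q.pow_eq_irec]
  exact Fn.irec (Fn.const 1) (Fn.mul_Q (by fun_prop) (by fun_prop)) hn

theorem Q.val_half : K.val (Q.half : Q 𝔐) = 1 / 2 := by
  rw [K.val_eq]
  simp only [Q.half, K.ofNum_one, K.ofNum_zero]
  norm_num

@[simp]
theorem Q.val_half_pow (k : 𝔐.Num) : K.val (Q.pow Q.half k) = hp k := by
  rw [Q.val_pow, Q.val_half, hp]

/-! ## Polynomials -/

@[fun_prop]
theorem Fn.polyLen {Γ : Type*} [Coded 𝔐 Γ] {p : Γ → 𝔐.Num} (hp : Fn 𝔐 p) :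
    Fn 𝔐 fun x => polyLen (p x) := by
  unfold L2Structure.polyLen; fun_prop

@[fun_prop]
theorem Fn.polyCoeff {Γ : Type*} [Coded 𝔐 Γ] {p i : Γ → 𝔐.Num} (hp : Fn 𝔐 p) (hi : Fn 𝔐 i) :
    Fn 𝔐 fun x => polyCoeff (p x) (i x) := by
  classical
  unfold L2Structure.polyCoeff; fun_prop

theorem Fn.polyEval {Γ : Type*} [Coded 𝔐 Γ] {p : Γ → 𝔐.Num} {t : Γ → Q 𝔐} (hp : Fn 𝔐 p)
    (ht : Fn 𝔐 t) : Fn 𝔐 fun x => polyEval (p x) (t x) :=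
  Fn.Q_sum (Fn.mul_Q (by fun_prop) (Fn.Q_pow (by fun_prop) (by fun_prop))) (by fun_prop)

theorem Fn.polyDerivEval {Γ : Type*} [Coded 𝔐 Γ] {p : Γ → 𝔐.Num} {t : Γ → Q 𝔐} (hp : Fn 𝔐 p)
    (ht : Fn 𝔐 t) : Fn 𝔐 fun x => polyDerivEval (p x) (t x) :=
  Fn.Q_sum (Fn.mul_Q (Fn.mul_Q (by unfold Q.ofNum; fun_prop) (by fun_prop))
    (Fn.Q_pow (by fun_prop) (by fun_prop))) (by fun_prop)

/-- The value of a polynomial, as a map on rational numbers. -/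
noncomputable def peval (p : 𝔐.Num) (x : K 𝔐) : K 𝔐 :=
  isum (fun i => K.val (polyCoeff p i) * kpow x i) (polyLen p)

/-- The value of the derivative of a polynomial. -/
noncomputable def dpeval (p : 𝔐.Num) (x : K 𝔐) : K 𝔐 :=
  isum (fun i => (i + 1) * K.val (polyCoeff p (i + 1)) * kpow x i) (polyLen p)

theorem val_polyEval (p : 𝔐.Num) (t : Q 𝔐) : K.val (polyEval p t) = peval p (K.val t) := by
  unfold polyEval peval
  rw [Q.val_sum (Fn.mul_Q (by fun_prop) (Fn.Q_pow (by fun_prop) (by fun_prop)))]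
  simp only [K.val_mul, Q.val_pow]

theorem val_polyDerivEval (p : 𝔐.Num) (t : Q 𝔐) :
    K.val (polyDerivEval p t) = dpeval p (K.val t) := by
  unfold polyDerivEval dpeval
  rw [Q.val_sum (Fn.mul_Q (Fn.mul_Q (by unfold Q.ofNum; fun_prop) (by fun_prop))
    (Fn.Q_pow (by fun_prop) (by fun_prop)))]
  simp only [K.val_mul, Q.val_pow]
  have : ∀ i : 𝔐.Num, K.val (Q.ofNum (i + 1)) = (i : K 𝔐) + 1 := fun i => by
    rw [← K.ofNum_one, ← K.ofNum_add]; rfl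
  simp only [this]

@[fun_prop]
theorem Fn.peval {Γ : Type*} [Coded 𝔐 Γ] {p : Γ → 𝔐.Num} {t : Γ → K 𝔐} (hp : Fn 𝔐 p)
    (ht : Fn 𝔐 t) : Fn 𝔐 fun x => peval (p x) (t x) :=
  Fn.isum (by fun_prop) (by fun_prop)

@[fun_prop]
theorem Fn.dpeval {Γ : Type*} [Coded 𝔐 Γ] {p : Γ → 𝔐.Num} {t : Γ → K 𝔐} (hp : Fn 𝔐 p)
    (ht : Fn 𝔐 t) : Fn 𝔐 fun x => dpeval (p x) (t x) :=
  Fn.isum (by fun_prop) (by fun_prop)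

/-! ### Lipschitz and Taylor estimates for polynomials on [0, 1] -/

section Estimates

variable {x y : K 𝔐}

theorem kpow_mem (hx : 0 ≤ x) (hx1 : x ≤ 1) (n : 𝔐.Num) : 0 ≤ kpow x n ∧ kpow x n ≤ 1 := by
  refine Fn.induction (P := fun n => 0 ≤ kpow x n ∧ kpow x n ≤ 1) (by fun_prop) (by simp)
    (fun n ih => ?_) n
  rw [kpow_succ]
  exact ⟨mul_nonneg ih.1 hx, mul_le_one₀ ih.2 hx hx1⟩

theorem abs_kpow_sub_le (hx : 0 ≤ x) (hx1 : x ≤ 1) (hy : 0 ≤ y) (hy1 : y ≤ 1) (n : 𝔐.Num) :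
    |kpow y n - kpow x n| ≤ n * |y - x| := by
  refine Fn.induction (P := fun n => |kpow y n - kpow x n| ≤ n * |y - x|) (by fun_prop) (by simp)
    (fun n ih => ?_) n
  obtain ⟨h1, h2⟩ := kpow_mem hy hy1 n
  rw [kpow_succ, kpow_succ, show kpow y n * y - kpow x n * x =
    kpow y n * (y - x) + (kpow y n - kpow x n) * x by ring]
  refine (abs_add_le _ _).trans ?_
  rw [abs_mul, abs_mul, abs_of_nonneg h1, abs_of_nonneg hx]
  push_cast
  nlinarith [abs_nonneg (y - x), abs_nonneg (kpow y n - kpow x n)]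

/-- The next remainder is x times the current one plus (y - x)(y^(n+1) - x^(n+1)), and the second
term is quadratic in y - x by the Lipschitz bound. This replaces the mean value theorem. -/
theorem abs_kpow_taylor_le (hx : 0 ≤ x) (hx1 : x ≤ 1) (hy : 0 ≤ y) (hy1 : y ≤ 1) (n : 𝔐.Num) :
    |kpow y (n + 1) - kpow x (n + 1) - (n + 1) * kpow x n * (y - x)| ≤
      (n + 1) * (n + 1) * (y - x) ^ 2 := by
  refine Fn.induction (P := fun n => |kpow y (n + 1) - kpow x (n + 1) - (n + 1) * kpow x n * (y - x)| ≤
      (n + 1) * (n + 1) * (y - x) ^ 2) (by simp only [sq]; fun_prop) ?_ (fun n ih => ?_) n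
  · simp only [kpow_succ, kpow_zero, K.ofNum_zero]
    rw [show 1 * y - 1 * x - (0 + 1) * 1 * (y - x) = 0 by ring, abs_zero]
    nlinarith [sq_nonneg (y - x)]
  · have h1 := abs_kpow_sub_le hx hx1 hy hy1 (n + 1)
    rw [kpow_succ y (n + 1), kpow_succ x (n + 1)]
    have e : kpow y (n + 1) * y - kpow x (n + 1) * x -
        (((n + 1 : 𝔐.Num) : K 𝔐) + 1) * kpow x (n + 1) * (y - x) =
        x * (kpow y (n + 1) - kpow x (n + 1) - (n + 1) * kpow x n * (y - x)) +
          (y - x) * (kpow y (n + 1) - kpow x (n + 1)) := by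
      rw [kpow_succ x n]; push_cast; ring
    rw [e]
    refine (abs_add_le _ _).trans ?_
    rw [abs_mul, abs_mul, abs_of_nonneg hx]
    push_cast at h1 ⊢
    have h2 : |y - x| * |kpow y (n + 1) - kpow x (n + 1)| ≤ (n + 1) * (y - x) ^ 2 := by
      rw [← sq_abs (y - x)]
      nlinarith [abs_nonneg (y - x)]
    have h3 := mul_le_mul_of_nonneg_right hx1 (abs_nonneg
      (kpow y (n + 1) - kpow x (n + 1) - (n + 1) * kpow x n * (y - x)))
    have h4 := K.ofNum_nonneg n
    nlinarith [sq_nonneg (y - x), mul_nonneg h4 (sq_nonneg (y - x))]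

theorem polyCoeff_polyLen (p : 𝔐.Num) : polyCoeff p (polyLen p) = 0 := if_neg (lt_irrefl _)

theorem exists_peval_lipschitz (p : 𝔐.Num) : ∃ L : K 𝔐, 0 ≤ L ∧ ∀ x y, 0 ≤ x → x ≤ 1 → 0 ≤ y →
    y ≤ 1 → |peval p y - peval p x| ≤ L * |y - x| := by
  refine ⟨isum (fun i => |K.val (polyCoeff p i)| * i) (polyLen p),
    isum_nonneg (by fun_prop) fun i _ => mul_nonneg (abs_nonneg _) (K.ofNum_nonneg _),
    fun x y hx hx1 hy hy1 => ?_⟩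
  unfold peval
  rw [← isum_sub (by fun_prop) (by fun_prop), ← isum_mul_const (by fun_prop)]
  refine (abs_isum_le (by fun_prop) _).trans (isum_le (by fun_prop) (by fun_prop) fun i _ => ?_)
  rw [← mul_sub, abs_mul, mul_assoc]
  exact mul_le_mul_of_nonneg_left (abs_kpow_sub_le hx hx1 hy hy1 i) (abs_nonneg _)

/-- The coefficient at index `polyLen p` vanishes, so shifting the index keeps the length of the sum
and matches it with `dpeval`. -/
theorem peval_eq_add (p : 𝔐.Num) (x : K 𝔐) : peval p x = K.val (polyCoeff p 0) +
    isum (fun i => K.val (polyCoeff p (i + 1)) * kpow x (i + 1)) (polyLen p) := by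
  have h := isum_succ (a := fun i => K.val (polyCoeff p i) * kpow x i) (by fun_prop) (polyLen p)
  rw [isum_succ' (by fun_prop), polyCoeff_polyLen, K.val_zero, zero_mul, add_zero, kpow_zero,
    mul_one] at h
  exact h.symm

theorem exists_peval_taylor (p : 𝔐.Num) : ∃ C : K 𝔐, 0 ≤ C ∧ ∀ x y, 0 ≤ x → x ≤ 1 → 0 ≤ y →
    y ≤ 1 → |peval p y - peval p x - dpeval p x * (y - x)| ≤ C * (y - x) ^ 2 := by
  refine ⟨isum (fun i => |K.val (polyCoeff p (i + 1))| * ((i + 1) * (i + 1))) (polyLen p),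
    isum_nonneg (by fun_prop) fun i _ => mul_nonneg (abs_nonneg _)
      (mul_self_nonneg _), fun x y hx hx1 hy hy1 => ?_⟩
  rw [peval_eq_add, peval_eq_add, add_sub_add_left_eq_sub]
  unfold dpeval
  rw [← isum_sub (by fun_prop) (by fun_prop), ← isum_mul_const (by fun_prop),
    ← isum_sub (by fun_prop) (by fun_prop), ← isum_mul_const (by fun_prop)]
  refine (abs_isum_le (by fun_prop) _).trans (isum_le (by fun_prop) (by fun_prop) fun i _ => ?_)
  rw [show K.val (polyCoeff p (i + 1)) * kpow y (i + 1) - K.val (polyCoeff p (i + 1)) * kpow x (i + 1)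
    - (i + 1) * K.val (polyCoeff p (i + 1)) * kpow x i * (y - x) = K.val (polyCoeff p (i + 1)) *
      (kpow y (i + 1) - kpow x (i + 1) - (i + 1) * kpow x i * (y - x)) by ring, abs_mul, mul_assoc (|K.val (polyCoeff p (i + 1))|)]
  exact mul_le_mul_of_nonneg_left (abs_kpow_taylor_le hx hx1 hy hy1 i) (abs_nonneg _)

end Estimates

/-! ## Riemann sums -/

/-- The average of `H` over the points `j / N`, `j < N`. -/
noncomputable def avg (H : K 𝔐 → K 𝔐) (N : 𝔐.Num) : K 𝔐 := isum (fun j => H (j / N)) N / N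

/-- The variation of `q` along the points `j / N`, `j ≤ N`. -/
noncomputable def vari (q : K 𝔐 → K 𝔐) (N : 𝔐.Num) : K 𝔐 :=
  isum (fun j => |q ((j + 1) / N) - q (j / N)|) N

/-- The integral of `H` over `[0, 1]` is at most `r`. -/
def IntLE (H : K 𝔐 → K 𝔐) (r : K 𝔐) : Prop :=
  ∀ ε : K 𝔐, 0 < ε → ∃ N : 𝔐.Num, ∀ n, N ≤ n → avg H (n + 1) ≤ r + ε

/-- The operation `F` on fractions computes the map `H` on rational numbers. -/
structure Lifts (F : Q 𝔐 → Q 𝔐) (H : K 𝔐 → K 𝔐) : Prop where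
  fn : Fn 𝔐 F
  val_eq : ∀ t, K.val (F t) = H (K.val t)

theorem Lifts.fn_K {F : Q 𝔐 → Q 𝔐} {H : K 𝔐 → K 𝔐} (h : Lifts F H) : Fn 𝔐 H :=
  Fn.lift_K (by simpa only [← h.val_eq] using h.fn.val)

theorem Lifts.val_riemannSum {F : Q 𝔐 → Q 𝔐} {H : K 𝔐 → K 𝔐} (h : Lifts F H) (n : 𝔐.Num) :
    K.val (riemannSum F n) = avg H (n + 1) := by
  have h1 := h.fn
  have h2 := h.fn_K
  unfold riemannSum avg
  rw [Q.val_sum (Fn.mul_Q (h1.comp (by fun_prop)) (by fun_prop))]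
  simp only [K.val_mul, h.val_eq]
  simp only [K.val_eq]
  rw [isum_mul_const (by fun_prop)]
  simp only [K.ofNum_zero, K.ofNum_one, K.ofNum_add, sub_zero]
  ring

theorem lifts_polyDeriv (p : 𝔐.Num) :
    Lifts (fun t => (polyDerivEval p t).abs) fun x => |dpeval p x| :=
  ⟨Fn.abs_Q (Fn.polyDerivEval (by fun_prop) (by fun_prop)),
    fun t => by rw [K.val_abs, val_polyDerivEval]⟩

theorem lifts_polyEval (p : 𝔐.Num) : Lifts (fun t => (polyEval p t).abs) fun x => |peval p x| :=
  ⟨Fn.abs_Q (Fn.polyEval (by fun_prop) (by fun_prop)), fun t => by rw [K.val_abs, val_polyEval]⟩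

theorem lifts_polyEval_sub (p q : 𝔐.Num) :
    Lifts (fun t => (polyEval p t - polyEval q t).abs) fun x => |peval p x - peval q x| :=
  ⟨Fn.abs_Q (Fn.sub_Q (Fn.polyEval (by fun_prop) (by fun_prop))
    (Fn.polyEval (by fun_prop) (by fun_prop))),
    fun t => by rw [K.val_abs, K.val_sub, val_polyEval, val_polyEval]⟩

theorem RealLE.val {x : 𝔐.Num → Q 𝔐} {r : Q 𝔐} (h : RealLE x r) (k : 𝔐.Num) :
    K.val (x k) ≤ K.val r + hp k := by
  have : K.val (x k) ≤ K.val (r + Q.pow Q.half k) := h k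
  rwa [K.val_add, Q.val_half_pow] at this

theorem RealDistLE.val {x y : 𝔐.Num → Q 𝔐} {r : Q 𝔐} (h : RealDistLE x y r) (k : 𝔐.Num) :
    |K.val (x k) - K.val (y k)| ≤ K.val r + (hp k + hp k) := by
  have : K.val (x k - y k).abs ≤ K.val (r + (Q.pow Q.half k + Q.pow Q.half k)) := h k
  rwa [K.val_add, K.val_add, Q.val_half_pow, K.val_abs, K.val_sub] at this

theorem exists_val_eq {ε : K 𝔐} (h : 0 < ε) : ∃ r : Q 𝔐, 0 < r ∧ K.val r = ε := by
  obtain ⟨r, rfl⟩ := K.val_surjective ε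
  exact ⟨r, K.val_lt_val.1 h, rfl⟩

theorem IsIntegral.val {F : Q 𝔐 → Q 𝔐} {H : K 𝔐 → K 𝔐} {x : 𝔐.Num → Q 𝔐} (h : Lifts F H)
    (hx : IsIntegral F x) {ε : K 𝔐} (hε : 0 < ε) :
    ∃ N : 𝔐.Num, ∀ n, N ≤ n → |avg H (n + 1) - K.val (x n)| ≤ ε := by
  obtain ⟨r, hr, rfl⟩ := exists_val_eq hε
  obtain ⟨N, hN⟩ := hx.2 r hr
  refine ⟨N, fun n hn => ?_⟩
  have : K.val _ ≤ K.val r := hN n hn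
  rwa [K.val_abs, K.val_sub, h.val_riemannSum] at this

theorem IntegralLE.intLE {F : Q 𝔐 → Q 𝔐} {H : K 𝔐 → K 𝔐} {r : Q 𝔐} (h : Lifts F H)
    (hr : IntegralLE F r) : IntLE H (K.val r) := by
  obtain ⟨x, hx, hxr⟩ := hr
  intro ε hε
  obtain ⟨N, hN⟩ := hx.val h (half_pos hε)
  obtain ⟨k, hk⟩ := exists_hp_le (half_pos hε)
  refine ⟨max N k, fun n hn => ?_⟩
  have h1 := le_of_abs_le (hN n (le_of_max_le_left hn))
  have h2 := hk n (le_of_max_le_right hn)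
  have h3 := hxr.val n
  linarith

theorem IsLimNorm.intLE {F : 𝔐.Num → Q 𝔐 → Q 𝔐} {H : 𝔐.Num → K 𝔐 → K 𝔐} {x : 𝔐.Num → Q 𝔐}
    {r : Q 𝔐} (h : ∀ k, Lifts (fun t => (F k t).abs) (H k)) (hx : IsLimNorm F x) (hr : RealLE x r)
    {ε : K 𝔐} (hε : 0 < ε) : ∃ k₀ : 𝔐.Num, ∀ k, k₀ ≤ k → IntLE (H k) (K.val r + ε) := by
  obtain ⟨s, hs, rfl⟩ := exists_val_eq hε
  obtain ⟨k₀, hk₀⟩ := hx.2 s hs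
  refine ⟨k₀, fun k hk ε hε => ?_⟩
  obtain ⟨y, hy, hyx⟩ := hk₀ k hk
  obtain ⟨N, hN⟩ := hy.val (h k) (half_pos hε)
  obtain ⟨l, hl⟩ := exists_hp_le (by linarith : 0 < ε / 6)
  refine ⟨max N l, fun n hn => ?_⟩
  have h1 := le_of_abs_le (hN n (le_of_max_le_left hn))
  have h2 := hl n (le_of_max_le_right hn)
  have h3 := le_of_abs_le (hyx.val n)
  have h4 := hr.val n
  linarith

/-! ### Comparison of averages over different grids -/

section avg

variable {H H₁ H₂ : K 𝔐 → K 𝔐} {M N : 𝔐.Num} {r s : K 𝔐}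

theorem K.ofNum_pos {n : 𝔐.Num} : (0 : K 𝔐) < n ↔ 0 < n := by
  rw [← K.ofNum_zero, K.ofNum_lt]

theorem div_mem {i N : 𝔐.Num} (h : i ≤ N) : (0 : K 𝔐) ≤ i / N ∧ (i : K 𝔐) / N ≤ 1 :=
  ⟨div_nonneg (K.ofNum_nonneg i) (K.ofNum_nonneg N),
    div_le_one_of_le₀ (K.ofNum_le.2 h) (K.ofNum_nonneg N)⟩

theorem avg_mono (h₁ : Fn 𝔐 H₁) (h₂ : Fn 𝔐 H₂) (h : ∀ i < N, H₁ (i / N) ≤ H₂ (i / N)) :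
    avg H₁ N ≤ avg H₂ N :=
  div_le_div_of_nonneg_right (isum_le (by fun_prop) (by fun_prop) h) (K.ofNum_nonneg N)

theorem avg_add (h₁ : Fn 𝔐 H₁) (h₂ : Fn 𝔐 H₂) :
    avg (fun x => H₁ x + H₂ x) N = avg H₁ N + avg H₂ N := by
  unfold avg
  rw [isum_add (by fun_prop) (by fun_prop), add_div]

theorem avg_neg (h : Fn 𝔐 H) : avg (fun x => -H x) N = -avg H N := by
  unfold avg
  have := isum_sub (a := fun _ => 0) (b := fun j : 𝔐.Num => H (j / N)) (by fun_prop) (by fun_prop) N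
  simp only [zero_sub, isum_const, mul_zero] at this
  rw [this, neg_div]

theorem avg_const (hN : 0 < N) (c : K 𝔐) : avg (fun _ => c) N = c := by
  unfold avg
  rw [isum_const, mul_div_cancel_left₀ _ (K.ofNum_pos.2 hN).ne']

theorem IntLE.add (h₁ : Fn 𝔐 H₁) (h₂ : Fn 𝔐 H₂) (hH : Fn 𝔐 H) (hr : IntLE H₁ r) (hs : IntLE H₂ s)
    (h : ∀ x, H x ≤ H₁ x + H₂ x) : IntLE H (r + s) := by
  intro ε hε
  obtain ⟨N, hN⟩ := hr _ (half_pos hε)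
  obtain ⟨N', hN'⟩ := hs _ (half_pos hε)
  refine ⟨max N N', fun n hn => ?_⟩
  have := hN n (le_of_max_le_left hn)
  have := hN' n (le_of_max_le_right hn)
  have : avg H (n + 1) ≤ _ := avg_mono hH (h₁.add_K h₂) fun i _ => h _
  rw [avg_add h₁ h₂] at this
  linarith

theorem IntLE.mono (hr : IntLE H r) (h : r ≤ s) : IntLE H s := fun ε hε =>
  (hr ε hε).imp fun _ hN n hn => (hN n hn).trans (by linarith)

theorem avg_block_le (hH : Fn 𝔐 H) {e : 𝔐.Num → K 𝔐} (he : Fn 𝔐 e) (hM : 0 < M) (hN : 0 < N)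
    (h : ∀ i < M, ∀ l < N, H (((i * N + l : 𝔐.Num) : K 𝔐) / (M * N : 𝔐.Num)) ≤ e i) :
    avg H (M * N) ≤ isum e M / M := by
  have hM' := K.ofNum_pos.2 hM
  have hN' := K.ofNum_pos.2 hN
  unfold avg
  have key : isum (fun j => H (j / (M * N : 𝔐.Num))) (M * N) ≤ isum e M * N := by
    rw [isum_block (by fun_prop), ← isum_mul_const he]
    refine isum_le (Fn.isum (by fun_prop) (by fun_prop)) (by fun_prop) fun i hi => ?_
    exact (isum_le (by fun_prop) (Fn.const (e i)) fun l hl => h i hi l hl).trans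
      ((isum_const _ _).trans (mul_comm _ _)).le
  rw [div_le_div_iff₀ (K.ofNum_pos.2 (mul_pos hM hN)) hM']
  exact (mul_le_mul_of_nonneg_right key hM'.le).trans_eq (by rw [K.ofNum_mul]; ring)

/-- `H` is Lipschitz on `[0, 1]`. -/
def Lip (H : K 𝔐 → K 𝔐) (L : K 𝔐) : Prop :=
  ∀ x y, 0 ≤ x → x ≤ 1 → 0 ≤ y → y ≤ 1 → |H y - H x| ≤ L * |y - x|

theorem block_point (hN : 0 < N) (i l : 𝔐.Num) :
    ((i * N + l : 𝔐.Num) : K 𝔐) / (M * N : 𝔐.Num) = i / M + l / (M * N) := by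
  have hN' := (K.ofNum_pos.2 hN).ne'
  push_cast
  rw [add_div, mul_div_mul_right _ _ hN']

theorem block_index_le {i l : 𝔐.Num} (hi : i < M) (hl : l ≤ N) : i * N + l ≤ M * N := by
  obtain ⟨k, rfl⟩ := Num.lt_iff_exists.1 hi
  refine (add_le_add_right hl (i * N)).trans (Num.le_iff_exists.2 ⟨k * N, by ring⟩)

theorem avg_mul_le {L : K 𝔐} (hH : Fn 𝔐 H) (h : Lip H L) (hL : 0 ≤ L) (hM : 0 < M) (hN : 0 < N) :
    avg H (M * N) ≤ avg H M + L / M := by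
  have hM' := K.ofNum_pos.2 hM
  have hN' := K.ofNum_pos.2 hN
  refine (avg_block_le (e := fun i => H (i / M) + L / M) hH (by fun_prop) hM hN
    fun i hi l hl => ?_).trans_eq ?_
  · have h1 := div_mem (block_index_le hi hl.le)
    have h2 := div_mem hi.le
    have h3 := le_of_abs_le (h _ _ h2.1 h2.2 h1.1 h1.2)
    rw [block_point hN] at h3 ⊢
    have h4 : (l : K 𝔐) / (M * N) ≤ 1 / M := by
      rw [div_le_div_iff₀ (mul_pos hM' hN') hM']
      have := K.ofNum_le.2 hl.le
      nlinarith
    have h5 : (0 : K 𝔐) ≤ l / (M * N) := div_nonneg (K.ofNum_nonneg l) (mul_pos hM' hN').le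
    rw [add_sub_cancel_left, abs_of_nonneg h5] at h3
    have h6 := mul_le_mul_of_nonneg_left h4 hL
    rw [mul_one_div] at h6
    linarith
  · unfold avg
    rw [isum_add (by fun_prop) (by fun_prop), isum_const, add_div, mul_div_cancel_left₀ _ hM'.ne']

theorem le_avg_mul {L : K 𝔐} (hH : Fn 𝔐 H) (h : Lip H L) (hL : 0 ≤ L) (hM : 0 < M) (hN : 0 < N) :
    avg H M ≤ avg H (M * N) + L / M := by
  have := avg_mul_le (H := fun x => -H x) (by fun_prop) (fun x y h1 h2 h3 h4 => by
    rw [neg_sub_neg, abs_sub_comm]; exact h x y h1 h2 h3 h4) hL hM hN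
  rw [avg_neg hH, avg_neg hH] at this
  linarith

/-- Both grids are compared with their common refinement into M * N intervals; a refined point lies
within one mesh width of the left end of its block. -/
theorem avg_le_avg {L : K 𝔐} (hH : Fn 𝔐 H) (h : Lip H L) (hL : 0 ≤ L) (hM : 0 < M) (hN : 0 < N) :
    avg H M ≤ avg H N + (L / M + L / N) := by
  have h1 := le_avg_mul hH h hL hM hN
  have h2 := avg_mul_le hH h hL hN hM
  rw [mul_comm] at h2
  linarith

theorem exists_div_succ_le (L : K 𝔐) {ε : K 𝔐} (hε : 0 < ε) :
    ∃ n : 𝔐.Num, ∀ m, n ≤ m → L / (m + 1) ≤ ε := by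
  obtain ⟨n, hn⟩ := K.exists_ofNum_ge (L / ε)
  refine ⟨n, fun m hm => ?_⟩
  rw [div_le_iff₀ hε] at hn
  rw [div_le_iff₀ (K.ofNum_succ_pos m)]
  have := K.ofNum_le.2 hm
  nlinarith

/-- For a Lipschitz function good averages on arbitrarily fine grids suffice. `polyDistLE_of_grid`
needs this, as it controls only grids refining a given one. -/
theorem intLE_of_frequently {L : K 𝔐} (hH : Fn 𝔐 H) (h : Lip H L) (hL : 0 ≤ L)
    (hr : ∀ ε, 0 < ε → ∀ n : 𝔐.Num, ∃ N, n < N ∧ avg H N ≤ r + ε) : IntLE H r := by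
  intro ε hε
  have hε' : 0 < ε / 3 := by linarith
  obtain ⟨n, hn⟩ := exists_div_succ_le L hε'
  obtain ⟨N, hnN, hN⟩ := hr _ hε' n
  refine ⟨n, fun m hm => ?_⟩
  have h1 := avg_le_avg hH h hL (Num.succ_pos m) ((Num.zero_le' n).trans_lt hnN)
  have h2 := hn m hm
  obtain ⟨k, rfl⟩ := Num.lt_iff_exists.1 hnN
  have h3 := hn (n + k) le_self_add
  rw [← add_assoc n k 1] at h1 hN
  push_cast at h1 h2 h3
  linarith

end avg

/-! ## Variation of polynomials -/

section vari

variable {q : K 𝔐 → K 𝔐} {M N : 𝔐.Num}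

theorem vari_eq_isum_block (hq : Fn 𝔐 q) : vari q (M * N) = isum (fun i => isum (fun l =>
    |q (((i * N + l : 𝔐.Num) + 1) / (M * N : 𝔐.Num)) - q ((i * N + l : 𝔐.Num) / (M * N : 𝔐.Num))|)
      N) M :=
  isum_block (by fun_prop) M N

/-- Telescoping within the i-th block of the refined grid: the oscillation from its left end is at
most its variation. -/
theorem abs_block_sub_le (hq : Fn 𝔐 q) (hN : 0 < N) (i : 𝔐.Num) {l : 𝔐.Num} (hl : l ≤ N) :
    |q (((i * N + l : 𝔐.Num) : K 𝔐) / (M * N : 𝔐.Num)) - q (i / M)| ≤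
      isum (fun l => |q (((i * N + l : 𝔐.Num) + 1) / (M * N : 𝔐.Num)) -
        q ((i * N + l : 𝔐.Num) / (M * N : 𝔐.Num))|) N := by
  have h := isum_telescope (a := fun l => q (((i * N + l : 𝔐.Num) : K 𝔐) / (M * N : 𝔐.Num)))
    (by fun_prop) l
  have h0 : q (((i * N + 0 : 𝔐.Num) : K 𝔐) / (M * N : 𝔐.Num)) = q (i / M) := by
    rw [block_point hN]; simp
  rw [h0] at h
  rw [← h]
  refine (abs_isum_le (by fun_prop) l).trans ((isum_mono_right (by fun_prop) hl
    fun _ _ => abs_nonneg _).trans_eq (isum_congr (by fun_prop) (by fun_prop) fun l _ => ?_))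
  simp only [← add_assoc, K.ofNum_add, K.ofNum_one]

theorem vari_le_vari_mul (hq : Fn 𝔐 q) (hN : 0 < N) : vari q M ≤ vari q (M * N) := by
  rw [vari_eq_isum_block hq]
  refine isum_le (by fun_prop) (Fn.isum (by fun_prop) (by fun_prop)) fun i _ => ?_
  refine le_of_eq_of_le ?_ (abs_block_sub_le hq hN i le_rfl)
  rw [show i * N + N = (i + 1) * N + 0 by ring, block_point hN]
  simp

/-- Refining the grid only increases the variation. On a grid with n intervals the Taylor estimate
costs C/n² per interval, hence C/n in total, so refinement removes the error and the exact bound v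
remains. -/
theorem vari_peval_le {p : 𝔐.Num} {v : K 𝔐} (h : IntLE (fun x => |dpeval p x|) v) (hN : 0 < N) :
    vari (peval p) N ≤ v := by
  obtain ⟨C, hC, hC'⟩ := exists_peval_taylor p
  refine le_of_forall_pos_le_add fun ε hε => ?_
  obtain ⟨n, hn⟩ := h _ (half_pos hε)
  obtain ⟨m, hm⟩ := exists_div_succ_le C (half_pos hε)
  -- The factor n + m + 1 makes the grid fine enough both for the integral and for the Taylor error.
  refine (vari_le_vari_mul (N := n + m + 1) (by fun_prop) (Num.succ_pos _)).trans ?_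
  obtain ⟨k, hk⟩ := Num.lt_iff_exists.1 hN
  rw [zero_add] at hk
  obtain ⟨N', hN', h1⟩ : ∃ N', n + m ≤ N' ∧ N * (n + m + 1) = N' + 1 :=
    ⟨k * (n + m + 1) + (n + m), le_add_self, by rw [← hk]; ring⟩
  rw [h1]
  have hpos := K.ofNum_succ_pos N'
  have h2 : vari (peval p) (N' + 1) ≤ avg (fun x => |dpeval p x|) (N' + 1) + C / ((N' : K 𝔐) + 1) := by
    have e : avg (fun x => |dpeval p x|) (N' + 1) + C / ((N' : K 𝔐) + 1) = isum (fun j =>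
        |dpeval p ((j : K 𝔐) / (N' + 1 : 𝔐.Num))| * (1 / ((N' : K 𝔐) + 1)) +
          C / ((N' : K 𝔐) + 1) ^ 2) (N' + 1) := by
      unfold avg
      rw [isum_add (by fun_prop) (by fun_prop), isum_const, isum_mul_const (by fun_prop)]
      push_cast
      field_simp
    rw [e]
    refine isum_le (by fun_prop) (by fun_prop) fun j hj => ?_
    have h3 := div_mem hj.le
    have h4 := div_mem (Order.add_one_le_of_lt hj)
    have h5 := hC' _ _ h3.1 h3.2 h4.1 h4.2
    have h6 : ((j + 1 : 𝔐.Num) : K 𝔐) / (N' + 1 : 𝔐.Num) - j / (N' + 1 : 𝔐.Num) = 1 / (N' + 1) := by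
      push_cast; field_simp; ring
    rw [h6] at h5
    rw [← K.ofNum_one, ← K.ofNum_add j 1, K.ofNum_one]
    have h7 := (abs_sub_abs_le_abs_sub _ _).trans h5
    rw [abs_mul, abs_of_pos (one_div_pos.2 hpos)] at h7
    have h8 : C * (1 / ((N' : K 𝔐) + 1)) ^ 2 = C / (N' + 1) ^ 2 := by
      rw [one_div, inv_pow, div_eq_mul_inv]
    linarith
  have h3 := hn N' (le_self_add.trans hN')
  have h4 := hm N' (le_add_self.trans hN')
  linarith

theorem abs_sub_zero_le_vari (hq : Fn 𝔐 q) (hN : 0 < N) {j : 𝔐.Num} (hj : j ≤ N) :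
    |q (j / N) - q 0| ≤ vari q N := by
  have := abs_block_sub_le (M := 1) hq hN 0 hj
  simp only [zero_mul, zero_add, one_mul, K.ofNum_zero, zero_div] at this
  exact this

theorem vari_sub_le {q' : K 𝔐 → K 𝔐} (hq : Fn 𝔐 q) (hq' : Fn 𝔐 q') :
    vari (fun x => q x - q' x) N ≤ vari q N + vari q' N := by
  unfold vari
  rw [← isum_add (by fun_prop) (by fun_prop)]
  refine isum_le (by fun_prop) (by fun_prop) fun j _ => ?_
  rw [sub_sub_sub_comm]
  exact abs_sub _ _

/-- On each of the M blocks |q| is at most δ plus the variation of that block. Averaging over the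
blocks divides the total variation by M. -/
theorem avg_abs_le (hq : Fn 𝔐 q) (hM : 0 < M) (hN : 0 < N) {δ : K 𝔐}
    (h : ∀ i < M, |q (i / M)| ≤ δ) :
    avg (fun x => |q x|) (M * N) ≤ δ + vari q (M * N) / M := by
  have hM' := K.ofNum_pos.2 hM
  have hW : Fn 𝔐 fun i => isum (fun l => |q (((i * N + l : 𝔐.Num) + 1) / (M * N : 𝔐.Num)) -
        q ((i * N + l : 𝔐.Num) / (M * N : 𝔐.Num))|) N := Fn.isum (by fun_prop) (by fun_prop)
  refine (avg_block_le (e := fun i => δ + isum (fun l => |q (((i * N + l : 𝔐.Num) + 1) /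
    (M * N : 𝔐.Num)) - q ((i * N + l : 𝔐.Num) / (M * N : 𝔐.Num))|) N) (by fun_prop) (by fun_prop)
    hM hN fun i hi l hl => ?_).trans_eq ?_
  · have h1 := abs_block_sub_le (M := M) hq hN i hl.le
    have h2 := abs_sub_abs_le_abs_sub (q (((i * N + l : 𝔐.Num) : K 𝔐) / (M * N : 𝔐.Num)))
      (q (i / M))
    have h3 := h i hi
    linarith
  · rw [isum_add (by fun_prop) hW, ← vari_eq_isum_block hq, isum_const, add_div,
      mul_div_cancel_left₀ _ hM'.ne']

theorem abs_zero_le_avg (hq : Fn 𝔐 q) (hN : 0 < N) :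
    |q 0| ≤ avg (fun x => |q x|) N + vari q N := by
  have h := avg_mono (N := N) (H₁ := fun _ => |q 0|) (H₂ := fun x => |q x| + vari q N)
    (by fun_prop) (by fun_prop) fun i hi => by
      have h1 := abs_sub_zero_le_vari hq hN hi.le
      rw [abs_sub_comm] at h1
      have h2 := abs_sub_abs_le_abs_sub (q 0) (q (i / N))
      linarith
  rwa [avg_const hN, avg_add (by fun_prop) (by fun_prop), avg_const hN] at h

end vari

/-! ### The `L₁`-distance of polynomials of bounded variation -/

section polynomials

variable {p q r : 𝔐.Num} {u v : K 𝔐}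

/-- The `L₁`-distance of the polynomials `p` and `q` is at most `r`. -/
def PolyDistLE (p q : 𝔐.Num) (r : K 𝔐) : Prop := IntLE (fun x => |peval p x - peval q x|) r

theorem PolyDistLE.symm (h : PolyDistLE p q u) : PolyDistLE q p u := by
  unfold PolyDistLE at *
  simpa only [abs_sub_comm] using h

theorem PolyDistLE.trans (h : PolyDistLE p q u) (h' : PolyDistLE q r v) :
    PolyDistLE p r (u + v) :=
  IntLE.add (by fun_prop) (by fun_prop) (by fun_prop) h h' fun _ => abs_sub_le _ _ _

theorem polyDistLE_self (p : 𝔐.Num) : PolyDistLE p p 0 := by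
  intro ε hε
  refine ⟨0, fun n _ => ?_⟩
  simp only [sub_self, abs_zero]
  rw [avg_const (Num.succ_pos n)]
  linarith

theorem exists_lip_sub (p q : 𝔐.Num) :
    ∃ L : K 𝔐, 0 ≤ L ∧ Lip (fun x => |peval p x - peval q x|) L := by
  obtain ⟨L, hL, h⟩ := exists_peval_lipschitz p
  obtain ⟨L', hL', h'⟩ := exists_peval_lipschitz q
  refine ⟨L + L', add_nonneg hL hL', fun x y h1 h2 h3 h4 => ?_⟩
  refine (abs_abs_sub_abs_le_abs_sub _ _).trans ?_
  rw [sub_sub_sub_comm, add_mul]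
  exact (abs_sub _ _).trans (add_le_add (h x y h1 h2 h3 h4) (h' x y h1 h2 h3 h4))

/-- Some average of |p| is at most u + 1; passing from the average to the value at 0 costs v, and
from 0 to the given point another v. -/
theorem abs_peval_le (hu : IntLE (fun x => |peval p x|) u) (hv : IntLE (fun x => |dpeval p x|) v)
    {i M : 𝔐.Num} (hi : i ≤ M) (hM : 0 < M) : |peval p (i / M)| ≤ u + 1 + (v + v) := by
  obtain ⟨n, hn⟩ := hu 1 one_pos
  have h1 := hn n le_rfl
  have h2 := abs_zero_le_avg (q := peval p) (by fun_prop) (Num.succ_pos n)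
  have h3 := vari_peval_le hv (Num.succ_pos n)
  have h4 := abs_sub_zero_le_vari (q := peval p) (by fun_prop) hM hi
  have h5 := vari_peval_le hv hM
  have h6 := abs_sub_abs_le_abs_sub (peval p (i / M)) (peval p 0)
  linarith

/-- The compactness behind Helly's theorem: finitely many approximate values determine the
polynomial up to a small `L₁`-error. The difference has variation at most v + v, which is spread
over M blocks. -/
theorem polyDistLE_of_grid {δ : K 𝔐} {M : 𝔐.Num} (hM : 0 < M)
    (h : ∀ i < M, |peval p (i / M) - peval q (i / M)| ≤ δ) (hp : IntLE (fun x => |dpeval p x|) v)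
    (hq : IntLE (fun x => |dpeval q x|) v) : PolyDistLE p q (δ + (v + v) / M) := by
  obtain ⟨L, hL, hL'⟩ := exists_lip_sub p q
  refine intLE_of_frequently (by fun_prop) hL' hL fun ε hε n => ⟨M * (n + 1), ?_, ?_⟩
  · obtain ⟨k, hk⟩ := Num.lt_iff_exists.1 hM
    exact Num.lt_iff_exists.2 ⟨k * (n + 1), by rw [← hk]; ring⟩
  · have h1 := avg_abs_le (q := fun x => peval p x - peval q x) (by fun_prop) hM (Num.succ_pos n) h
    have h2 := vari_sub_le (q := peval p) (q' := peval q) (N := M * (n + 1)) (by fun_prop)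
      (by fun_prop)
    have h3 := mul_pos hM (Num.succ_pos n)
    have h4 := vari_peval_le hp h3
    have h5 := vari_peval_le hq h3
    have h6 := div_le_div_of_nonneg_right (h2.trans (add_le_add h4 h5)) (K.ofNum_nonneg M)
    linarith

end polynomials

/-! ## Arithmetical comprehension from projections -/

variable (𝔐) in
/-- The sets of the structure are closed under projection. -/
def ProjClosed : Prop := ∀ A ∈ 𝔐.sets, {x : 𝔐.Num | ∃ y, pair x y ∈ A} ∈ 𝔐.sets

omit hR in
theorem IsACA0.projClosed (h : 𝔐.IsACA0) : ProjClosed 𝔐 := fun A hA => by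
  have := h.arithmetical_comprehension (Formula.ex (.mem (.pair (.var 1) (.var 0)) 0))
    (fun _ => ⟨A, hA⟩) (fun _ => 0)
  simp only [sat_ex] at this
  exact this

/-- With projections available, decidable predicates absorb unbounded quantifiers, so induction and
minimisation apply to arithmetical ones. -/
theorem Fn.ex (h : ProjClosed 𝔐) {Γ Δ : Type*} [Coded 𝔐 Γ] [Coded 𝔐 Δ] {R : Γ → Δ → Prop}
    (hR : Fn 𝔐 fun p : Γ × Δ => R p.1 p.2) : Fn 𝔐 fun x => ∃ y, R x y := by
  classical
  obtain ⟨F, hF, hF'⟩ := hR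
  have hX := h _ hF.setOf_ne_zero_mem
  refine ⟨_, IsFun.char hX, fun z => ?_⟩
  have key : z ∈ {x | ∃ y, L2Structure.pair x y ∈ {z | F z ≠ 0}} ↔ ∃ y, R (dec z) y := by
    rw [(surj (𝔐 := 𝔐) (Γ := Δ)).exists, Set.mem_ofPred_eq]
    refine exists_congr fun y => ?_
    have := hF' (L2Structure.pair z y)
    simp only [dec_prod, unpair_pair] at this
    exact iff_of_eq this
  refine Eq.trans ?_ (propext key)
  generalize {x | ∃ y, L2Structure.pair x y ∈ {z | F z ≠ 0}} = X
  show ((if z ∈ X then (1 : 𝔐.Num) else 0) ≠ 0) = (z ∈ X)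
  simp

theorem Fn.all (h : ProjClosed 𝔐) {Γ Δ : Type*} [Coded 𝔐 Γ] [Coded 𝔐 Δ] {R : Γ → Δ → Prop}
    (hR : Fn 𝔐 fun p : Γ × Δ => R p.1 p.2) : Fn 𝔐 fun x => ∀ y, R x y :=
  (Fn.ex h (R := fun x y => ¬ R x y) hR.not).not.congr fun _ => by push Not; rfl

theorem Fn.term {Γ : Type*} [Coded 𝔐 Γ] {e : ℕ → Γ → 𝔐.Num} (he : ∀ i, Fn 𝔐 (e i)) (t : Term) :
    Fn 𝔐 fun x => 𝔐.val (fun i => e i x) t := by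
  induction t with
  | var i => exact he i
  | zero => exact Fn.const _
  | one => exact Fn.const _
  | add s t ihs iht => exact ihs.add iht
  | mul s t ihs iht => exact ihs.mul iht

/-- The parameter type is general because each quantifier adds a factor `𝔐.Num` to it. -/
theorem Fn.sat (h : ProjClosed 𝔐) (E : ℕ → 𝔐.sets) (φ : Formula) :
    ∀ {Γ : Type u} [Coded 𝔐 Γ] {e : ℕ → Γ → 𝔐.Num}, (∀ i, Fn 𝔐 (e i)) →
      Fn 𝔐 fun x => 𝔐.Sat E φ fun i => e i x := by
  have hs : ∀ {Γ : Type u} [Coded 𝔐 Γ] {e : ℕ → Γ → 𝔐.Num}, (∀ i, Fn 𝔐 (e i)) →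
      ∀ i, Fn 𝔐 fun p : Γ × 𝔐.Num => scons p.2 (fun i => e i p.1) i := fun he i => by
    cases i with
    | zero => exact Fn.snd Fn.id
    | succ i => exact (he i).comp (Fn.fst Fn.id)
  induction φ with
  | eq s t => exact fun he => (Fn.term he s).eq (Fn.term he t)
  | lt s t => exact fun he => (Fn.term he s).lt (Fn.term he t)
  | mem t i => exact fun he => Fn.mem (E i).2 (Fn.term he t)
  | not φ ih => exact fun he => (ih he).not
  | and φ ψ ih₁ ih₂ => exact fun he => (ih₁ he).and (ih₂ he)
  | ball t φ ih => exact fun he => Fn.ball (ih (hs he)) (Fn.term he t)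
  | all φ ih => exact fun he => Fn.all h (ih (hs he))

theorem ProjClosed.isACA0 (h : ProjClosed 𝔐) : 𝔐.IsACA0 where
  basic := hR.out.basic
  induction _ hX h0 hs := set_induction hX h0 hs
  arithmetical_comprehension φ E v := by
    refine (Fn.sat h E φ (e := fun i n => scons n v i) fun i => ?_).setOf_mem
    cases i with
    | zero => exact Fn.id
    | succ i => exact Fn.const _

/-! ## Real numbers of the structure -/

theorem IsReal.of_val {x : 𝔐.Num → Q 𝔐} (hx : Fn 𝔐 x)
    (h : ∀ k i, |K.val (x k) - K.val (x (k + i))| ≤ hp k) : IsReal x :=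
  ⟨hx.isSeq, fun k i => by
    rw [← K.val_le_val, K.val_abs, K.val_sub, Q.val_half_pow]; exact h k i⟩

theorem IsReal.val {x : 𝔐.Num → Q 𝔐} (hx : IsReal x) (k i : 𝔐.Num) :
    |K.val (x k) - K.val (x (k + i))| ≤ hp k := by
  have := K.val_le_val.2 (hx.2 k i)
  rwa [K.val_abs, K.val_sub, Q.val_half_pow] at this

theorem IsIntegral.of_val {F : Q 𝔐 → Q 𝔐} {H : K 𝔐 → K 𝔐} {x : 𝔐.Num → Q 𝔐} (h : Lifts F H)
    (hx : IsReal x) (h' : ∀ ε : K 𝔐, 0 < ε → ∃ N : 𝔐.Num, ∀ n, N ≤ n →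
      |avg H (n + 1) - K.val (x n)| ≤ ε) : IsIntegral F x := by
  refine ⟨hx, fun ε hε => ?_⟩
  obtain ⟨N, hN⟩ := h' (K.val ε) (K.val_lt_val.2 hε)
  refine ⟨N, fun n hn => ?_⟩
  rw [← K.val_le_val, K.val_abs, K.val_sub, h.val_riemannSum]
  exact hN n hn

theorem RealLE.of_val {x : 𝔐.Num → Q 𝔐} {r : Q 𝔐} (h : ∀ k, K.val (x k) ≤ K.val r + hp k) :
    RealLE x r := fun k => by
  rw [← K.val_le_val, K.val_add, Q.val_half_pow]; exact h k

theorem RealDistLE.of_val {x y : 𝔐.Num → Q 𝔐} {r : Q 𝔐}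
    (h : ∀ k, |K.val (x k) - K.val (y k)| ≤ K.val r + (hp k + hp k)) : RealDistLE x y r := fun k => by
  rw [← K.val_le_val, K.val_abs, K.val_sub, K.val_add, K.val_add, Q.val_half_pow]; exact h k

theorem isReal_const (r : Q 𝔐) : IsReal fun _ : 𝔐.Num => r :=
  IsReal.of_val (Fn.const r) fun k i => by rw [sub_self, abs_zero]; exact (hp_pos k).le

theorem isIntegral_const {F : Q 𝔐 → Q 𝔐} {H : K 𝔐 → K 𝔐} (h : Lifts F H) (r : Q 𝔐)
    (hr : ∀ x, H x = K.val r) : IsIntegral F fun _ => r :=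
  IsIntegral.of_val h (isReal_const r) fun ε hε => ⟨0, fun n _ => by
    rw [funext hr, avg_const (Num.succ_pos n), sub_self, abs_zero]; exact hε.le⟩

theorem isFun₂_iff {f : 𝔐.Num → 𝔐.Num → 𝔐.Num} :
    IsFun₂ f ↔ Fn 𝔐 fun p : 𝔐.Num × 𝔐.Num => f p.1 p.2 := by
  constructor
  · intro h
    refine Fn.of_graph ((Fn.mem h (f := fun p : (𝔐.Num × 𝔐.Num) × 𝔐.Num =>
      pair (pair p.1.1 p.1.2) p.2) (by fun_prop)).congr fun p => ?_)
    constructor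
    · rintro ⟨n, k, h⟩
      obtain ⟨h1, h2⟩ := pair_inj.1 h
      obtain ⟨h3, h4⟩ := pair_inj.1 h1
      rw [h2, h3, h4]
    · intro h
      exact ⟨p.1.1, p.1.2, by rw [h]⟩
  · intro h
    have : Fn 𝔐 fun z : 𝔐.Num => ∃ n < z + 1, ∃ k < z + 1, z = pair (pair n k) (f n k) :=
      Fn.bex (Fn.bex (Fn.eq (by fun_prop) (Fn.pair (by fun_prop)
        (h.comp (f := fun q : (𝔐.Num × 𝔐.Num) × 𝔐.Num => (q.1.2, q.2)) (by fun_prop))))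
        (by fun_prop)) (by fun_prop)
    refine (congrArg (· ∈ 𝔐.sets) (Set.ext fun z => ?_)).mp this.setOf_mem
    constructor
    · rintro ⟨n, -, k, -, h⟩; exact ⟨n, k, h⟩
    · rintro ⟨n, k, rfl⟩
      exact ⟨n, Num.lt_add_one_iff'.2 ((le_pair_left _ _).trans (le_pair_left _ _)), k,
        Num.lt_add_one_iff'.2 ((le_pair_right _ _).trans (le_pair_left _ _)), rfl⟩

/-! ## Constant polynomials -/

/-- A code of the constant polynomial with value `r`. -/
def constPoly (r : Q 𝔐) : 𝔐.Num := pair 1 (pair r.code r.code)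

theorem polyCoeff_constPoly_zero (r : Q 𝔐) : polyCoeff (constPoly r) 0 = r := by
  -- At index 0 the modulus is d + 1, so taking c = d makes c its own remainder.
  have h : beta r.code r.code 0 = r.code :=
    beta_eq (q := 0) (by rw [zero_add, one_mul]; exact lt_add_one _) (by rw [zero_mul, zero_add])
  simp [polyCoeff, polyLen, constPoly, h]

theorem polyCoeff_constPoly_one (r : Q 𝔐) : polyCoeff (constPoly r) 1 = 0 := by
  simp [polyCoeff, polyLen, constPoly]

theorem polyLen_constPoly (r : Q 𝔐) : polyLen (constPoly r) = 0 + 1 := by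
  simp [polyLen, constPoly]

theorem peval_constPoly (r : Q 𝔐) (x : K 𝔐) : peval (constPoly r) x = K.val r := by
  rw [peval, polyLen_constPoly, isum_succ (by fun_prop), isum_zero (by fun_prop),
    polyCoeff_constPoly_zero, kpow_zero, zero_add, mul_one]

theorem dpeval_constPoly (r : Q 𝔐) (x : K 𝔐) : dpeval (constPoly r) x = 0 := by
  rw [dpeval, polyLen_constPoly, isum_succ (by fun_prop), isum_zero (by fun_prop), zero_add,
    zero_add, polyCoeff_constPoly_one, K.val_zero]
  simp

theorem isBV_constPoly (r : Q 𝔐) : IsBV (fun _ => constPoly r) 0 := by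
  refine ⟨⟨IsFun.const _, fun k => ⟨fun _ => 0, ?_, ?_⟩⟩, fun k => ⟨fun _ => 0, ?_, ?_⟩⟩
  · exact isIntegral_const (lifts_polyEval_sub _ _) 0 fun x => by rw [sub_self, abs_zero]; rfl
  · refine RealLE.of_val fun l => ?_
    rw [K.val_zero, Q.val_half_pow]
    exact (add_pos (hp_pos k) (hp_pos l)).le
  · exact isIntegral_const (lifts_polyDeriv _) 0 fun x => by
      rw [dpeval_constPoly, abs_zero]; rfl
  · refine RealLE.of_val fun l => ?_
    rw [K.val_zero, zero_add]
    exact (hp_pos l).le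

theorem normLE_constPoly {r s : Q 𝔐} (h : |K.val r| ≤ K.val s) :
    NormLE (fun _ => constPoly r) s := by
  refine ⟨fun _ => r.abs, ⟨isReal_const _, fun ε hε => ⟨0, fun k _ => ⟨fun _ => r.abs, ?_, ?_⟩⟩⟩, ?_⟩
  · exact isIntegral_const (lifts_polyEval _) _ fun x => by rw [peval_constPoly, K.val_abs]
  · refine RealDistLE.of_val fun l => ?_
    have h1 : 0 < K.val ε := K.val_lt_val.2 hε
    have h2 := hp_pos l
    rw [sub_self, abs_zero]
    linarith
  · refine RealLE.of_val fun l => ?_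
    rw [K.val_abs]
    linarith [hp_pos l]

/-- The polynomial `p` takes the value `a` at all rational points of `[0, 1]`. -/
def IsConstPoly (p : 𝔐.Num) (a : K 𝔐) : Prop :=
  ∀ N : 𝔐.Num, 0 < N → ∀ j, j ≤ N → peval p (j / N) = a

/-- Every grid variation is at most 0, so no value at a grid point can differ from the value at 0.
-/
theorem isConstPoly_of_intLE {p : 𝔐.Num} (h : IntLE (fun x => |dpeval p x|) 0) :
    IsConstPoly p (peval p 0) := fun N hN j hj => by
  have h1 := (abs_sub_zero_le_vari (q := peval p) (by fun_prop) hN hj).trans (vari_peval_le h hN)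
  exact sub_eq_zero.1 (abs_nonpos_iff.1 h1)

theorem PolyDistLE.abs_sub_le {p q : 𝔐.Num} {a b r : K 𝔐} (hp : IsConstPoly p a)
    (hq : IsConstPoly q b) (h : PolyDistLE p q r) : |a - b| ≤ r := by
  refine le_of_forall_pos_le_add fun ε hε => ?_
  obtain ⟨N, hN⟩ := h ε hε
  refine le_trans ?_ (hN N le_rfl)
  have := avg_mono (N := N + 1) (H₁ := fun _ => |a - b|)
    (H₂ := fun x => |peval p x - peval q x|) (by fun_prop) (by fun_prop) fun i hi => by
      rw [hp _ (Num.succ_pos N) _ hi.le, hq _ (Num.succ_pos N) _ hi.le]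
  rwa [avg_const (Num.succ_pos N)] at this

/-! ## Helly's selection theorem implies arithmetical comprehension -/

theorem abs_sub_le_of_step {d : 𝔐.Num → K 𝔐} (hd : Fn 𝔐 d) (h : ∀ k, |d k - d (k + 1)| ≤ hp k)
    (k i : 𝔐.Num) : |d k - d (k + i)| ≤ 2 * hp k := by
  -- The telescoping form of the geometric bound, strong enough to be inductive.
  have : |d k - d (k + i)| ≤ 2 * hp k - 2 * hp (k + i) := by
    refine Fn.induction (P := fun i => |d k - d (k + i)| ≤ 2 * hp k - 2 * hp (k + i)) (by fun_prop)
      (by simp) (fun i ih => ?_) i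
    have h1 := h (k + i)
    rw [← add_assoc, hp_succ]
    have h2 := _root_.abs_sub_le (d k) (d (k + i)) (d (k + i + 1))
    linarith
  linarith [hp_pos (k + i)]

theorem single_le_isum {a : 𝔐.Num → K 𝔐} (ha : Fn 𝔐 a) {n x : 𝔐.Num} (hx : x < n)
    (h : ∀ i < n, 0 ≤ a i) : a x ≤ isum a n := by
  refine le_trans ?_ (isum_mono_right ha (Order.add_one_le_of_lt hx) h)
  rw [isum_succ ha]
  exact le_add_of_nonneg_left (isum_nonneg ha fun i hi => h i (hi.trans hx))

/-! ### Specker's sequence for the projection of a set -/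

section specker

variable (A : Set 𝔐.Num)

open Classical in
/-- The weight `2 ^ (-x - 1)` if `x` is found in the projection of `A` before stage `n`. -/
noncomputable def weight (n x : 𝔐.Num) : K 𝔐 := if ∃ y < n, pair x y ∈ A then hp (x + 1) else 0

/-- The bounded increasing sequence of rational numbers that approximates the projection of `A`. -/
noncomputable def specker (n : 𝔐.Num) : K 𝔐 := isum (weight A n) n

variable {A}

theorem fn_weight (hA : A ∈ 𝔐.sets) : Fn 𝔐 fun p : 𝔐.Num × 𝔐.Num => weight A p.1 p.2 := by
  classical
  exact Fn.ite (Fn.bex (Fn.mem hA (by fun_prop)) (by fun_prop)) (by fun_prop) (by fun_prop)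

theorem fn_weight_right (hA : A ∈ 𝔐.sets) (n : 𝔐.Num) : Fn 𝔐 (weight A n) :=
  (fn_weight hA).comp (f := fun x => (n, x)) (by fun_prop)

theorem fn_specker (hA : A ∈ 𝔐.sets) : Fn 𝔐 (specker A) := Fn.isum (fn_weight hA) (by fun_prop)

theorem weight_nonneg (n x : 𝔐.Num) : 0 ≤ weight A n x := by
  unfold weight; split_ifs
  · exact (hp_pos _).le
  · exact le_rfl

theorem weight_mono {m n : 𝔐.Num} (h : m ≤ n) (x : 𝔐.Num) : weight A m x ≤ weight A n x := by
  by_cases hx : ∃ y < m, pair x y ∈ A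
  · have : ∃ y < n, pair x y ∈ A := hx.imp fun y hy => ⟨hy.1.trans_le h, hy.2⟩
    rw [weight, weight, if_pos hx, if_pos this]
  · rw [weight, if_neg hx]; exact weight_nonneg n x

theorem specker_mono (hA : A ∈ 𝔐.sets) {m n : 𝔐.Num} (h : m ≤ n) : specker A m ≤ specker A n :=
  (isum_le (fn_weight_right hA m) (fn_weight_right hA n) fun i _ => weight_mono h i).trans
    (isum_mono_right (fn_weight_right hA n) h fun i _ => weight_nonneg n i)

theorem specker_nonneg (hA : A ∈ 𝔐.sets) (n : 𝔐.Num) : 0 ≤ specker A n :=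
  isum_nonneg (fn_weight_right hA n) fun i _ => weight_nonneg n i

theorem specker_le_one (hA : A ∈ 𝔐.sets) (n : 𝔐.Num) : specker A n ≤ 1 := by
  have h : isum (fun x : 𝔐.Num => hp (x + 1)) n = 1 - hp n := by
    refine Fn.induction (P := fun n => isum (fun x : 𝔐.Num => hp (x + 1)) n = 1 - hp n) (by fun_prop)
      ?_ (fun n ih => ?_) n
    · rw [isum_zero (by fun_prop)]; simp
    · rw [isum_succ (by fun_prop), ih, hp_succ]; ring
  refine (isum_le (fn_weight_right hA n) (by fun_prop : Fn 𝔐 fun x : 𝔐.Num => hp (x + 1))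
    fun x _ => ?_).trans (h.trans_le (by linarith [hp_pos n]))
  unfold weight; split_ifs
  · exact le_rfl
  · exact (hp_pos _).le

/-- A witness for x that appears between the stages m and n adds the full weight of x, and no other
weight decreases. -/
theorem specker_gap (hA : A ∈ 𝔐.sets) {m n x : 𝔐.Num} (hmn : m ≤ n) (hx : x < m)
    (h : ¬ ∃ y < m, pair x y ∈ A) (h' : ∃ y < n, pair x y ∈ A) :
    specker A m + hp (x + 1) ≤ specker A n := by
  have h1 := fn_weight_right hA m
  have h2 := fn_weight_right hA n
  have h3 := single_le_isum (a := fun i => weight A n i - weight A m i) (by fun_prop) hx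
    fun i _ => sub_nonneg.2 (weight_mono hmn i)
  rw [isum_sub h2 h1, weight, weight, if_pos h', if_neg h, sub_zero] at h3
  have h4 := isum_mono_right h2 hmn fun i _ => weight_nonneg n i
  unfold specker
  linarith

end specker

/-- The limit point supplied by the theorem is a fast sequence of rationals inside the model, so it
gives a rate of approximation for Specker's sequence, which decides the projection. -/
theorem HST.projClosed (h : HST 𝔐) : ProjClosed 𝔐 := by
  intro A hA
  obtain ⟨q, hq, hqc⟩ := Fn.exists_lift (fn_specker hA)
  obtain ⟨φ, g, hφ, hg, hg_mono, hconv⟩ := h (fun n _ => constPoly (q n)) (fun _ => 0)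
    (isFun₂_iff.2 (by unfold constPoly; fun_prop)) (Fn.const 0).isSeq
    (fun n => isBV_constPoly (q n)) 1 0
    (fun n => normLE_constPoly (by
      rw [hqc, K.val_one, abs_of_nonneg (specker_nonneg hA n)]; exact specker_le_one hA n))
    (fun _ => K.val_le_val.1 le_rfl)
  have hφfn := hφ.1.1.fn
  have hgfn := hg.fn
  have hconst : ∀ k, IsConstPoly (φ k) (peval (φ k) 0) := fun k =>
    isConstPoly_of_intLE ((hφ.2 k).intLE (lifts_polyDeriv _))
  have hd : Fn 𝔐 fun k => peval (φ k) 0 := by fun_prop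
  have hstep : ∀ k, |peval (φ k) 0 - peval (φ (k + 1)) 0| ≤ hp k := fun k => by
    have := (hφ.1.2 k).intLE (lifts_polyEval_sub _ _)
    rw [Q.val_half_pow] at this
    exact PolyDistLE.abs_sub_le (hconst k) (hconst (k + 1)) this
  have hgk : ∀ n, n ≤ g n := fun n => by
    refine Fn.induction (P := fun n => n ≤ g n) (by fun_prop) (Num.zero_le' _) (fun n ih => ?_) n
    exact Order.add_one_le_of_lt (ih.trans_lt (hg_mono _ _ (lt_add_one n)))
  -- Convergence in `L₁` only compares with far members of `φ`; the fast rate of `φ` carries the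
  -- estimate back to the index k at a cost of 2 * hp k.
  have hlim : ∀ k (ε : K 𝔐), 0 < ε → ∃ N : 𝔐.Num, ∀ n, N ≤ n →
      |specker A (g n) - peval (φ k) 0| ≤ ε + 2 * hp k := by
    intro k ε hε
    obtain ⟨r, hr, hrε⟩ := exists_val_eq (half_pos hε)
    obtain ⟨N, hN⟩ := hconv r hr
    refine ⟨N, fun n hn => ?_⟩
    obtain ⟨x, hx, hxr⟩ := hN n hn
    obtain ⟨k₀, hk₀⟩ := hx.intLE (fun k => lifts_polyEval_sub _ _) hxr (half_pos hε)
    have h1 := hk₀ (k₀ + k) le_self_add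
    have h2 : |K.val (q (g n)) - peval (φ (k₀ + k)) 0| ≤ K.val r + ε / 2 :=
      PolyDistLE.abs_sub_le (fun _ _ _ _ => peval_constPoly _ _) (hconst _) h1
    have h3 := abs_sub_le_of_step hd hstep k k₀
    rw [add_comm k k₀] at h3
    rw [hqc, hrε] at h2
    rw [abs_sub_comm] at h3
    have h4 := _root_.abs_sub_le (specker A (g n)) (peval (φ (k₀ + k)) 0) (peval (φ k) 0)
    linarith
  have hle : ∀ m k, specker A m ≤ peval (φ k) 0 + 2 * hp k := fun m k => by
    refine le_of_forall_pos_le_add fun ε hε => ?_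
    obtain ⟨N, hN⟩ := hlim k ε hε
    have h1 := le_of_abs_le (hN (max N m) (le_max_left _ _))
    have h2 := specker_mono hA ((le_max_right N m).trans (hgk (max N m)))
    linarith
  have hge : ∀ m k, ∃ n, m ≤ n ∧ peval (φ k) 0 - 3 * hp k ≤ specker A n := fun m k => by
    obtain ⟨N, hN⟩ := hlim k (hp k) (hp_pos k)
    refine ⟨g (max N m), (le_max_right N m).trans (hgk _), ?_⟩
    have h1 := neg_le_of_abs_le (hN (max N m) (le_max_left _ _))
    linarith
  have hspecker := fn_specker hA
  -- With precision hp (x + 5), the sequence can still grow by at most (2 + 3) * hp (x + 5) after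
  -- stage n, whereas a new witness for x would add hp (x + 1), that is 16 * hp (x + 5).
  refine (Fn.of_sigma (P := fun x => ∃ y, pair x y ∈ A) (A := fun x y => pair x y ∈ A)
    (B := fun x n => x < n ∧ peval (φ (x + 5)) 0 - 3 * hp (x + 5) ≤ specker A n ∧
      ¬ ∃ y < n, pair x y ∈ A) (Fn.mem hA (by fun_prop)) ?_ (fun x => Iff.rfl)
    fun x => ⟨fun hx => ?_, ?_⟩).setOf_mem
  · exact Fn.and (by fun_prop) (Fn.and (by fun_prop) (Fn.bex (Fn.mem hA (by fun_prop))
      (by fun_prop)).not)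
  · obtain ⟨n, hn, hn'⟩ := hge (x + 1) (x + 5)
    exact ⟨n, (lt_add_one x).trans_le hn, hn', fun ⟨y, _, hy⟩ => hx ⟨y, hy⟩⟩
  · rintro ⟨n, hxn, hn, hn'⟩ ⟨y, hy⟩
    have h1 := specker_gap hA (le_max_left n (y + 1)) hxn hn'
      ⟨y, (lt_add_one y).trans_le (le_max_right _ _), hy⟩
    have h2 := hle (max n (y + 1)) (x + 5)
    have h3 : hp (x + 1) = 16 * hp (x + 5) := by
      rw [show x + 5 = x + 1 + 1 + 1 + 1 + 1 by ring]
      simp only [hp_succ]; ring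
    have h4 := hp_pos (x + 5)
    linarith

/-! ## Limits of sequences of rational numbers -/

/-- Being a modulus of convergence is arithmetical, so least moduli form a function of the model.
They are automatically monotone, since a modulus for a finer precision serves a coarser one. -/
theorem exists_real_limit (hPC : ProjClosed 𝔐) {s : 𝔐.Num → K 𝔐} (hs : Fn 𝔐 s)
    (h : ∀ ε : K 𝔐, 0 < ε → ∃ N : 𝔐.Num, ∀ m, N ≤ m → ∀ n, N ≤ n → |s m - s n| ≤ ε) :
    ∃ x : 𝔐.Num → Q 𝔐, IsReal x ∧ ∀ ε : K 𝔐, 0 < ε → ∃ N : 𝔐.Num, ∀ n, N ≤ n →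
      |s n - K.val (x n)| ≤ ε := by
  obtain ⟨N, hN, hN'⟩ := Fn.exists_min
    (R := fun k N : 𝔐.Num => ∀ m, N ≤ m → ∀ n, N ≤ n → |s m - s n| ≤ hp k)
    (Fn.all hPC (Fn.imp (by fun_prop) (Fn.all hPC (Fn.imp (by fun_prop) (by fun_prop)))))
    fun k => h _ (hp_pos k)
  have hmono : ∀ {k l}, k ≤ l → N k ≤ N l := fun {k l} hkl => not_lt.1 fun hlt =>
    (hN' k).2 _ hlt fun m hm n hn => ((hN' l).1 m hm n hn).trans (hp_anti hkl)
  obtain ⟨x, hx, hxs⟩ := Fn.exists_lift (a := fun k => s (N k)) (by fun_prop)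
  refine ⟨x, IsReal.of_val hx fun k i => ?_, fun ε hε => ?_⟩
  · rw [hxs, hxs]
    exact (hN' k).1 _ le_rfl _ (hmono le_self_add)
  · obtain ⟨k, hk⟩ := exists_hp_le hε
    refine ⟨max k (N k), fun n hn => ?_⟩
    rw [hxs]
    exact ((hN' k).1 _ (le_of_max_le_right hn) _ (hmono (le_of_max_le_left hn))).trans
      (hk k le_rfl)

theorem IsReal.realLE {x : 𝔐.Num → Q 𝔐} {r : Q 𝔐} (hx : IsReal x)
    (h : ∀ ε : K 𝔐, 0 < ε → ∃ N : 𝔐.Num, ∀ n, N ≤ n → K.val (x n) ≤ K.val r + ε) : RealLE x r := by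
  refine RealLE.of_val fun k => le_of_forall_pos_le_add fun ε hε => ?_
  obtain ⟨N, hN⟩ := h ε hε
  have h1 := le_of_abs_le (hx.val k N)
  have h2 := hN (k + N) le_add_self
  linarith

theorem IsReal.realDistLE {x y : 𝔐.Num → Q 𝔐} {r : Q 𝔐} (hx : IsReal x) (hy : IsReal y)
    (h : ∀ ε : K 𝔐, 0 < ε → ∃ N : 𝔐.Num, ∀ n, N ≤ n → |K.val (x n) - K.val (y n)| ≤ K.val r + ε) :
    RealDistLE x y r := by
  refine RealDistLE.of_val fun k => le_of_forall_pos_le_add fun ε hε => ?_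
  obtain ⟨N, hN⟩ := h ε hε
  have h1 := hx.val k N
  have h2 := hy.val k N
  have h3 := hN (k + N) le_add_self
  rw [abs_sub_comm] at h2
  have h4 := abs_sub_le (K.val (x k)) (K.val (x (k + N))) (K.val (y k))
  have h5 := abs_sub_le (K.val (x (k + N))) (K.val (y (k + N))) (K.val (y k))
  linarith

/-! ## Existence of integrals and norms -/

theorem IsIntegral.realLE {F : Q 𝔐 → Q 𝔐} {H : K 𝔐 → K 𝔐} {x : 𝔐.Num → Q 𝔐} {r : Q 𝔐}
    (h : Lifts F H) (hx : IsIntegral F x) (hr : IntLE H (K.val r)) : RealLE x r := by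
  refine hx.1.realLE fun ε hε => ?_
  obtain ⟨N, hN⟩ := hx.val h (half_pos hε)
  obtain ⟨N', hN'⟩ := hr _ (half_pos hε)
  refine ⟨max N N', fun n hn => ?_⟩
  have h1 := neg_le_of_abs_le (hN n (le_of_max_le_left hn))
  have h2 := hN' n (le_of_max_le_right hn)
  linarith

theorem IntegralLE.mono {F : Q 𝔐 → Q 𝔐} {r s : Q 𝔐} (h : IntegralLE F r) (hrs : r ≤ s) :
    IntegralLE F s := by
  obtain ⟨x, hx, hxr⟩ := h
  exact ⟨x, hx, RealLE.of_val fun k =>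
    (hxr.val k).trans (add_le_add_left (K.val_le_val.2 hrs) _)⟩

theorem cauchy_avg (p q : 𝔐.Num) {ε : K 𝔐} (hε : 0 < ε) : ∃ N : 𝔐.Num, ∀ m, N ≤ m → ∀ n, N ≤ n →
    |avg (fun t => |peval p t - peval q t|) (m + 1) -
      avg (fun t => |peval p t - peval q t|) (n + 1)| ≤ ε := by
  obtain ⟨L, hL, hL'⟩ := exists_lip_sub p q
  obtain ⟨N, hN⟩ := exists_div_succ_le L (half_pos hε)
  have key : ∀ m, N ≤ m → ∀ n, N ≤ n → avg (fun t => |peval p t - peval q t|) (m + 1) ≤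
      avg (fun t => |peval p t - peval q t|) (n + 1) + ε := fun m hm n hn => by
    have h1 := avg_le_avg (by fun_prop) hL' hL (Num.succ_pos m) (Num.succ_pos n)
    have h2 := hN m hm
    have h3 := hN n hn
    push_cast at h1
    linarith
  refine ⟨N, fun m hm n hn => abs_sub_le_iff.2 ⟨?_, ?_⟩⟩
  · linarith [key m hm n hn]
  · linarith [key n hn m hm]

theorem fn_avg_polyDist {Γ : Type*} [Coded 𝔐 Γ] {p q n : Γ → 𝔐.Num} (hp : Fn 𝔐 p) (hq : Fn 𝔐 q)
    (hn : Fn 𝔐 n) : Fn 𝔐 fun x => avg (fun t => |peval (p x) t - peval (q x) t|) (n x) :=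
  Fn.div_K (Fn.isum (by fun_prop) hn) (by fun_prop)

/-- This lets distance bounds be chained by internal induction along nonstandard numbers of steps,
as in `polyDistLE_of_step`. -/
theorem Fn.polyDistLE (hPC : ProjClosed 𝔐) {Γ : Type*} [Coded 𝔐 Γ] {p q : Γ → 𝔐.Num} {r : Γ → K 𝔐}
    (hp : Fn 𝔐 p) (hq : Fn 𝔐 q) (hr : Fn 𝔐 r) : Fn 𝔐 fun x => PolyDistLE (p x) (q x) (r x) :=
  Fn.all hPC (Fn.imp (by fun_prop) (Fn.ex hPC (Fn.all hPC (Fn.imp (by fun_prop)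
    (Fn.le_K (fn_avg_polyDist (by fun_prop) (by fun_prop) (by fun_prop)) (by fun_prop))))))

theorem exists_isIntegral (hPC : ProjClosed 𝔐) (p q : 𝔐.Num) :
    ∃ x, IsIntegral (fun t => (polyEval p t - polyEval q t).abs) x := by
  obtain ⟨x, hx, hx'⟩ := exists_real_limit hPC
    (fn_avg_polyDist (Fn.const p) (Fn.const q) (n := fun n : 𝔐.Num => n + 1) (by fun_prop))
    fun ε hε => cauchy_avg p q hε
  exact ⟨x, IsIntegral.of_val (lifts_polyEval_sub p q) hx hx'⟩

theorem PolyDistLE.integralLE (hPC : ProjClosed 𝔐) {p q : 𝔐.Num} {r : Q 𝔐}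
    (h : PolyDistLE p q (K.val r)) :
    IntegralLE (fun t => (polyEval p t - polyEval q t).abs) r := by
  obtain ⟨x, hx⟩ := exists_isIntegral hPC p q
  exact ⟨x, hx, hx.realLE (lifts_polyEval_sub p q) h⟩

theorem avg_polyDist_le {p p' q q' : 𝔐.Num} {a b ε : K 𝔐} (hp : PolyDistLE p p' a)
    (hq : PolyDistLE q q' b) (hε : 0 < ε) : ∃ N : 𝔐.Num, ∀ n, N ≤ n →
      |avg (fun t => |peval p t - peval q t|) (n + 1) -
        avg (fun t => |peval p' t - peval q' t|) (n + 1)| ≤ a + b + ε := by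
  obtain ⟨N, hN⟩ := hp _ (half_pos hε)
  obtain ⟨N', hN'⟩ := hq _ (half_pos hε)
  refine ⟨max N N', fun n hn => ?_⟩
  have h1 := hN n (le_of_max_le_left hn)
  have h2 := hN' n (le_of_max_le_right hn)
  have h3 := avg_mono (N := n + 1) (H₁ := fun t => |peval p t - peval q t|)
    (H₂ := fun t => |peval p' t - peval q' t| + (|peval p t - peval p' t| +
      |peval q t - peval q' t|)) (by fun_prop) (by fun_prop) fun i _ => by
    have h4 := abs_sub_le (peval p (i / (n + 1 : 𝔐.Num))) (peval p' (i / (n + 1 : 𝔐.Num)))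
      (peval q (i / (n + 1 : 𝔐.Num)))
    have h5 := abs_sub_le (peval p' (i / (n + 1 : 𝔐.Num))) (peval q' (i / (n + 1 : 𝔐.Num)))
      (peval q (i / (n + 1 : 𝔐.Num)))
    rw [abs_sub_comm (peval q' _)] at h5
    linarith
  have h3' := avg_mono (N := n + 1) (H₁ := fun t => |peval p' t - peval q' t|)
    (H₂ := fun t => |peval p t - peval q t| + (|peval p t - peval p' t| +
      |peval q t - peval q' t|)) (by fun_prop) (by fun_prop) fun i _ => by
    have h4 := abs_sub_le (peval p' (i / (n + 1 : 𝔐.Num))) (peval p (i / (n + 1 : 𝔐.Num)))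
      (peval q' (i / (n + 1 : 𝔐.Num)))
    have h5 := abs_sub_le (peval p (i / (n + 1 : 𝔐.Num))) (peval q (i / (n + 1 : 𝔐.Num)))
      (peval q' (i / (n + 1 : 𝔐.Num)))
    rw [abs_sub_comm (peval p' _) (peval p _)] at h4
    linarith
  rw [avg_add (by fun_prop) (by fun_prop), avg_add (by fun_prop) (by fun_prop)] at h3 h3'
  exact abs_sub_le_iff.2 ⟨by linarith, by linarith⟩

theorem polyDistLE_of_step (hPC : ProjClosed 𝔐) {p : 𝔐.Num → 𝔐.Num} (hp' : Fn 𝔐 p)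
    (h : ∀ k, PolyDistLE (p k) (p (k + 1)) (hp k)) {k l : 𝔐.Num} (hkl : k ≤ l) :
    PolyDistLE (p k) (p l) (2 * hp k) := by
  obtain ⟨i, rfl⟩ := Num.le_iff_exists.1 hkl
  have : PolyDistLE (p k) (p (k + i)) (2 * hp k - 2 * hp (k + i)) := by
    refine Fn.induction (P := fun i => PolyDistLE (p k) (p (k + i)) (2 * hp k - 2 * hp (k + i)))
      (Fn.polyDistLE hPC (by fun_prop) (by fun_prop) (by fun_prop)) ?_ (fun i ih => ?_) i
    · simpa using polyDistLE_self (p k)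
    · rw [← add_assoc, hp_succ]
      exact (ih.trans (h (k + i))).mono (by linarith)
  exact this.mono (by linarith [hp_pos (k + i)])

/-- For each k one sufficiently fine Riemann sum approximates the k-th integral up to 2^(-k); these
rationals form a Cauchy sequence, and its limit is the norm. -/
theorem exists_isLimNorm (hPC : ProjClosed 𝔐) {p q : 𝔐.Num → 𝔐.Num} (hp' : Fn 𝔐 p) (hq' : Fn 𝔐 q)
    (h : ∀ k, PolyDistLE (p k) (p (k + 1)) (hp k))
    (h' : ∀ k, PolyDistLE (q k) (q (k + 1)) (hp k)) :
    ∃ x, IsLimNorm (fun k t => polyEval (p k) t - polyEval (q k) t) x ∧ ∀ r : Q 𝔐,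
      (∃ k₀ : 𝔐.Num, ∀ k, k₀ ≤ k → PolyDistLE (p k) (q k) (K.val r)) → RealLE x r := by
  set c : 𝔐.Num → 𝔐.Num → K 𝔐 := fun k n => avg (fun t => |peval (p k) t - peval (q k) t|) (n + 1)
    with hc
  have hcf : Fn 𝔐 fun z : 𝔐.Num × 𝔐.Num => c z.1 z.2 :=
    fn_avg_polyDist (by fun_prop) (by fun_prop) (by fun_prop)
  obtain ⟨N, hN, hN'⟩ := Fn.exists_min
    (R := fun k N : 𝔐.Num => ∀ m, N ≤ m → ∀ n, N ≤ n → |c k m - c k n| ≤ hp k)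
    (Fn.all hPC (Fn.imp (by fun_prop) (Fn.all hPC (Fn.imp (by fun_prop) (Fn.le_K (Fn.abs_K
      (Fn.sub_K (hcf.comp (f := fun z : ((𝔐.Num × 𝔐.Num) × 𝔐.Num) × 𝔐.Num => (z.1.1.1, z.1.2))
        (by fun_prop))
      (hcf.comp (f := fun z : ((𝔐.Num × 𝔐.Num) × 𝔐.Num) × 𝔐.Num => (z.1.1.1, z.2))
        (by fun_prop)))) (by fun_prop))))))
    fun k => cauchy_avg _ _ (hp_pos k)
  have hNk : ∀ k n, N k ≤ n → |c k n - c k (N k)| ≤ hp k := fun k n hn =>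
    (hN' k).1 _ hn _ le_rfl
  have hSf : Fn 𝔐 fun k => c k (N k) := hcf.comp (f := fun k => (k, N k)) (by fun_prop)
  -- On a common fine grid: one hp k for each of the two Riemann sums, and 2 * hp k for moving each
  -- of `p` and `q` from k to l.
  have hS : ∀ k l, k ≤ l → |c k (N k) - c l (N l)| ≤ 6 * hp k := fun k l hkl => by
    refine le_of_forall_pos_le_add fun ε hε => ?_
    obtain ⟨M, hM⟩ := avg_polyDist_le (polyDistLE_of_step hPC hp' h hkl)
      (polyDistLE_of_step hPC hq' h' hkl) hε
    have h1 := hNk k (max M (max (N k) (N l))) ((le_max_left _ _).trans (le_max_right _ _))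
    have h2 := hNk l (max M (max (N k) (N l))) ((le_max_right _ _).trans (le_max_right _ _))
    have h3 := hM (max M (max (N k) (N l))) (le_max_left _ _)
    have h4 := hp_anti hkl
    rw [abs_sub_le_iff] at *
    constructor <;> linarith [h1.1, h1.2, h2.1, h2.2, h3.1, h3.2]
  obtain ⟨x, hx, hx'⟩ := exists_real_limit hPC hSf fun ε hε => by
    obtain ⟨k, hk⟩ := exists_hp_le (by linarith : 0 < ε / 12)
    refine ⟨k, fun m hm n hn => ?_⟩
    have h1 := hS k m hm
    have h2 := hS k n hn
    have h3 := hk k le_rfl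
    rw [abs_sub_le_iff] at *
    constructor <;> linarith [h1.1, h1.2, h2.1, h2.2]
  refine ⟨x, ⟨hx, fun ε hε => ?_⟩, fun r hr => hx.realLE fun ε hε => ?_⟩
  -- The seven parts are six from `hS` and one from `hNk`.
  · obtain ⟨k₀, hk₀⟩ := exists_hp_le (by linarith [K.val_lt_val.2 hε, K.val_zero (𝔐 := 𝔐)] :
      0 < K.val ε / 7)
    refine ⟨k₀, fun k hk => ?_⟩
    obtain ⟨y, hy⟩ := exists_isIntegral hPC (p k) (q k)
    refine ⟨y, hy, hy.1.realDistLE hx fun ε' hε' => ?_⟩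
    obtain ⟨M, hM⟩ := hy.val (lifts_polyEval_sub _ _) (half_pos hε')
    obtain ⟨M', hM'⟩ := hx' _ (half_pos hε')
    refine ⟨max (max M M') (max k (N k)), fun n hn => ?_⟩
    have hn1 := le_of_max_le_left hn
    have hn2 := le_of_max_le_right hn
    have h1 := hM n (le_of_max_le_left hn1)
    have h2 := hM' n (le_of_max_le_right hn1)
    have h3 := hS k n (le_of_max_le_left hn2)
    have h4 := hNk k n (le_of_max_le_right hn2)
    have h5 := hk₀ k hk
    rw [abs_sub_le_iff] at *
    constructor <;> linarith [h1.1, h1.2, h2.1, h2.2, h3.1, h3.2, h4.1, h4.2]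
  · obtain ⟨k₀, hk₀⟩ := hr
    obtain ⟨M, hM⟩ := hx' _ (half_pos hε)
    obtain ⟨l, hl⟩ := exists_hp_le (by linarith : 0 < ε / 4)
    refine ⟨max M (max k₀ l), fun n hn => ?_⟩
    have h1 := neg_le_of_abs_le (hM n (le_of_max_le_left hn))
    have h2 := hl n (le_of_max_le_right (le_of_max_le_right hn))
    obtain ⟨N₁, h3⟩ := hk₀ n (le_of_max_le_left (le_of_max_le_right hn)) (ε / 4) (by linarith)
    have h4 := h3 (max N₁ (N n)) (le_max_left _ _)
    have h5 := neg_le_of_abs_le (hNk n (max N₁ (N n)) (le_max_right _ _))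
    simp only [hc] at h1 h5
    linarith

/-! ## Thinning out sequences -/

/-- The sequences of colours `c j m` and `c j n` agree for `j < s`. -/
def Agree (c : 𝔐.Num → 𝔐.Num → 𝔐.Num) (s m n : 𝔐.Num) : Prop := ∀ j < s, c j m = c j n

/-- There are infinitely many `n` that agree with `t` up to `s`. -/
def InfAgree (c : 𝔐.Num → 𝔐.Num → 𝔐.Num) (s t : 𝔐.Num) : Prop := ∀ b, ∃ n, b < n ∧ Agree c s t n

section agree

variable {c : 𝔐.Num → 𝔐.Num → 𝔐.Num} {s t m n l : 𝔐.Num}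

theorem Agree.symm (h : Agree c s m n) : Agree c s n m := fun j hj => (h j hj).symm

theorem Agree.trans (h : Agree c s m n) (h' : Agree c s n l) : Agree c s m l := fun j hj =>
  (h j hj).trans (h' j hj)

theorem Agree.mono (h : Agree c s m n) (hts : t ≤ s) : Agree c t m n := fun j hj =>
  h j (hj.trans_le hts)

theorem Fn.agree (hc : Fn 𝔐 fun p : 𝔐.Num × 𝔐.Num => c p.1 p.2) {Γ : Type*} [Coded 𝔐 Γ]
    {s m n : Γ → 𝔐.Num} (hs : Fn 𝔐 s) (hm : Fn 𝔐 m) (hn : Fn 𝔐 n) :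
    Fn 𝔐 fun x => Agree c (s x) (m x) (n x) :=
  Fn.ball (Fn.eq (hc.comp (f := fun p : Γ × 𝔐.Num => (p.2, m p.1)) (by fun_prop))
    (hc.comp (f := fun p : Γ × 𝔐.Num => (p.2, n p.1)) (by fun_prop))) hs

theorem Fn.infAgree (hPC : ProjClosed 𝔐) (hc : Fn 𝔐 fun p : 𝔐.Num × 𝔐.Num => c p.1 p.2)
    {Γ : Type*} [Coded 𝔐 Γ] {s t : Γ → 𝔐.Num} (hs : Fn 𝔐 s) (ht : Fn 𝔐 t) :
    Fn 𝔐 fun x => InfAgree c (s x) (t x) :=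
  Fn.all hPC (Fn.ex hPC (Fn.and (by fun_prop) (Fn.agree hc (by fun_prop) (by fun_prop)
    (by fun_prop))))

/-- Infinite pigeonhole principle. If no colour recurred, each colour would have a last occurrence;
a common bound for these over the boundedly many colours contradicts infinitude. The function of
least bounds uses arithmetical minimisation. -/
theorem InfAgree.exists_succ (hPC : ProjClosed 𝔐) (hc : Fn 𝔐 fun p : 𝔐.Num × 𝔐.Num => c p.1 p.2)
    (hb : ∀ s, ∃ b, ∀ n, c s n ≤ b) (h : InfAgree c s t) :
    ∃ t', Agree c s t t' ∧ InfAgree c (s + 1) t' := by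
  obtain ⟨b, hb⟩ := hb s
  by_contra! hcon
  have key : ∀ r, ∃ B, ∀ n, B < n → Agree c s t n → c s n ≠ r := fun r => by
    by_contra! hr
    obtain ⟨t', -, ht', rfl⟩ := hr 0
    refine hcon t' ht' fun B => ?_
    obtain ⟨n, hn, htn, hcn⟩ := hr B
    refine ⟨n, hn, fun j hj => ?_⟩
    rcases (Num.basic.lt_succ j s).1 hj with hj | rfl
    · exact (ht'.symm.trans htn) j hj
    · exact hcn.symm
  obtain ⟨B, hB, hB'⟩ := Fn.exists_min
    (R := fun r B : 𝔐.Num => ∀ n, B < n → Agree c s t n → c s n ≠ r)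
    (Fn.all hPC (Fn.imp (by fun_prop) (Fn.imp (Fn.agree hc (by fun_prop) (by fun_prop)
      (by fun_prop)) (Fn.not (Fn.eq (hc.comp (f := fun p : (𝔐.Num × 𝔐.Num) × 𝔐.Num => (s, p.2))
        (by fun_prop)) (by fun_prop)))))) key
  obtain ⟨B₀, hB₀⟩ := Fn.exists_bound hB (b + 1)
  obtain ⟨n, hn, htn⟩ := h B₀
  exact (hB' (c s n)).1 n ((hB₀ _ (Num.lt_add_one_iff'.2 (hb n))).trans hn) htn rfl

/-- A recursion chooses representatives `T s` whose first s colours occur infinitely often, each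
extending the preceding choice. The representatives need not increase, so a second recursion picks
increasing indices with the same initial colours. -/
theorem exists_thin (hPC : ProjClosed 𝔐) (hc : Fn 𝔐 fun p : 𝔐.Num × 𝔐.Num => c p.1 p.2)
    (hb : ∀ s, ∃ b, ∀ n, c s n ≤ b) : ∃ g : 𝔐.Num → 𝔐.Num, Fn 𝔐 g ∧ (∀ n, g n < g (n + 1)) ∧
      ∀ s n, s ≤ n → Agree c s (g s) (g n) := by
  -- The implication makes the search total; off the relevant arguments the value is irrelevant.
  obtain ⟨G, hG, hG'⟩ := Fn.exists_min (Γ := 𝔐.Num × 𝔐.Num)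
    (R := fun p t' => InfAgree c p.1 p.2 → Agree c p.1 p.2 t' ∧ InfAgree c (p.1 + 1) t')
    (Fn.imp (Fn.infAgree hPC hc (by fun_prop) (by fun_prop))
      (Fn.and (Fn.agree hc (by fun_prop) (by fun_prop) (by fun_prop))
        (Fn.infAgree hPC hc (by fun_prop) (by fun_prop)))) fun p => by
    by_cases hp : InfAgree c p.1 p.2
    · obtain ⟨t', ht'⟩ := hp.exists_succ hPC hc hb
      exact ⟨t', fun _ => ht'⟩
    · exact ⟨0, fun h => (hp h).elim⟩
  obtain ⟨hT, hT0, hTs⟩ := isRec_irec (a := (0 : 𝔐.Num)) (G := fun s t => G (s, t)) hG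
  generalize irec (0 : 𝔐.Num) (fun s t => G (s, t)) = T at hT hT0 hTs
  have hinf : ∀ s, InfAgree c s (T s) := fun s => by
    refine Fn.induction (P := fun s => InfAgree c s (T s))
      (Fn.infAgree hPC hc (by fun_prop) (by fun_prop)) ?_ (fun s ih => ?_) s
    · exact fun b => ⟨b + 1, lt_add_one b, fun j hj => (not_lt_zero j hj).elim⟩
    · rw [hTs]; exact ((hG' (s, T s)).1 ih).2
  have hT' : ∀ s n, s ≤ n → Agree c s (T s) (T n) := fun s n hsn => by
    obtain ⟨i, rfl⟩ := Num.le_iff_exists.1 hsn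
    refine Fn.induction (P := fun i => Agree c s (T s) (T (s + i)))
      (Fn.agree hc (by fun_prop) (by fun_prop) (by fun_prop)) ?_ (fun i ih => ?_) i
    · rw [add_zero]; exact fun _ _ => rfl
    · refine ih.trans (Agree.mono (s := s + i) ?_ le_self_add)
      rw [← add_assoc, hTs]
      exact ((hG' (s + i, T (s + i))).1 (hinf _)).1
  obtain ⟨N, hN, hN'⟩ := Fn.exists_min (Γ := 𝔐.Num × 𝔐.Num)
    (R := fun p n => p.2 < n ∧ Agree c (p.1 + 1) (T (p.1 + 1)) n)
    (Fn.and (by fun_prop) (Fn.agree hc (by fun_prop) (by fun_prop) (by fun_prop)))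
    fun p => hinf _ _
  obtain ⟨hg, hg0, hgs⟩ := isRec_irec (a := (0 : 𝔐.Num)) (G := fun s t => N (s, t)) hN
  generalize irec (0 : 𝔐.Num) (fun s t => N (s, t)) = g at hg hg0 hgs
  have hgT : ∀ s, Agree c s (T s) (g s) := fun s => by
    rcases eq_or_ne s 0 with rfl | hs
    · exact fun j hj => (not_lt_zero j hj).elim
    · obtain ⟨k, hk⟩ := Num.lt_iff_exists.1 (lt_of_le_of_ne (Num.zero_le' s) hs.symm)
      rw [zero_add] at hk
      rw [← hk, hgs]
      exact (hN' (k, g k)).1.2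
  refine ⟨g, hg, fun n => ?_, fun s n hsn => ?_⟩
  · rw [hgs]; exact (hN' (n, g n)).1.1
  · exact ((hgT s).symm.trans (hT' s n hsn)).trans ((hgT n).mono hsn)

theorem strictMono_of_lt_succ {g : 𝔐.Num → 𝔐.Num} (hg : Fn 𝔐 g) (h : ∀ n, g n < g (n + 1))
    {m n : 𝔐.Num} (hmn : m < n) : g m < g n := by
  obtain ⟨k, rfl⟩ := Num.lt_iff_exists.1 hmn
  rw [← add_assoc]
  refine Fn.induction (P := fun k => g m < g (m + k + 1)) (by fun_prop) ?_ (fun k ih => ?_) k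
  · rw [add_zero]; exact h m
  · rw [← add_assoc]; exact ih.trans (h _)

end agree

/-! ## Arithmetical comprehension implies Helly's selection theorem -/

/-- Minimality of r puts both s + B and t + B between r * δ and (r + 1) * δ. For r = 0 the lower
bound comes from the bound B instead. -/
theorem abs_sub_le_of_least {B δ s t : K 𝔐} {r : 𝔐.Num} (hs : |s| ≤ B) (ht : |t| ≤ B)
    (hsr : s + B ≤ ((r + 1 : 𝔐.Num) : K 𝔐) * δ) (htr : t + B ≤ ((r + 1 : 𝔐.Num) : K 𝔐) * δ)
    (hsr' : ∀ r' < r, ¬ s + B ≤ ((r' + 1 : 𝔐.Num) : K 𝔐) * δ)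
    (htr' : ∀ r' < r, ¬ t + B ≤ ((r' + 1 : 𝔐.Num) : K 𝔐) * δ) : |s - t| ≤ δ := by
  have key : ∀ x : K 𝔐, |x| ≤ B → (∀ r' < r, ¬ x + B ≤ ((r' + 1 : 𝔐.Num) : K 𝔐) * δ) → r * δ ≤ x + B := by
    intro x hx h
    rcases eq_or_ne r 0 with rfl | hr
    · rw [K.ofNum_zero, zero_mul]
      linarith [neg_le_of_abs_le hx]
    · obtain ⟨k, hk⟩ := Num.lt_iff_exists.1 (lt_of_le_of_ne (Num.zero_le' r) hr.symm)
      rw [zero_add] at hk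
      rw [← hk] at h ⊢
      exact (not_le.1 (h k (lt_add_one k))).le
  have h1 := key s hs hsr'
  have h2 := key t ht htr'
  push_cast at hsr htr
  exact abs_sub_le_iff.2 ⟨by linarith, by linarith⟩

/-- A sequence of polynomials of bounded norm and variation has a subsequence that converges
fast. -/
theorem exists_fast_subsequence (hPC : ProjClosed 𝔐) {q : 𝔐.Num → 𝔐.Num} (hq : Fn 𝔐 q)
    {u v : K 𝔐} (hu : ∀ n, IntLE (fun x => |peval (q n) x|) u)
    (hv : ∀ n, IntLE (fun x => |dpeval (q n) x|) v) :
    ∃ g : 𝔐.Num → 𝔐.Num, Fn 𝔐 g ∧ (∀ m n, m < n → g m < g n) ∧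
      ∀ k n, k ≤ n → PolyDistLE (q (g k)) (q (g n)) (hp k) := by
  -- The grid at level k is so fine that the variation term of `polyDistLE_of_grid` uses half of the
  -- error 2^(-k); rounding the values uses the other half.
  obtain ⟨M, hM, hM'⟩ := Fn.exists_min
    (R := fun k M : 𝔐.Num => 0 < M ∧ (v + v) / (M : K 𝔐) ≤ hp (k + 1)) (by fun_prop) fun k => by
    obtain ⟨n, hn⟩ := exists_div_succ_le (v + v) (hp_pos (k + 1))
    exact ⟨n + 1, Num.succ_pos n, by push_cast; exact hn n le_rfl⟩
  have hMmono : ∀ {k l}, k ≤ l → M k ≤ M l := fun {k l} hkl => not_lt.1 fun hlt =>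
    (hM' k).2 _ hlt ⟨(hM' l).1.1, (hM' l).1.2.trans (hp_anti (add_le_add_left hkl 1))⟩
  set B : K 𝔐 := u + 1 + (v + v) with hB
  have hbound : ∀ k j n, j < M k → |peval (q n) (j / M k)| ≤ B := fun k j n hj =>
    abs_peval_le (hu n) (hv n) hj.le (hM' k).1.1
  -- The colour of `n` at `(k, j)` is the rounded value of the `n`-th polynomial at `j / M k`.
  obtain ⟨c, hc, hc'⟩ := Fn.exists_min (Γ := 𝔐.Num × 𝔐.Num)
    (R := fun p r => (unpair p.1).2 < M (unpair p.1).1 →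
      peval (q p.2) ((unpair p.1).2 / M (unpair p.1).1) + B ≤
        ((r + 1 : 𝔐.Num) : K 𝔐) * hp ((unpair p.1).1 + 1)) (Fn.imp (by fun_prop) (by fun_prop)) fun p => by
    obtain ⟨r, hr⟩ := K.exists_ofNum_ge
      ((peval (q p.2) ((unpair p.1).2 / M (unpair p.1).1) + B) / hp ((unpair p.1).1 + 1))
    refine ⟨r, fun _ => ?_⟩
    rw [div_le_iff₀ (hp_pos _)] at hr
    push_cast
    linarith [hp_pos ((unpair p.1).1 + 1)]
  obtain ⟨g, hg, hg_succ, hg'⟩ := exists_thin hPC (c := fun s n => c (s, n)) hc fun s => by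
    obtain ⟨b, hb⟩ := K.exists_ofNum_ge ((B + B) / hp ((unpair s).1 + 1))
    refine ⟨b, fun n => not_lt.1 fun hlt => (hc' (s, n)).2 b hlt fun hj => ?_⟩
    have h1 := le_of_abs_le (hbound _ _ n hj)
    rw [div_le_iff₀ (hp_pos _)] at hb
    push_cast
    linarith [hp_pos ((unpair s).1 + 1)]
  -- The code `pair k (M k)` exceeds the codes of all grid points of level k, so agreement up to it
  -- fixes every rounded value of that level.
  have hidx : ∀ {k l : 𝔐.Num}, k < l → pair k (M k) < pair l (M l) := fun {k l} hkl =>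
    pair_lt_of_add_lt (add_lt_add_of_lt_of_le hkl (hMmono hkl.le))
  refine ⟨fun k => g (pair k (M k)), by fun_prop, fun m n hmn =>
    strictMono_of_lt_succ hg hg_succ (hidx hmn), fun k n hkn => ?_⟩
  have hagree := hg' (pair k (M k)) (pair n (M n)) (by
    rcases hkn.eq_or_lt with rfl | h
    · exact le_rfl
    · exact (hidx h).le)
  refine (polyDistLE_of_grid (δ := hp (k + 1)) (hM' k).1.1 (fun j hj => ?_) (hv _) (hv _)).mono ?_
  · have e := hagree (pair k j) (pair_lt_of_add_lt (add_lt_add_right hj k))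
    have h1 := hc' (pair k j, g (pair k (M k)))
    have h2 := hc' (pair k j, g (pair n (M n)))
    simp only [unpair_pair, hj, true_imp_iff] at e h1 h2
    rw [← e] at h2
    exact abs_sub_le_of_least (hbound k j _ hj) (hbound k j _ hj) h1.1 h2.1 h1.2 h2.2
  · have := (hM' k).1.2
    linarith [hp_succ k]

/-- The n-th polynomial of f_n is within 2 * 2^(-n) of f_n, so it is enough to select from this
diagonal sequence of polynomials. -/
theorem ProjClosed.hst (hPC : ProjClosed 𝔐) : HST 𝔐 := by
  intro f w hf hw hBV u v hu hwv
  have hf' := isFun₂_iff.1 hf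
  have hfn : ∀ n, Fn 𝔐 (f n) := fun n => hf'.comp (f := fun k => (n, k)) (by fun_prop)
  have hstep : ∀ n k, PolyDistLE (f n k) (f n (k + 1)) (hp k) := fun n k => by
    rw [← Q.val_half_pow]
    exact ((hBV n).1.2 k).intLE (lifts_polyEval_sub _ _)
  have hq : Fn 𝔐 fun n => f n n := hf'.comp (f := fun n => (n, n)) (by fun_prop)
  -- The 1 is the slack in passing from the limit norm to a late polynomial, and the 2 bounds the
  -- distance from that polynomial back to index n.
  have hnorm : ∀ n, IntLE (fun x => |peval (f n n) x|) (K.val u + 1 + 2) := fun n => by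
    obtain ⟨x, hx, hxr⟩ := hu n
    obtain ⟨k₀, hk₀⟩ := hx.intLE (fun k => lifts_polyEval _) hxr one_pos
    have h1 := polyDistLE_of_step hPC (hfn n) (hstep n) (le_max_left n k₀)
    refine (IntLE.add (by fun_prop) (by fun_prop) (by fun_prop) (hk₀ _ (le_max_right n k₀)) h1
      fun x => ?_).mono ?_
    · linarith [abs_sub_abs_le_abs_sub (peval (f n n) x) (peval (f n (max n k₀)) x)]
    · have : hp n ≤ hp (0 : 𝔐.Num) := hp_anti (Num.zero_le' n)
      rw [hp_zero] at this
      linarith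
  obtain ⟨g, hg, hg_mono, hg'⟩ := exists_fast_subsequence hPC hq hnorm fun n =>
    (((hBV n).2 n).intLE (lifts_polyDeriv _)).mono (K.val_le_val.2 (hwv n))
  have hφ : Fn 𝔐 fun k => f (g k) (g k) := hq.comp hg
  have hφ_step : ∀ k, PolyDistLE (f (g k) (g k)) (f (g (k + 1)) (g (k + 1))) (hp k) := fun k =>
    hg' k (k + 1) (lt_add_one k).le
  refine ⟨fun k => f (g k) (g k), g, ⟨⟨hφ.isFun, fun k => ?_⟩, fun k => ?_⟩, hg.isFun, hg_mono,
    fun ε hε => ?_⟩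
  · refine PolyDistLE.integralLE hPC ?_
    rw [Q.val_half_pow]
    exact hφ_step k
  · exact ((hBV (g k)).2 (g k)).mono (hwv (g k))
  · have hε' : 0 < K.val ε := by rw [← K.val_zero]; exact K.val_lt_val.2 hε
    -- Moving along the sequence `f (g n)` costs 2 * hp (g n), and moving along the selected
    -- sequence costs hp n; since n ≤ g n, the total is at most 3 * hp n.
    obtain ⟨N, hN⟩ := exists_hp_le (by linarith : 0 < K.val ε / 3)
    refine ⟨N, fun n hn => ?_⟩
    obtain ⟨x, hx, hx'⟩ := exists_isLimNorm hPC (hfn (g n)) hφ (hstep (g n)) hφ_step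
    refine ⟨x, hx, hx' ε ⟨max n (g n), fun k hk => ?_⟩⟩
    have hgn : n ≤ g n := by
      refine Fn.induction (P := fun n => n ≤ g n) (by fun_prop) (Num.zero_le' _) (fun n ih => ?_) n
      exact Order.add_one_le_of_lt (ih.trans_lt (hg_mono _ _ (lt_add_one n)))
    refine ((polyDistLE_of_step hPC (hfn (g n)) (hstep (g n)) (le_of_max_le_right hk)).symm.trans
      (hg' n k (le_of_max_le_left hk))).mono ?_
    have h1 := hN n hn
    have h2 := hp_anti hgn
    linarith

end L2Structure
end SOA

theorem mainTheorem1 (𝔐 : SOA.L2Structure.{u}) (h : 𝔐.IsRCA0) : 𝔐.HST ↔ 𝔐.IsACA0 := by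
  have : Fact 𝔐.IsRCA0 := ⟨h⟩
  exact ⟨fun hH => (SOA.L2Structure.HST.projClosed hH).isACA0, fun hA => hA.projClosed.hst⟩
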